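/- Let $\gamma_{2k-1}=\big(\prod_{j<k}Z_j\big)X_k$ and $\gamma_{2k}=\big(\prod_{j<k}Z_j\big)Y_k$ ($k=1,\dots,n$) be the Majorana operators on $n$ qubits. A (possibly mixed) free-fermionic state is a state of the form $$\rho=U\Big(\bigotimes_{j=1}^n \tfrac{I+\lambda_j Z}{2}\Big)U^\dagger,\qquad \lambda_j\in[-1,1],$$ where the unitary $U$ satisfies $U^\dagger\gamma_\mu U=\sum_\nu Q_{\mu\nu}\gamma_\nu$ for all $\mu$, for some $Q\in \mathrm O(2n)$. Its correlation matrix, $\Gamma(\rho)_{\mu\nu}=-\tfrac i2\operatorname{Tr}([\gamma_\mu,\gamma_\nu]\rho)$, determines it uniquely. There is a computationally efficient quantum algorithm with the following property. Let $n\ge 1$, $\varepsilon\in(0,1)$, $\delta\in(0,1]$, and let $\rho$ be an unknown free-fermionic state of $n$ modes. Given $n$, $\lceil 1/\varepsilon\rceil$ and $\lceil 1/\delta\rceil$, the algorithm uses $$N\le K\,\frac{n^4}{\varepsilon^2}\log\frac{4n^2}{\delta}$$ copies of $\rho$, with a universal constant $K$ (that is, $N=O\big(\tfrac{n^4}{\varepsilon^2}\log\tfrac{n^2}{\delta}\big)$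 for $n\ge2$). It measures each copy separately: it runs on it a circuit of Clifford+$T$ gates on the $n$ qubits and then measures all the qubits in the computational basis. From the outcomes it computes an efficient classical description of a free-fermionic state $\hat\rho$, namely the correlation matrix of $\hat\rho$ with rational entries. With probability at least $1-\delta$, $$\|\hat\rho-\rho\|_1\le\varepsilon,\qquad \|A\|_1:=\operatorname{Tr}\sqrt{A^\dagger A}.$$ The total running time is polynomial in $n$, $1/\varepsilon$ and $\log(1/\delta)$: it counts the classical computation of the circuits, the quantum gates and measurements, and the classical processing of the outcomes, with classical computation on a random access machine with logarithmic cost (equivalent to Turing machines up to polynomial factors). -/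

import Mathlib

open scoped Matrix

noncomputable section

namespace FreeFermion

/-! ### States and operators of `n` qubits -/

/-- Labels of the computational basis of `n` qubits. -/
abbrev Basis (n : ℕ) : Type := Fin n → Fin 2

/-- Operators on the `n`-qubit space, as matrices in the computational basis. -/
abbrev Op (n : ℕ) : Type := Matrix (Basis n) (Basis n) ℂ

/-- The tensor product `A 0 ⊗ A 1 ⊗ ⋯ ⊗ A (n - 1)` of single-qubit matrices. -/
def tensor {n : ℕ} (A : Fin n → Matrix (Fin 2) (Fin 2) ℂ) : Op n :=
  Matrix.of fun x y => ∏ j, A j (x j) (y j)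

/-- The single-qubit matrix `A` acting on qubit `q`, the identity on the other qubits. -/
def onQubit {n : ℕ} (q : Fin n) (A : Matrix (Fin 2) (Fin 2) ℂ) : Op n :=
  tensor fun j => if j = q then A else 1

/-- The Pauli matrices. -/
def pauliX : Matrix (Fin 2) (Fin 2) ℂ := !![0, 1; 1, 0]

def pauliY : Matrix (Fin 2) (Fin 2) ℂ := !![0, -Complex.I; Complex.I, 0]

def pauliZ : Matrix (Fin 2) (Fin 2) ℂ := !![1, 0; 0, -1]

/-- The trace norm `‖A‖₁ = tr √(Aᴴ A)`, that is, the sum of the singular values of `A`. -/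
def traceNorm {ι : Type*} [Fintype ι] [DecidableEq ι] (A : Matrix ι ι ℂ) : ℝ :=
  ∑ i, Real.sqrt ((Matrix.isHermitian_conjTranspose_mul_self A).eigenvalues i)

/-! ### Free fermions -/

/-- Labels of the `2 n` Majorana operators: in the usual linear order
`γ₁, γ₂, …, γ₂ₙ`, the label `(k, 0)` stands for the first and `(k, 1)` for the second
Majorana operator of the mode `k`. -/
abbrev Maj (n : ℕ) : Type := Fin n × Fin 2

/-- The Majorana operators in the Jordan-Wigner representation:
`(∏_{j < k} Z_j) X_k` and `(∏_{j < k} Z_j) Y_k`. -/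
def majorana {n : ℕ} (μ : Maj n) : Op n :=
  tensor fun j =>
    if j < μ.1 then pauliZ
    else if j = μ.1 then (if μ.2 = 0 then pauliX else pauliY)
    else 1

/-- `U` is a free-fermionic (Gaussian) unitary associated with `Q ∈ O(2n)`. -/
def IsGaussianUnitary {n : ℕ} (Q : Matrix (Maj n) (Maj n) ℝ) (U : Op n) : Prop :=
  Q ∈ Matrix.orthogonalGroup (Maj n) ℝ ∧ U ∈ Matrix.unitaryGroup (Basis n) ℂ ∧
    ∀ μ, Uᴴ * majorana μ * U = ∑ ν, (Q μ ν : ℂ) • majorana ν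

/-- `ρ` is a (possibly mixed) free-fermionic state of `n` modes:
`ρ = U (⨂ⱼ (I + lamⱼ Z) / 2) Uᴴ` for a free-fermionic unitary `U` and `lamⱼ ∈ [-1, 1]`. -/
def IsFreeFermionic {n : ℕ} (ρ : Op n) : Prop :=
  ∃ (Q : Matrix (Maj n) (Maj n) ℝ) (U : Op n) (lam : Fin n → ℝ),
    IsGaussianUnitary Q U ∧ (∀ j, |lam j| ≤ 1) ∧
      ρ = U * tensor (fun j => (1 / 2 : ℂ) • (1 + (lam j : ℂ) • pauliZ)) * Uᴴ

/-- The correlation matrix `Γ(ρ)_{μ ν} = - (i / 2) tr([γ_μ, γ_ν] ρ)`. -/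
def correlationMatrix {n : ℕ} (ρ : Op n) : Matrix (Maj n) (Maj n) ℂ :=
  Matrix.of fun μ ν => -(Complex.I / 2) *
    ((majorana μ * majorana ν - majorana ν * majorana μ) * ρ).trace

/-! ### Quantum circuits and single-copy measurements -/

/-- Elementary gates on `n` qubits: the universal Clifford + T gate set. -/
inductive Gate (n : ℕ) : Type
  | H (q : Fin n)
  | S (q : Fin n)
  | T (q : Fin n)
  | CNOT (control target : Fin n) (h : control ≠ target)

namespace Gate

/-- The unitary matrix of a gate. -/
def mat {n : ℕ} : Gate n → Op n
  | H q => onQubit q (((Real.sqrt 2 : ℝ) : ℂ)⁻¹ • !![1, 1; 1, -1])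
  | S q => onQubit q !![1, 0; 0, Complex.I]
  | T q => onQubit q !![1, 0; 0, Complex.exp (Complex.I * (Real.pi / 4 : ℝ))]
  | CNOT c t _ => Matrix.of fun x y => if x = Function.update y t (y t + y c) then 1 else 0

/-- Code of a gate as a list of integers. -/
def code {n : ℕ} : Gate n → List ℤ
  | H q => [0, (q : ℕ)]
  | S q => [1, (q : ℕ)]
  | T q => [2, (q : ℕ)]
  | CNOT c t _ => [3, (c : ℕ), (t : ℕ)]

end Gate

/-- A circuit is a list of gates, applied from left to right. -/
abbrev Circuit (n : ℕ) : Type := List (Gate n)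

/-- The unitary matrix of a circuit. -/
def Circuit.mat {n : ℕ} (C : Circuit n) : Op n := C.foldl (fun V g => g.mat * V) 1

/-- Code of a list of circuits; the token `4` (measure all qubits in the computational basis)
ends every circuit. -/
def circuitsCode {n : ℕ} (Cs : List (Circuit n)) : List ℤ :=
  Cs.flatMap fun C => C.flatMap Gate.code ++ [4]

/-- Number of elementary quantum operations (gates and single-qubit measurements)
in a list of circuits. -/
def quantumOps {n : ℕ} (Cs : List (Circuit n)) : ℕ := (Cs.map fun C => C.length + n).sum

/-- The measurement record of a list of circuits: a basis label for each circuit. -/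
abbrev Outcomes {n : ℕ} (Cs : List (Circuit n)) : Type := Fin Cs.length → Basis n

/-- Code of a measurement record: the measured bits, one circuit after the other. -/
def outcomesCode {n : ℕ} {Cs : List (Circuit n)} (x : Outcomes Cs) : List ℤ :=
  (List.finRange Cs.length).flatMap fun i =>
    (List.finRange n).map fun q => (((x i q : Fin 2) : ℕ) : ℤ)

/-- The probability of the record `x` when every circuit is run on its own copy of `ρ` and all
qubits are then measured in the computational basis. -/
def outcomeProb {n : ℕ} (ρ : Op n) {Cs : List (Circuit n)} (x : Outcomes Cs) : ℝ :=
  ∏ i : Fin Cs.length,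
    ((Circuit.mat (Cs.get i) * ρ * (Circuit.mat (Cs.get i))ᴴ) (x i) (x i)).re

open Classical in
/-- The probability that the measurement record satisfies `P`. -/
def recordProb {n : ℕ} (ρ : Op n) (Cs : List (Circuit n)) (P : Outcomes Cs → Prop) : ℝ :=
  ∑ x : Outcomes Cs, if P x then outcomeProb ρ x else 0

/-! ### Classical computation: random access machine with logarithmic cost -/

/-- Memory: integer cells with integer addresses. -/
abbrev Mem : Type := ℤ → ℤ

/-- The bit length of an integer. -/
def bitLen (z : ℤ) : ℕ := z.natAbs.size

/-- Expressions. `cell e` is the content of the cell whose address is the value of `e`. -/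
inductive Expr : Type
  | const (c : ℤ)
  | cell (e : Expr)
  | add (e₁ e₂ : Expr)
  | sub (e₁ e₂ : Expr)
  | mul (e₁ e₂ : Expr)
  | div (e₁ e₂ : Expr)

/-- Value of an expression (`div` is the integer quotient). -/
def Expr.eval (M : Mem) : Expr → ℤ
  | const c => c
  | cell e => M (e.eval M)
  | add e₁ e₂ => e₁.eval M + e₂.eval M
  | sub e₁ e₂ => e₁.eval M - e₂.eval M
  | mul e₁ e₂ => e₁.eval M * e₂.eval M
  | div e₁ e₂ => e₁.eval M / e₂.eval M

/-- Cost of evaluating an expression: each operation costs one plus the bit lengths of its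
operands and of its result. -/
def Expr.cost (M : Mem) : Expr → ℕ
  | const c => 1 + bitLen c
  | cell e => e.cost M + (1 + bitLen (M (e.eval M)))
  | add e₁ e₂ => e₁.cost M + e₂.cost M + (1 + bitLen (e₁.eval M + e₂.eval M))
  | sub e₁ e₂ => e₁.cost M + e₂.cost M + (1 + bitLen (e₁.eval M - e₂.eval M))
  | mul e₁ e₂ => e₁.cost M + e₂.cost M + (1 + bitLen (e₁.eval M * e₂.eval M))
  | div e₁ e₂ => e₁.cost M + e₂.cost M + (1 + bitLen (e₁.eval M / e₂.eval M))

/-- Programs. `store a e` writes the value of `e` into the cell with address the value of `a`;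
`emit e` appends the value of `e` to the output; the tests of `ite` and `loop` are `0 < e`. -/
inductive Prog : Type
  | skip
  | store (a e : Expr)
  | emit (e : Expr)
  | seq (p q : Prog)
  | ite (e : Expr) (p q : Prog)
  | loop (e : Expr) (p : Prog)

/-- `Exec p M t M' out`: started with memory `M`, the program `p` halts after time `t` with
memory `M'`, having produced the output `out`. -/
inductive Exec : Prog → Mem → ℕ → Mem → List ℤ → Prop
  | skip (M : Mem) : Exec Prog.skip M 1 M []
  | store (a e : Expr) (M : Mem) :
      Exec (Prog.store a e) M (a.cost M + e.cost M + 1)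
        (Function.update M (a.eval M) (e.eval M)) []
  | emit (e : Expr) (M : Mem) : Exec (Prog.emit e) M (e.cost M + 1) M [e.eval M]
  | seq {p q : Prog} {M M₁ M₂ : Mem} {t₁ t₂ : ℕ} {o₁ o₂ : List ℤ}
      (hp : Exec p M t₁ M₁ o₁) (hq : Exec q M₁ t₂ M₂ o₂) :
      Exec (Prog.seq p q) M (t₁ + t₂) M₂ (o₁ ++ o₂)
  | ite_pos {e : Expr} {p : Prog} (q : Prog) {M M' : Mem} {t : ℕ} {o : List ℤ}
      (h : 0 < e.eval M) (hp : Exec p M t M' o) :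
      Exec (Prog.ite e p q) M (e.cost M + 1 + t) M' o
  | ite_neg {e : Expr} (p : Prog) {q : Prog} {M M' : Mem} {t : ℕ} {o : List ℤ}
      (h : e.eval M ≤ 0) (hq : Exec q M t M' o) :
      Exec (Prog.ite e p q) M (e.cost M + 1 + t) M' o
  | loop_pos {e : Expr} {p : Prog} {M M₁ M₂ : Mem} {t₁ t₂ : ℕ} {o₁ o₂ : List ℤ}
      (h : 0 < e.eval M) (hp : Exec p M t₁ M₁ o₁) (hl : Exec (Prog.loop e p) M₁ t₂ M₂ o₂) :
      Exec (Prog.loop e p) M (e.cost M + 1 + t₁ + t₂) M₂ (o₁ ++ o₂)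
  | loop_neg {e : Expr} (p : Prog) {M : Mem} (h : e.eval M ≤ 0) :
      Exec (Prog.loop e p) M (e.cost M + 1) M []

/-- Initial memory: the input stands in the cells `0, 1, 2, …`; all other cells are `0`. -/
def inputMem (xs : List ℤ) : Mem := fun a => if 0 ≤ a then xs.getD a.toNat 0 else 0

/-- On input `xs` the program `p` halts in time `t` with output `ys`. -/
def Computes (p : Prog) (xs : List ℤ) (t : ℕ) (ys : List ℤ) : Prop :=
  ∃ M', Exec p (inputMem xs) t M' ys

/-! ### Classical description of a free-fermionic state -/

/-- The entries of a matrix indexed by the Majorana labels, row after row, in the usual order. -/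
def rowMajor {n : ℕ} (A : Matrix (Maj n) (Maj n) ℤ) : List ℤ :=
  (List.finRange n ×ˢ List.finRange 2).flatMap fun μ =>
    (List.finRange n ×ˢ List.finRange 2).map fun ν => A μ ν

/-- The list `ys` of integers is a classical description of the free-fermionic state `σ`: it
consists of a common denominator `D` and the entries of an integer matrix `A` such that `A / D`
is the correlation matrix of `σ` (which determines a free-fermionic state uniquely). -/
def Describes {n : ℕ} (ys : List ℤ) (σ : Op n) : Prop :=
  ∃ (D : ℤ) (A : Matrix (Maj n) (Maj n) ℤ), 0 < D ∧ ys = D :: rowMajor A ∧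
    IsFreeFermionic σ ∧ correlationMatrix σ = Matrix.of fun μ ν => (A μ ν : ℂ) / (D : ℂ)

end FreeFermion

end

open FreeFermion

/-! ### Cost calculus for programs with bounded loops and bounded bit length. -/

open FreeFermion
open scoped Matrix

namespace FreeFermion

/-! ### Running times of loop programs -/

/-! Measurement. For modes `k < l`, the product `γ_(k,a) γ_(l,b)` is, up to a phase, a Pauli string
with X or Y on qubits `k` and `l` and Z on every qubit strictly between. All such strings with the
same `s = k + l` become nested in the pairing `q ↔ s - q`: the ends form one pair, the Z's inside
form pairs ZZ, and a middle qubit, if any, carries a single Z. A Bell measurement of every pair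
determines XX, YY and ZZ at once. With an additional phase gate on the larger qubit it determines
XY, YX and ZZ. Hence fewer than `4n` settings `(s, τ)` reach all correlations, and `4n` batches of
`m` copies suffice (`bellCircuit_conj`). A Chernoff bound and a union bound make all entries
accurate to `t` (`GaussianForm.one_sub_le_recordProb`).

Rounding. The matrix of estimates is antisymmetric but need not be a contraction, so it may belong
to no state. It is turned into a symmetric matrix by the dilation with blocks `0, -A, A, 0`. The
eigenvalues should then be clipped to `[-1, 1]`, which costs at most a constant factor in Frobenius
distance to the true matrix (`ActsOn.sum_sq_sub_le`). Exact clipping is irrational, so it is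
replaced by a Bernstein polynomial of degree `L`. This polynomial has values exactly in `[-1, 1]`,
and its error is controlled by the variance of the binomial law (`abs_deCasteljau_clip_sub_le`). It
is evaluated in integers by de Casteljau's scheme on matrices (`layerMat_actsOn`). The
antisymmetrized lower left block is therefore a rational antisymmetric contraction, and every such
matrix is the correlation matrix of a free-fermionic state (`exists_gaussianForm_of_contraction`).

Continuity. With exterior multiplication by Majorana vectors as superoperators, a state is `2 ^
(-n)` times the exponential of a quadratic form, linear in the correlation matrix, applied to the
identity (`GaussianForm.eq_exp`). Quadratic forms commute, so along the segment between two
correlation matrices the derivative of the state is the quadratic form of the difference applied to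
a state again. In the normal modes of the difference, each mode with value `d j` contributes at most
`|d j|` in trace norm. Hence the trace distance is at most the sum of the `|d j|`
(`norm_trace_mul_sub_le`), and Cauchy-Schwarz gives a Frobenius bound. Entrywise accuracy of order
`ε / n ^ (3/2)` is then enough, that is `m` of order `n ^ 3 / ε ^ 2` times the logarithm, and `n ^ 4
/ ε ^ 2` in total.

Complexity. Programs are bounded by a weight, the loop depth, the number `Y` of loop rounds and the
bit length `β` of all cells (`Runs`). All integers of the scheme have polynomially many bits
(`abs_layers_le`). -/

/-- A bound for the bit growth of an expression. -/
def Expr.bits : Expr → ℕ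
  | const c => 1 + bitLen c
  | cell _ => 1
  | add a b => a.bits + b.bits
  | sub a b => a.bits + b.bits
  | mul a b => a.bits + b.bits
  | div a b => a.bits + b.bits

/-- A weight bounding the cost of an expression. -/
def Expr.wt : Expr → ℕ
  | const c => 1 + bitLen c
  | cell e => e.wt + 2
  | add a b => a.wt + b.wt + (1 + (a.bits + b.bits))
  | sub a b => a.wt + b.wt + (1 + (a.bits + b.bits))
  | mul a b => a.wt + b.wt + (1 + (a.bits + b.bits))
  | div a b => a.wt + b.wt + (1 + (a.bits + b.bits))

/-- All cells have absolute value at most `2 ^ β`. -/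
def MemBd (β : ℕ) (M : Mem) : Prop := ∀ a, |M a| ≤ 2 ^ β

theorem natAbs_lt_two_pow_bitLen (z : ℤ) : |z| < 2 ^ bitLen z := by
  have := Nat.lt_size_self z.natAbs
  rw [Int.abs_eq_natAbs]
  exact_mod_cast this

theorem bitLen_le_of_lt {z : ℤ} {k : ℕ} (h : |z| < 2 ^ k) : bitLen z ≤ k := by
  rw [bitLen, Nat.size_le]
  rw [Int.abs_eq_natAbs] at h
  exact_mod_cast h

theorem Expr.bits_pos (e : Expr) : 1 ≤ e.bits := by
  induction e <;> simp only [Expr.bits] <;> omega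

theorem abs_ediv_le (x y : ℤ) : |x / y| ≤ |x| := by
  rw [Int.abs_eq_natAbs, Int.abs_eq_natAbs]
  exact_mod_cast Int.natAbs_ediv_le_natAbs x y

theorem two_pow_add_le {x y : ℕ} (hx : 1 ≤ x) (hy : 1 ≤ y) :
    (2 : ℤ) ^ x + 2 ^ y ≤ 2 ^ (x + y) := by
  have h1 : (2 : ℤ) ≤ 2 ^ x := by
    calc (2 : ℤ) = 2 ^ 1 := by norm_num
      _ ≤ 2 ^ x := pow_le_pow_right₀ (by norm_num) hx
  have h2 : (2 : ℤ) ≤ 2 ^ y := by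
    calc (2 : ℤ) = 2 ^ 1 := by norm_num
      _ ≤ 2 ^ y := pow_le_pow_right₀ (by norm_num) hy
  rw [pow_add]
  nlinarith

/-- A cell read is worth `β + 1` bits and a constant its own length. Bit lengths add under
multiplication, and since both operands have at least one bit, adding them also covers sums,
differences and quotients. -/
theorem Expr.abs_eval_lt {β : ℕ} {M : Mem} (hM : MemBd β M) (e : Expr) :
    |e.eval M| < 2 ^ (e.bits * (β + 1)) := by
  have key : ∀ (a b : Expr) (z : ℤ), |a.eval M| < 2 ^ (a.bits * (β + 1)) →
      |b.eval M| < 2 ^ (b.bits * (β + 1)) → |z| ≤ |a.eval M| + |b.eval M| →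
      |z| < 2 ^ ((a.bits + b.bits) * (β + 1)) := by
    intro a b z ha hb hz
    have h := two_pow_add_le (x := a.bits * (β + 1)) (y := b.bits * (β + 1))
      (Nat.mul_pos a.bits_pos (by omega)) (Nat.mul_pos b.bits_pos (by omega))
    rw [add_mul]
    omega
  induction e with
  | const c =>
    refine (natAbs_lt_two_pow_bitLen c).trans_le (pow_le_pow_right₀ (by norm_num) ?_)
    show _ ≤ (1 + bitLen c) * (β + 1)
    nlinarith
  | cell e ih =>
    refine (hM _).trans_lt (pow_lt_pow_right₀ (by norm_num) ?_)
    simp [Expr.bits]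
  | add a b iha ihb => exact key a b _ iha ihb (abs_add_le _ _)
  | sub a b iha ihb => exact key a b _ iha ihb (abs_sub _ _)
  | mul a b iha ihb =>
    simp only [Expr.eval, Expr.bits, abs_mul, add_mul, pow_add]
    exact mul_lt_mul'' iha ihb (abs_nonneg _) (abs_nonneg _)
  | div a b iha ihb =>
    exact key a b _ iha ihb ((abs_ediv_le _ _).trans (le_add_of_nonneg_right (abs_nonneg _)))

theorem Expr.cost_le {β : ℕ} {M : Mem} (hM : MemBd β M) (e : Expr) :
    e.cost M ≤ e.wt * (β + 1) := by
  have key : ∀ (a b : Expr) (z : ℤ), a.cost M ≤ a.wt * (β + 1) → b.cost M ≤ b.wt * (β + 1) →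
      |z| < 2 ^ ((a.bits + b.bits) * (β + 1)) →
      a.cost M + b.cost M + (1 + bitLen z) ≤
        (a.wt + b.wt + (1 + (a.bits + b.bits))) * (β + 1) := by
    intro a b z ha hb hz
    have := bitLen_le_of_lt hz
    nlinarith
  induction e with
  | const c =>
    show 1 + bitLen c ≤ (1 + bitLen c) * (β + 1)
    nlinarith
  | cell e ih =>
    have h := bitLen_le_of_lt ((hM (e.eval M)).trans_lt
      (pow_lt_pow_right₀ (by norm_num : (1 : ℤ) < 2) (Nat.lt_succ_self β)))
    show e.cost M + (1 + bitLen (M (e.eval M))) ≤ (e.wt + 2) * (β + 1)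
    rw [add_mul]
    omega
  | add a b iha ihb => exact key a b _ iha ihb ((add a b).abs_eval_lt hM)
  | sub a b iha ihb => exact key a b _ iha ihb ((sub a b).abs_eval_lt hM)
  | mul a b iha ihb => exact key a b _ iha ihb ((mul a b).abs_eval_lt hM)
  | div a b iha ihb => exact key a b _ iha ihb ((div a b).abs_eval_lt hM)

/-- A weight bounding the cost of a program per nested loop iteration. -/
def Prog.wt : Prog → ℕ
  | skip => 1
  | store a e => a.wt + e.wt + 1
  | emit e => e.wt + 1
  | seq p q => p.wt + q.wt
  | ite e p q => e.wt + 1 + (p.wt + q.wt)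
  | loop e p => e.wt + 1 + p.wt

/-- The depth of the nesting of loops. -/
def Prog.depth : Prog → ℕ
  | skip => 0
  | store _ _ => 0
  | emit _ => 0
  | seq p q => max p.depth q.depth
  | ite _ p q => max p.depth q.depth
  | loop _ p => p.depth + 1

/-- On memories with cells of at most `β` bits, `p` runs from `M` to `M'` with output `o`, keeps
the cells within `β` bits and takes the time of a program whose loops have fewer than `Y`
iterations. -/
def Runs (β Y : ℕ) (p : Prog) (M M' : Mem) (o : List ℤ) : Prop :=
  MemBd β M → MemBd β M' ∧ ∃ t ≤ p.wt * Y ^ p.depth * (β + 1), Exec p M t M' o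

variable {β Y : ℕ}

theorem Runs.store {a e : Expr} {M : Mem} {x y : ℤ} (ha : a.eval M = x) (he : e.eval M = y)
    (hy : |y| ≤ 2 ^ β) : Runs β Y (Prog.store a e) M (Function.update M x y) [] := by
  intro hM
  subst ha he
  refine ⟨fun b => ?_, _, ?_, Exec.store a e M⟩
  · by_cases h : b = a.eval M
    · subst h; simpa using hy
    · rw [Function.update_of_ne h]; exact hM b
  · have h1 := a.cost_le hM
    have h2 := e.cost_le hM
    simp only [Prog.wt, Prog.depth, pow_zero, mul_one]
    nlinarith

theorem Runs.emit {e : Expr} {M : Mem} {y : ℤ} (he : e.eval M = y) :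
    Runs β Y (Prog.emit e) M M [y] := by
  intro hM
  subst he
  refine ⟨hM, _, ?_, Exec.emit e M⟩
  have h2 := e.cost_le hM
  simp only [Prog.wt, Prog.depth, pow_zero, mul_one]
  nlinarith

theorem Runs.skip {M : Mem} : Runs β Y Prog.skip M M [] := by
  intro hM
  refine ⟨hM, 1, ?_, Exec.skip M⟩
  simp [Prog.wt, Prog.depth]

theorem Runs.seq {p q : Prog} {M M₁ M₂ : Mem} {o₁ o₂ : List ℤ} (hY : 1 ≤ Y)
    (hp : Runs β Y p M M₁ o₁) (hq : MemBd β M₁ → Runs β Y q M₁ M₂ o₂) :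
    Runs β Y (Prog.seq p q) M M₂ (o₁ ++ o₂) := by
  intro hM
  obtain ⟨hM₁, t₁, ht₁, h₁⟩ := hp hM
  obtain ⟨hM₂, t₂, ht₂, h₂⟩ := hq hM₁ hM₁
  refine ⟨hM₂, _, ?_, Exec.seq h₁ h₂⟩
  have e1 : Y ^ p.depth ≤ Y ^ max p.depth q.depth := Nat.pow_le_pow_right hY (le_max_left _ _)
  have e2 : Y ^ q.depth ≤ Y ^ max p.depth q.depth := Nat.pow_le_pow_right hY (le_max_right _ _)
  calc t₁ + t₂ ≤ p.wt * Y ^ max p.depth q.depth * (β + 1) +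
        q.wt * Y ^ max p.depth q.depth * (β + 1) := by
        refine add_le_add (ht₁.trans ?_) (ht₂.trans ?_) <;> gcongr
    _ = _ := by simp only [Prog.wt, Prog.depth]; ring

theorem Runs.ite_pos {e : Expr} {p q : Prog} {M M' : Mem} {o : List ℤ} (hY : 1 ≤ Y)
    (he : 0 < e.eval M) (hp : Runs β Y p M M' o) : Runs β Y (Prog.ite e p q) M M' o := by
  intro hM
  obtain ⟨hM₁, t₁, ht₁, h₁⟩ := hp hM
  refine ⟨hM₁, _, ?_, Exec.ite_pos q he h₁⟩
  have h2 := e.cost_le hM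
  have e1 : Y ^ p.depth ≤ Y ^ max p.depth q.depth := Nat.pow_le_pow_right hY (le_max_left _ _)
  have e0 : 1 ≤ Y ^ max p.depth q.depth := Nat.one_le_pow _ _ hY
  calc e.cost M + 1 + t₁ ≤ (e.wt + 1) * 1 * (β + 1) + p.wt * Y ^ p.depth * (β + 1) + 0 := by
        nlinarith
    _ ≤ (e.wt + 1) * Y ^ max p.depth q.depth * (β + 1) +
        p.wt * Y ^ max p.depth q.depth * (β + 1) +
        q.wt * Y ^ max p.depth q.depth * (β + 1) := by gcongr; exact Nat.zero_le _
    _ = _ := by simp only [Prog.wt, Prog.depth]; ring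

theorem Runs.ite_neg {e : Expr} {p q : Prog} {M M' : Mem} {o : List ℤ} (hY : 1 ≤ Y)
    (he : e.eval M ≤ 0) (hq : Runs β Y q M M' o) : Runs β Y (Prog.ite e p q) M M' o := by
  intro hM
  obtain ⟨hM₁, t₁, ht₁, h₁⟩ := hq hM
  refine ⟨hM₁, _, ?_, Exec.ite_neg p he h₁⟩
  have h2 := e.cost_le hM
  have e1 : Y ^ q.depth ≤ Y ^ max p.depth q.depth := Nat.pow_le_pow_right hY (le_max_right _ _)
  have e0 : 1 ≤ Y ^ max p.depth q.depth := Nat.one_le_pow _ _ hY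
  calc e.cost M + 1 + t₁ ≤ (e.wt + 1) * 1 * (β + 1) + 0 + q.wt * Y ^ q.depth * (β + 1) := by
        nlinarith
    _ ≤ (e.wt + 1) * Y ^ max p.depth q.depth * (β + 1) +
        p.wt * Y ^ max p.depth q.depth * (β + 1) +
        q.wt * Y ^ max p.depth q.depth * (β + 1) := by gcongr; exact Nat.zero_le _
    _ = _ := by simp only [Prog.wt, Prog.depth]; ring

/-- `inv c` describes the memory after `c` rounds. The extra unit in `N + 1 ≤ Y` pays for the last,
failing test, and one more factor `Y` is what the increased depth provides. -/
theorem Runs.loop {e : Expr} {p : Prog} {N : ℕ} (inv : ℕ → Mem → Prop) (o : ℕ → List ℤ)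
    (hY : N + 1 ≤ Y)
    (hpos : ∀ c < N, ∀ M, inv c M → 0 < e.eval M) (hneg : ∀ M, inv N M → e.eval M ≤ 0)
    (hbody : ∀ c < N, ∀ M, MemBd β M → inv c M → ∃ M', Runs β Y p M M' (o c) ∧ inv (c + 1) M')
    {M : Mem} (hM : MemBd β M) (h0 : inv 0 M) :
    ∃ M', Runs β Y (Prog.loop e p) M M' ((List.range N).flatMap o) ∧ inv N M' := by
  -- Induction on the number `j` of rounds still to come, with the elapsed number `c` kept general.
  have main : ∀ j c, c + j = N → ∀ M, MemBd β M → inv c M → ∃ M', MemBd β M' ∧ inv N M' ∧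
      ∃ t ≤ (j * ((e.wt + 1 + p.wt) * Y ^ p.depth) + (e.wt + 1)) * (β + 1),
        Exec (Prog.loop e p) M t M' ((List.range' c j).flatMap o) := by
    intro j
    induction j with
    | zero =>
      intro c hc M hM hi
      obtain rfl : c = N := by omega
      refine ⟨M, hM, hi, _, ?_, Exec.loop_neg p (hneg M hi)⟩
      have := e.cost_le hM
      nlinarith
    | succ j ih =>
      intro c hc M hM hi
      obtain ⟨M₁, h₁, hi₁⟩ := hbody c (by omega) M hM hi
      obtain ⟨hM₁, t₁, ht₁, x₁⟩ := h₁ hM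
      obtain ⟨M₂, hM₂, hi₂, t₂, ht₂, x₂⟩ := ih (c + 1) (by omega) M₁ hM₁ hi₁
      refine ⟨M₂, hM₂, hi₂, _, ?_, by
        simpa [List.range'_succ] using Exec.loop_pos (hpos c (by omega) M hi) x₁ x₂⟩
      have h3 := e.cost_le hM
      have e0 : 1 ≤ Y ^ p.depth := Nat.one_le_pow _ _ (by omega)
      calc e.cost M + 1 + t₁ + t₂ ≤ (e.wt + 1) * 1 * (β + 1) + p.wt * Y ^ p.depth * (β + 1) +
            (j * ((e.wt + 1 + p.wt) * Y ^ p.depth) + (e.wt + 1)) * (β + 1) := by nlinarith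
        _ ≤ (e.wt + 1) * Y ^ p.depth * (β + 1) + p.wt * Y ^ p.depth * (β + 1) +
            (j * ((e.wt + 1 + p.wt) * Y ^ p.depth) + (e.wt + 1)) * (β + 1) := by gcongr
        _ = _ := by ring
  obtain ⟨M', hM', hi', t, ht, x⟩ := main N 0 (by omega) M hM h0
  refine ⟨M', fun _ => ⟨hM', t, ht.trans ?_, by rwa [List.range_eq_range']⟩, hi'⟩
  have e0 : 1 ≤ Y ^ p.depth := Nat.one_le_pow _ _ (by omega)
  calc (N * ((e.wt + 1 + p.wt) * Y ^ p.depth) + (e.wt + 1)) * (β + 1)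
      ≤ (N * ((e.wt + 1 + p.wt) * Y ^ p.depth) + (e.wt + 1 + p.wt) * Y ^ p.depth) * (β + 1) := by
        gcongr; nlinarith [Nat.zero_le (p.wt)]
    _ = (N + 1) * ((e.wt + 1 + p.wt) * Y ^ p.depth) * (β + 1) := by ring
    _ ≤ Y * ((e.wt + 1 + p.wt) * Y ^ p.depth) * (β + 1) := by gcongr
    _ = _ := by simp only [Prog.wt, Prog.depth]; ring

/-- The content of the cell with a fixed address. -/
abbrev Expr.var (i : ℤ) : Expr := Expr.cell (Expr.const i)

/-- Assignment to the cell with a fixed address. -/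
abbrev Prog.set (i : ℤ) (e : Expr) : Prog := Prog.store (Expr.const i) e

/-- Repeat `p` for the values `0, 1, …` below `e` of the cell `i`. -/
def Prog.forTo (i : ℤ) (e : Expr) (p : Prog) : Prog :=
  Prog.seq (Prog.set i (Expr.const 0))
    (Prog.loop (Expr.sub e (Expr.var i))
      (Prog.seq p (Prog.set i (Expr.add (Expr.var i) (Expr.const 1)))))

/-- The body may use any cells but must leave the counter at `c`; its invariant is required only
after the increment. -/
theorem Runs.forTo {i : ℤ} {e : Expr} {p : Prog} {N : ℕ} (inv : ℕ → Mem → Prop)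
    (o : ℕ → List ℤ) (hY : N + 1 ≤ Y) (hβ : (N : ℤ) ≤ 2 ^ β)
    (hinv : ∀ c ≤ N, ∀ M, inv c M → M i = c ∧ e.eval M = N)
    (hbody : ∀ c < N, ∀ M, MemBd β M → inv c M → ∃ M', Runs β Y p M M' (o c) ∧ M' i = c ∧
      inv (c + 1) (Function.update M' i (c + 1)))
    {M : Mem} (hM : MemBd β M) (h0 : inv 0 (Function.update M i 0)) :
    ∃ M', Runs β Y (Prog.forTo i e p) M M' ((List.range N).flatMap o) ∧ inv N M' := by
  have s0 : Runs β Y (Prog.set i (Expr.const 0)) M (Function.update M i 0) [] :=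
    Runs.store rfl rfl (by simp)
  obtain ⟨M', h, hi⟩ := Runs.loop (β := β) (Y := Y) (e := Expr.sub e (Expr.var i))
    (p := Prog.seq p (Prog.set i (Expr.add (Expr.var i) (Expr.const 1)))) (N := N) inv o hY
    (fun c hc M hi => by
      obtain ⟨h1, h2⟩ := hinv c hc.le M hi
      simp only [Expr.eval, h1, h2]; omega)
    (fun M hi => by
      obtain ⟨h1, h2⟩ := hinv N le_rfl M hi
      simp [Expr.eval, h1, h2])
    (fun c hc M hM hi => by
      obtain ⟨M₁, h₁, hc₁, hi₁⟩ := hbody c hc M hM hi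
      refine ⟨_, ?_, hi₁⟩
      rw [← List.append_nil (o c)]
      refine Runs.seq (by omega) h₁ fun _ => Runs.store rfl (by simp [Expr.eval, hc₁]) ?_
      rw [abs_of_nonneg (by positivity)]
      exact le_trans (by exact_mod_cast hc) hβ)
    (s0 hM).1 h0
  have hs := Runs.seq (Y := Y) (by omega) s0 fun _ => h
  rw [List.nil_append] at hs
  exact ⟨M', hs, hi⟩

end FreeFermion

/-! ### Programs that compute the number of repetitions and print the circuits. -/

open FreeFermion
open scoped Matrix

namespace FreeFermion

instance : Add Expr := ⟨Expr.add⟩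
instance : Sub Expr := ⟨Expr.sub⟩
instance : Mul Expr := ⟨Expr.mul⟩
instance : Div Expr := ⟨Expr.div⟩
instance (k : ℕ) : OfNat Expr k := ⟨Expr.const k⟩

@[simp] theorem Expr.eval_add' (M : Mem) (a b : Expr) : (a + b).eval M = a.eval M + b.eval M := rfl
@[simp] theorem Expr.eval_sub' (M : Mem) (a b : Expr) : (a - b).eval M = a.eval M - b.eval M := rfl
@[simp] theorem Expr.eval_mul' (M : Mem) (a b : Expr) : (a * b).eval M = a.eval M * b.eval M := rfl
@[simp] theorem Expr.eval_div' (M : Mem) (a b : Expr) : (a / b).eval M = a.eval M / b.eval M := rfl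
@[simp] theorem Expr.eval_ofNat' (M : Mem) (k : ℕ) [k.AtLeastTwo] :
    (ofNat(k) : Expr).eval M = (ofNat(k) : ℤ) := rfl
@[simp] theorem Expr.eval_zero' (M : Mem) : (0 : Expr).eval M = 0 := rfl
@[simp] theorem Expr.eval_one' (M : Mem) : (1 : Expr).eval M = 1 := rfl
@[simp] theorem Expr.eval_cell' (M : Mem) (e : Expr) : (Expr.cell e).eval M = M (e.eval M) := rfl
@[simp] theorem Expr.eval_const' (M : Mem) (k : ℤ) : (Expr.const k).eval M = k := rfl

infixr:60 " ;; " => Prog.seq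

variable {β Y : ℕ}

theorem Runs.seq_nil_left {p q : Prog} {M M₁ M₂ : Mem} {o : List ℤ} (hY : 1 ≤ Y)
    (hp : Runs β Y p M M₁ []) (hq : MemBd β M₁ → Runs β Y q M₁ M₂ o) :
    Runs β Y (p ;; q) M M₂ o :=
  Runs.seq hY hp hq

theorem abs_natCast_le_two_pow {β k : ℕ} (h : k ≤ 2 ^ β) : |(k : ℤ)| ≤ 2 ^ β := by
  rw [abs_of_nonneg (by positivity)]
  exact_mod_cast h

/-! ### The number of repetitions of each setting -/

/-- Bit length of `8 n² b`. -/
def logParam (n b : ℕ) : ℕ := (8 * n * n * b).size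

/-- Number of repetitions of each measurement setting. -/
def repetitions (n a b : ℕ) : ℕ := 256 * n * n * n * a * a * logParam n b

/-- Computes the number of repetitions into the cell `-1`. -/
def paramProg : Prog :=
  Prog.set (-10) (8 * Expr.var 0 * Expr.var 0 * Expr.var 2) ;;
  Prog.set (-11) 0 ;;
  Prog.loop (Expr.var (-10))
    (Prog.set (-10) (Expr.var (-10) / 2) ;; Prog.set (-11) (Expr.var (-11) + 1)) ;;
  Prog.set (-1) (256 * Expr.var 0 * Expr.var 0 * Expr.var 0 * Expr.var 1 * Expr.var 1 *
    Expr.var (-11))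

/-- The bit length is found by halving until zero: after `c` rounds the cell `-10` holds `v / 2 ^
c`, which is positive exactly while `c` is below the bit length. Cells with nonnegative address, the
input, stay intact for the later programs. -/
theorem paramProg_runs {n a b : ℕ} (hY : logParam n b + 1 ≤ Y) (hℓ : logParam n b ≤ β)
    (hm : repetitions n a b ≤ 2 ^ β) {M : Mem} (hM : MemBd β M)
    (h0 : M 0 = n) (h1 : M 1 = a) (h2 : M 2 = b) :
    ∃ M', Runs β Y paramProg M M' [] ∧ M' (-1) = repetitions n a b ∧
      (∀ x, 0 ≤ x → M' x = M x) := by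
  set v := 8 * n * n * b with hv
  have hvβ : v ≤ 2 ^ β := by
    have : v < 2 ^ logParam n b := Nat.lt_size_self _
    exact this.le.trans (Nat.pow_le_pow_right (by norm_num) hℓ)
  have s1 : Runs β Y (Prog.set (-10) (8 * Expr.var 0 * Expr.var 0 * Expr.var 2)) M
      (Function.update M (-10) v) [] :=
    Runs.store rfl (by simp [h0, h2, hv]) (abs_natCast_le_two_pow hvβ)
  have s2 : Runs β Y (Prog.set (-11) 0) (Function.update M (-10) (v : ℤ))
      (Function.update (Function.update M (-10) v) (-11) 0) [] :=
    Runs.store rfl rfl (by simp)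
  obtain ⟨M₃, s3, i1, i2, i3⟩ := Runs.loop (β := β) (Y := Y) (e := Expr.var (-10))
    (p := Prog.set (-10) (Expr.var (-10) / 2) ;; Prog.set (-11) (Expr.var (-11) + 1))
    (N := logParam n b)
    (fun c N => N (-10) = ((v / 2 ^ c : ℕ) : ℤ) ∧ N (-11) = c ∧ ∀ x, 0 ≤ x → N x = M x)
    (fun _ => []) hY
    (fun c hc N hi => by
      simp only [Expr.eval_cell', Expr.eval_const', hi.1]
      have := Nat.lt_size.1 hc
      have := Nat.div_pos this (by positivity)
      exact_mod_cast this)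
    (fun N hi => by
      simp only [Expr.eval_cell', Expr.eval_const', hi.1]
      rw [Nat.div_eq_of_lt (show v < 2 ^ logParam n b from Nat.lt_size_self _)]; rfl)
    (fun c hc N hN ⟨j1, j2, j3⟩ => by
      refine ⟨_, Runs.seq_nil_left (by omega) (Runs.store rfl
        (y := ((v / 2 ^ (c + 1) : ℕ) : ℤ)) ?_ ?_) fun _ => Runs.store rfl
        (y := ((c + 1 : ℕ) : ℤ)) ?_ ?_, ?_, ?_, ?_⟩
      · simp [j1, pow_succ]
        rw [Int.ediv_ediv_of_nonneg (by positivity)]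
      · exact abs_natCast_le_two_pow ((Nat.div_le_self _ _).trans hvβ)
      · simp [j2]
      · exact abs_natCast_le_two_pow
          (le_trans (by omega) (hℓ.trans (Nat.lt_two_pow_self).le))
      · simp
      · simp
      · intro x hx
        simp only [Expr.eval_const', Function.update_apply]
        rw [if_neg (by omega), if_neg (by omega), j3 x hx])
    (s2 (s1 hM).1).1
    ⟨by simp, by simp, fun x hx => by
      simp only [Function.update_apply]
      rw [if_neg (by omega), if_neg (by omega)]⟩
  refine ⟨Function.update M₃ (-1) (repetitions n a b), Runs.seq_nil_left (by omega) s1 fun _ =>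
    Runs.seq_nil_left (by omega) s2 fun _ => Runs.seq_nil_left (by omega) (by simpa [List.flatMap_eq_nil_iff.2] using s3)
      fun _ => Runs.store rfl ?_ (abs_natCast_le_two_pow hm), by simp, fun x hx => ?_⟩
  · simp [i2, i3, h0, h1, repetitions]
  · rw [Function.update_of_ne (by omega), i3 x hx]

/-! ### Printing the circuits -/

/-- Code of the gates coupling the qubit `l` with the qubit `s - l < l`. -/
def blockCode (s τ l : ℕ) : List ℤ :=
  if l ≤ s ∧ s - l < l then
    (if τ = 1 then [1, (l : ℤ)] else []) ++ [3, ((s - l : ℕ) : ℤ), l, 0, ((s - l : ℕ) : ℤ)]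
  else []

/-- Prints the gates coupling the qubit in the cell `-24`. -/
def blockProg : Prog :=
  Prog.set (-25) (Expr.var (-22) - Expr.var (-24)) ;;
  Prog.ite (Expr.var (-25) + 1)
    (Prog.ite (Expr.var (-24) - Expr.var (-25))
      (Prog.ite (Expr.var (-23)) (Prog.emit 1 ;; Prog.emit (Expr.var (-24))) Prog.skip ;;
        Prog.emit 3 ;; Prog.emit (Expr.var (-25)) ;; Prog.emit (Expr.var (-24)) ;;
        Prog.emit 0 ;; Prog.emit (Expr.var (-25)))
      Prog.skip)
    Prog.skip

/-- Prints all circuits. -/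
def prepProg : Prog :=
  paramProg ;;
  Prog.forTo (-21) (4 * Expr.var 0 * Expr.var (-1))
    (Prog.set (-22) (Expr.var (-21) / Expr.var (-1) / 2) ;;
      Prog.set (-23) (Expr.var (-21) / Expr.var (-1) - 2 * Expr.var (-22)) ;;
      Prog.forTo (-24) (Expr.var 0) blockProg ;; Prog.emit 4)

/-- The cell `-25` holds the integer `s - l`, possibly negative. The two nested tests check `l ≤ s`
and `s - l < l`, after which the integer agrees with the truncated difference in `blockCode`. -/
theorem blockProg_runs {s τ l : ℕ} (hτ : τ ≤ 1) (hY : 1 ≤ Y) (hl : l ≤ 2 ^ β) (hs : s ≤ 2 ^ β)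
    {M : Mem}
    (h1 : M (-22) = s) (h2 : M (-23) = τ) (h3 : M (-24) = l) :
    Runs β Y blockProg M (Function.update M (-25) (s - l)) (blockCode s τ l) := by
  refine Runs.seq_nil_left hY (Runs.store rfl (y := (s : ℤ) - l) (by simp [h1, h3]) ?_) fun _ => ?_
  · have : (s : ℤ) ≤ 2 ^ β := by exact_mod_cast hs
    have : (l : ℤ) ≤ 2 ^ β := by exact_mod_cast hl
    rw [abs_le]; constructor <;> omega
  by_cases c1 : l ≤ s
  · refine Runs.ite_pos hY (by simp; omega) ?_
    by_cases c2 : s - l < l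
    · refine Runs.ite_pos hY (by simp [h3]; omega) ?_
      rw [blockCode, if_pos ⟨c1, c2⟩]
      refine Runs.seq (M₁ := Function.update M (-25) ((s : ℤ) - l)) hY ?_ fun _ => ?_
      · by_cases c3 : τ = 1
        · rw [if_pos c3]
          refine Runs.ite_pos hY (by simp [h2, c3]) ?_
          exact Runs.seq (o₁ := [1]) hY (Runs.emit rfl) fun _ =>
            Runs.emit (by simp [h3])
        · rw [if_neg c3]
          exact Runs.ite_neg hY (by simp [h2]; omega) Runs.skip
      · refine Runs.seq (o₁ := [3]) hY (Runs.emit rfl) fun _ =>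
          Runs.seq (o₁ := [((s - l : ℕ) : ℤ)]) hY (Runs.emit ?_) fun _ =>
          Runs.seq (o₁ := [(l : ℤ)]) hY (Runs.emit ?_) fun _ =>
          Runs.seq (o₁ := [0]) hY (Runs.emit rfl) fun _ => Runs.emit ?_
        · simp [Nat.cast_sub c1]
        · simp [h3]
        · simp [Nat.cast_sub c1]
    · rw [blockCode, if_neg (by tauto)]
      exact Runs.ite_neg hY (by simp [h3]; omega) Runs.skip
  · rw [blockCode, if_neg (by tauto)]
    exact Runs.ite_neg hY (by simp; omega) Runs.skip

theorem prepProg_runs {n a b : ℕ} (hY : logParam n b + 1 ≤ Y) (hℓ : logParam n b ≤ β)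
    (hm : repetitions n a b ≤ 2 ^ β) (hN : 4 * n * repetitions n a b + 1 ≤ Y)
    (hn : n + 1 ≤ Y) (hYβ : Y ≤ 2 ^ β)
    {M : Mem} (hM : MemBd β M) (h0 : M 0 = n) (h1 : M 1 = a) (h2 : M 2 = b) :
    ∃ M', Runs β Y prepProg M M' ((List.range (4 * n * repetitions n a b)).flatMap fun i =>
      ((List.range n).flatMap fun l =>
        blockCode (i / repetitions n a b / 2) (i / repetitions n a b % 2) l) ++ [4]) := by
  obtain ⟨M₁, r1, hm1, hf⟩ := paramProg_runs hY hℓ hm hM h0 h1 h2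
  set m := repetitions n a b with hmdef
  have h0' : M₁ 0 = n := by rw [hf 0 le_rfl, h0]
  obtain ⟨M₂, r2, -⟩ := Runs.forTo (β := β) (Y := Y) (i := -21)
    (e := 4 * Expr.var 0 * Expr.var (-1))
    (p := Prog.set (-22) (Expr.var (-21) / Expr.var (-1) / 2) ;;
      Prog.set (-23) (Expr.var (-21) / Expr.var (-1) - 2 * Expr.var (-22)) ;;
      Prog.forTo (-24) (Expr.var 0) blockProg ;; Prog.emit 4)
    (N := 4 * n * m)
    (fun c N => N (-21) = c ∧ N 0 = n ∧ N (-1) = m)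
    (fun i => ((List.range n).flatMap fun l => blockCode (i / m / 2) (i / m % 2) l) ++ [4])
    hN (by exact_mod_cast (show 4 * n * m ≤ 2 ^ β by omega))
    (fun c _ N hi => ⟨hi.1, by simp [hi.2.1, hi.2.2]⟩)
    (fun c hc N hN' ⟨j1, j2, j3⟩ => by
      -- The running index `c` encodes the setting as `c / m = 2 * s + τ`, so consecutive blocks of
      -- `m` circuits repeat the same measurement.
      have hcm : c / m ≤ c := Nat.div_le_self _ _
      have t1 : Runs β Y (Prog.set (-22) (Expr.var (-21) / Expr.var (-1) / 2)) N
          (Function.update N (-22) ((c / m / 2 : ℕ) : ℤ)) [] :=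
        Runs.store rfl (by simp [j1, j3]) (abs_natCast_le_two_pow (by omega))
      have t2 : Runs β Y (Prog.set (-23) (Expr.var (-21) / Expr.var (-1) - 2 * Expr.var (-22)))
          (Function.update N (-22) ((c / m / 2 : ℕ) : ℤ))
          (Function.update (Function.update N (-22) ((c / m / 2 : ℕ) : ℤ)) (-23)
            ((c / m % 2 : ℕ) : ℤ)) [] :=
        Runs.store rfl (by simp [j1, j3]; omega)
          (abs_natCast_le_two_pow (by omega))
      obtain ⟨N₃, t3, k1, k2, k3, k4, -⟩ := Runs.forTo (β := β) (Y := Y) (i := -24)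
        (e := Expr.var 0) (p := blockProg) (N := n)
        (fun l N => N (-21) = c ∧ N 0 = n ∧ N (-1) = m ∧ N (-24) = l ∧
          N (-22) = (c / m / 2 : ℕ) ∧ N (-23) = (c / m % 2 : ℕ))
        (fun l => blockCode (c / m / 2) (c / m % 2) l) hn
        (by exact_mod_cast (show n ≤ 2 ^ β by omega))
        (fun l _ N hi => ⟨hi.2.2.2.1, by simp [hi.2.1]⟩)
        (fun l hl N hN ⟨j1, j2, j3, j4, j5, j6⟩ =>
          ⟨_, blockProg_runs (by omega) (by omega) (by omega) (by omega) j5 j6 j4,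
            by simp [j4],
            by simp [j1, j2, j3, j5, j6]⟩)
        (t2 (t1 hN').1).1
        (by simp [j1, j2, j3])
      refine ⟨N₃, Runs.seq_nil_left (by omega) t1 fun _ => Runs.seq_nil_left (by omega) t2 fun _ =>
        Runs.seq (by omega) t3 fun _ => Runs.emit rfl, k1, ?_⟩
      simp [k2, k3])
    (r1 hM).1 (by simp [h0', hm1])
  exact ⟨M₂, Runs.seq_nil_left (by omega) r1 fun _ => r2⟩

end FreeFermion

/-! ### Program for one correlation, read off the measured bits. -/

open FreeFermion
open scoped Matrix

namespace FreeFermion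

variable {β Y : ℕ}

/-- The memories agree outside of the addresses `lo, …, hi`. -/
def SameOff (lo hi : ℤ) (M M' : Mem) : Prop := ∀ x, x < lo ∨ hi < x → M' x = M x

theorem SameOff.refl (lo hi : ℤ) (M : Mem) : SameOff lo hi M M := fun _ _ => rfl

theorem SameOff.update {lo hi : ℤ} {M M' : Mem} (h : SameOff lo hi M M') {a : ℤ} (y : ℤ)
    (h1 : lo ≤ a) (h2 : a ≤ hi) : SameOff lo hi M (Function.update M' a y) := by
  intro x hx
  rw [Function.update_of_ne (by omega), h x hx]

theorem SameOff.trans {lo hi lo' hi' lo'' hi'' : ℤ} {M M' M'' : Mem} (h : SameOff lo hi M M')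
    (h' : SameOff lo' hi' M' M'') (h1 : lo'' ≤ lo) (h2 : hi ≤ hi'') (h3 : lo'' ≤ lo')
    (h4 : hi' ≤ hi'') : SameOff lo'' hi'' M M'' := by
  intro x hx
  rw [h' x (by omega), h x (by omega)]

/-! ### Estimates of correlations -/

/-- The estimate, times `m`, of the correlation of the operators `(k, a)` and `(l, b)` up to its
sign, from the measured bits in the memory `I`. -/
def rawEst (I : Mem) (n m k a l b : ℕ) : ℤ :=
  ∑ rep ∈ Finset.range m,
    (1 - 2 * I (3 + ((2 * (k + l) + if a = b then 1 else 0) * m + rep : ℕ) * n + k)) *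
      ∏ q ∈ Finset.range n, if k + l ≤ 2 * q ∧ q + a ≤ l then
        1 - 2 * I (3 + ((2 * (k + l) + if a = b then 1 else 0) * m + rep : ℕ) * n + q) else 1

/-- The address of the bit of the qubit `q` in the repetition in the cell `-34`. -/
def bitAddr (q : Expr) : Expr :=
  3 + ((2 * (Expr.var (-28) + Expr.var (-30)) + (1 - (Expr.var (-29) - Expr.var (-31)) *
    (Expr.var (-29) - Expr.var (-31)))) * Expr.var (-1) + Expr.var (-34)) * Expr.var 0 + q

/-- Computes `rawEst` into the cell `-33`. -/
def sampleProg : Prog :=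
  Prog.set (-33) 0 ;;
  Prog.forTo (-34) (Expr.var (-1))
    (Prog.set (-35) (1 - 2 * Expr.cell (bitAddr (Expr.var (-28)))) ;;
      Prog.forTo (-36) (Expr.var 0)
        (Prog.ite (2 * Expr.var (-36) + 1 - (Expr.var (-28) + Expr.var (-30)))
          (Prog.ite (Expr.var (-30) + 1 - Expr.var (-29) - Expr.var (-36))
            (Prog.set (-35) (Expr.var (-35) * (1 - 2 * Expr.cell (bitAddr (Expr.var (-36))))))
            Prog.skip)
          Prog.skip) ;;
      Prog.set (-33) (Expr.var (-33) + Expr.var (-35)))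

theorem bitAddr_eval {n m k a l b rep : ℕ} (ha : a < 2) (hb : b < 2) {M : Mem} (q : Expr)
    (h0 : M 0 = n) (h1 : M (-1) = m) (h28 : M (-28) = k) (h29 : M (-29) = a) (h30 : M (-30) = l)
    (h31 : M (-31) = b) (h34 : M (-34) = rep) :
    (bitAddr q).eval M =
      3 + ((2 * (k + l) + if a = b then 1 else 0) * m + rep : ℕ) * n + q.eval M := by
  -- For bits, the square of the difference is the indicator of `a ≠ b`; this replaces a comparison,
  -- which expressions cannot perform.
  have : (1 : ℤ) - ((a : ℤ) - b) * (a - b) = ((if a = b then 1 else 0 : ℕ) : ℤ) := by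
    interval_cases a <;> interval_cases b <;> simp
  simp only [bitAddr, Expr.eval_add', Expr.eval_sub', Expr.eval_mul', Expr.eval_ofNat',
    Expr.eval_cell', Expr.eval_const', Expr.eval_one', h0, h1, h28, h29, h30, h31, h34, this]
  push_cast
  ring

theorem abs_bitSign_le {z : ℤ} (h : z = 0 ∨ z = 1) : |1 - 2 * z| ≤ 1 := by
  rcases h with rfl | rfl <;> simp

/-- Every factor is a sign or `1`. Stated for an arbitrary cut-off `c`, so that it also bounds the
partial products held in memory. -/
theorem abs_sample_le {I : Mem} (hbit : ∀ x, 3 ≤ x → I x = 0 ∨ I x = 1) {n : ℕ} (k : ℕ)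
    (p : ℕ → Prop) [DecidablePred p] (r c : ℕ) :
    |(1 - 2 * I (3 + (r : ℤ) * n + k)) *
      ∏ q ∈ Finset.range c, if p q then 1 - 2 * I (3 + (r : ℤ) * n + q) else 1| ≤ 1 := by
  have h3 : ∀ q : ℕ, 3 ≤ 3 + (r : ℤ) * n + q := fun q => by
    have : (0 : ℤ) ≤ (r : ℤ) * n + q := by positivity
    omega
  rw [abs_mul, Finset.abs_prod]
  refine mul_le_one₀ (abs_bitSign_le (hbit _ (h3 _))) (Finset.prod_nonneg fun _ _ => abs_nonneg _)
    (Finset.prod_le_one (fun _ _ => abs_nonneg _) fun q _ => ?_)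
  split_ifs
  · exact abs_bitSign_le (hbit _ (h3 _))
  · simp

theorem sampleProg_runs {n m k a l b : ℕ} (ha : a < 2) (hb : b < 2) (hn : n + 1 ≤ Y)
    (hm : m + 1 ≤ Y) (hYβ : Y ≤ 2 ^ β) {M : Mem} (hM : MemBd β M)
    (hbit : ∀ x, 3 ≤ x → M x = 0 ∨ M x = 1)
    (h0 : M 0 = n) (h1 : M (-1) = m) (h28 : M (-28) = k) (h29 : M (-29) = a) (h30 : M (-30) = l)
    (h31 : M (-31) = b) :
    ∃ M', Runs β Y sampleProg M M' [] ∧ M' (-33) = rawEst M n m k a l b ∧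
      SameOff (-36) (-33) M M' := by
  set A : ℕ → ℕ → ℤ := fun rep q =>
    3 + ((2 * (k + l) + if a = b then 1 else 0) * m + rep : ℕ) * n + q with hA
  have hA0 : ∀ r q, 0 ≤ A r q := fun r q => by simp only [hA]; positivity
  -- `PR rep c` is the running product after the qubits below `c` have been treated: the content of
  -- the cell `-35`. The cell `-33` accumulates the complete products.
  set PR : ℕ → ℕ → ℤ := fun rep c => (1 - 2 * M (A rep k)) *
      ∏ q ∈ Finset.range c, if k + l ≤ 2 * q ∧ q + a ≤ l then 1 - 2 * M (A rep q) else 1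
    with hPR
  have hPR1 : ∀ r c, |PR r c| ≤ 1 := fun r c =>
    abs_sample_le hbit k (fun q => k + l ≤ 2 * q ∧ q + a ≤ l) _ c
  have h1β : (1 : ℤ) ≤ 2 ^ β := one_le_pow₀ (by norm_num)
  have hacc : ∀ c ≤ m, |∑ r ∈ Finset.range c, PR r n| ≤ 2 ^ β := fun c hc => by
    refine (Finset.abs_sum_le_sum_abs _ _).trans ((Finset.sum_le_sum fun r _ => hPR1 r n).trans ?_)
    simp only [Finset.sum_const, Finset.card_range, nsmul_eq_mul, mul_one]
    exact_mod_cast (show c ≤ 2 ^ β by omega)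
  have s0 : Runs β Y (Prog.set (-33) 0) M (Function.update M (-33) 0) [] :=
    Runs.store rfl rfl (by simp)
  obtain ⟨M', r, i1, i2, i3⟩ := Runs.forTo (β := β) (Y := Y) (i := -34) (e := Expr.var (-1))
    (p := Prog.set (-35) (1 - 2 * Expr.cell (bitAddr (Expr.var (-28)))) ;;
      Prog.forTo (-36) (Expr.var 0)
        (Prog.ite (2 * Expr.var (-36) + 1 - (Expr.var (-28) + Expr.var (-30)))
          (Prog.ite (Expr.var (-30) + 1 - Expr.var (-29) - Expr.var (-36))
            (Prog.set (-35) (Expr.var (-35) * (1 - 2 * Expr.cell (bitAddr (Expr.var (-36))))))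
            Prog.skip)
          Prog.skip) ;;
      Prog.set (-33) (Expr.var (-33) + Expr.var (-35))) (N := m)
    (fun c N => N (-34) = c ∧ N (-33) = ∑ r ∈ Finset.range c, PR r n ∧ SameOff (-36) (-33) M N)
    (fun _ => []) hm (by exact_mod_cast (show m ≤ 2 ^ β by omega))
    (fun c _ N hi => ⟨hi.1, by simp [hi.2.2 (-1) (by norm_num), h1]⟩)
    (fun c hc N hN ⟨j1, j2, j3⟩ => by
      have f : ∀ x, x < -36 ∨ -33 < x → N x = M x := j3
      have t1 : Runs β Y (Prog.set (-35) (1 - 2 * Expr.cell (bitAddr (Expr.var (-28))))) N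
          (Function.update N (-35) (PR c 0)) [] := by
        refine Runs.store rfl ?_ ((hPR1 c 0).trans h1β)
        have e : (bitAddr (Expr.var (-28))).eval N = A c k := by
          rw [bitAddr_eval (n := n) (m := m) (k := k) (l := l) (rep := c) ha hb] <;>
            simp [*]
        simp only [Expr.eval_sub', Expr.eval_mul', Expr.eval_cell', Expr.eval_one',
          Expr.eval_ofNat', e]
        rw [f _ (by have := hA0 c k; omega)]
        simp [hPR]
      obtain ⟨N₂, t2, k1, k2, k3, k4⟩ := Runs.forTo (β := β) (Y := Y) (i := -36) (e := Expr.var 0)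
        (p := Prog.ite (2 * Expr.var (-36) + 1 - (Expr.var (-28) + Expr.var (-30)))
          (Prog.ite (Expr.var (-30) + 1 - Expr.var (-29) - Expr.var (-36))
            (Prog.set (-35) (Expr.var (-35) * (1 - 2 * Expr.cell (bitAddr (Expr.var (-36))))))
            Prog.skip)
          Prog.skip) (N := n)
        (fun q N' => N' (-36) = q ∧ N' (-35) = PR c q ∧ N' (-34) = c ∧
          SameOff (-36) (-35) N N')
        (fun _ => []) hn (by exact_mod_cast (show n ≤ 2 ^ β by omega))
        (fun q _ N' hi => ⟨hi.1, by simp [hi.2.2.2 0 (by norm_num), f, h0]⟩)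
        (fun q hq N' hN' ⟨l1, l2, l3, l4⟩ => by
          have g : ∀ x, x < -36 ∨ -33 < x → N' x = M x := fun x hx => by
            rw [l4 x (by omega), f x hx]
          by_cases c1 : k + l ≤ 2 * q
          swap
          · refine ⟨N', Runs.ite_neg (by omega) ?_ Runs.skip, l1, by simp, ?_, by simp [l3],
              l4.update _ (by norm_num) (by norm_num)⟩
            · simp [g, h28, h30, l1]; omega
            · simp [l2, hPR, Finset.prod_range_succ, c1]
          by_cases c2 : q + a ≤ l
          swap
          · refine ⟨N', Runs.ite_pos (by omega) ?_ (Runs.ite_neg (by omega) ?_ Runs.skip), l1,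
              by simp, ?_, by simp [l3], l4.update _ (by norm_num) (by norm_num)⟩
            · simp [g, h28, h30, l1]; omega
            · simp [g, h29, h30, l1]; omega
            · simp [l2, hPR, Finset.prod_range_succ, c2]
          · refine ⟨Function.update N' (-35) (PR c (q + 1)), Runs.ite_pos (by omega) ?_
              (Runs.ite_pos (by omega) ?_ (Runs.store rfl ?_ ((hPR1 c _).trans h1β))), by simp [l1],
              by simp, by simp, by simp [l3],
              (l4.update _ (by norm_num) (by norm_num)).update _ (by norm_num) (by norm_num)⟩
            · simp [g, h28, h30, l1]; omega
            · simp [g, h29, h30, l1]; omega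
            · have e : (bitAddr (Expr.var (-36))).eval N' = A c q := by
                rw [bitAddr_eval (n := n) (m := m) (k := k) (l := l) (rep := c) ha hb] <;>
                  simp [*]
              simp only [Expr.eval_sub', Expr.eval_mul', Expr.eval_cell', Expr.eval_one',
                Expr.eval_ofNat', Expr.eval_const', e, l2]
              rw [g _ (by have := hA0 c q; omega)]
              simp [hPR, Finset.prod_range_succ, c1, c2]
              ring)
        (t1 hN).1
        ⟨by simp, by simp, by simp [j1],
          ((SameOff.refl _ _ N).update _ (by norm_num) (by norm_num)).update _ (by norm_num)
            (by norm_num)⟩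
      have e33 : N₂ (-33) = ∑ r ∈ Finset.range c, PR r n := by
        rw [k4 _ (by norm_num), j2]
      refine ⟨Function.update N₂ (-33) (∑ r ∈ Finset.range (c + 1), PR r n),
        Runs.seq_nil_left (by omega) t1 fun _ => Runs.seq_nil_left (by omega)
          (by simpa [List.flatMap_eq_nil_iff.2] using t2) fun _ =>
          Runs.store rfl ?_ (hacc _ (by omega)), by simp [k3], by simp, by simp, ?_⟩
      · simp [e33, k2, Finset.sum_range_succ]
      · exact ((j3.trans k4 (lo'' := -36) (hi'' := -33) (by norm_num) (by norm_num) (by norm_num)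
          (by norm_num)).update _ (by norm_num) (by norm_num)).update _ (by norm_num) (by norm_num))
    (s0 hM).1
    ⟨by simp, by simp, ((SameOff.refl _ _ M).update _ (by norm_num) (by norm_num)).update _
      (by norm_num) (by norm_num)⟩
  exact ⟨M', Runs.seq_nil_left (by omega) s0 fun _ => by
    simpa [List.flatMap_eq_nil_iff.2] using r, i2, i3⟩

end FreeFermion

/-! ### Constants of the classical processing and the matrix of estimates. -/

open FreeFermion
open scoped Matrix

namespace FreeFermion

variable {β Y : ℕ}

/-- The estimate, times `m`, of the correlation of two Majorana operators in increasing order. -/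
def ordEst (I : Mem) (n m x y : ℕ) : ℤ :=
  (if (x % 2 = 1 ∧ y % 2 = 1) ∨ x / 2 = y / 2 then -1 else 1) *
    rawEst I n m (x / 2) (x % 2) (y / 2) (y % 2)

/-- The position of a Majorana operator in the order with the two operators of each mode
exchanged. -/
def pairKey (x : ℕ) : ℕ := 4 * (x / 2) + 1 - x

/-- The estimate, times `m`, of the correlation of two Majorana operators. -/
def corrEst (I : Mem) (n m x y : ℕ) : ℤ :=
  if pairKey y < pairKey x then -ordEst I n m y x
  else if pairKey x < pairKey y then ordEst I n m x y else 0

/-- The entries, row after row, of the symmetric dilation of the matrix of the estimates. -/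
def dilEst (I : Mem) (n m c : ℕ) : ℤ :=
  (((c / (4 * n) / (2 * n) : ℕ) : ℤ) - ((c % (4 * n) / (2 * n) : ℕ) : ℤ)) *
    corrEst I n m (c / (4 * n) % (2 * n)) (c % (4 * n) % (2 * n))

theorem abs_natCast_sub_le_one {a b : ℕ} (ha : a ≤ 1) (hb : b ≤ 1) : |(a : ℤ) - b| ≤ 1 := by
  rw [abs_le]; omega

theorem abs_rawEst_le {I : Mem} (hbit : ∀ x, 3 ≤ x → I x = 0 ∨ I x = 1) (n m k a l b : ℕ) :
    |rawEst I n m k a l b| ≤ m := by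
  refine (Finset.abs_sum_le_sum_abs _ _).trans ((Finset.sum_le_sum fun r _ =>
    abs_sample_le hbit k (fun q => k + l ≤ 2 * q ∧ q + a ≤ l) _ n).trans ?_)
  simp

/-- The bound `m` serves twice: for bit lengths, and to confine the spectrum of the `4n × 4n`
dilation to `[-4nm, 4nm]`. -/
theorem abs_corrEst_le {I : Mem} (hbit : ∀ x, 3 ≤ x → I x = 0 ∨ I x = 1) (n m x y : ℕ) :
    |corrEst I n m x y| ≤ m := by
  have h : ∀ x y, |ordEst I n m x y| ≤ m := fun x y => by
    rw [ordEst, abs_mul]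
    have := abs_rawEst_le hbit n m (x / 2) (x % 2) (y / 2) (y % 2)
    split_ifs <;> simpa using this
  rw [corrEst]
  split_ifs
  · rw [abs_neg]; exact h _ _
  · exact h _ _
  · simp

theorem abs_dilEst_le {I : Mem} (hbit : ∀ x, 3 ≤ x → I x = 0 ∨ I x = 1) {n m c : ℕ}
    (hc : c < 4 * n * (4 * n)) : |dilEst I n m c| ≤ m := by
  have h1 : c / (4 * n) / (2 * n) ≤ 1 := by
    have : c / (4 * n) < 4 * n := Nat.div_lt_of_lt_mul hc
    have : c / (4 * n) / (2 * n) < 2 := Nat.div_lt_of_lt_mul (by omega)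
    omega
  have h2 : c % (4 * n) / (2 * n) ≤ 1 := by
    have : c % (4 * n) < 4 * n := Nat.mod_lt _ (by by_contra h; simp at h; simp [h] at hc)
    have : c % (4 * n) / (2 * n) < 2 := Nat.div_lt_of_lt_mul (by omega)
    omega
  rw [dilEst, abs_mul]
  have h := abs_corrEst_le hbit n m (c / (4 * n) % (2 * n)) (c % (4 * n) % (2 * n))
  have : |((c / (4 * n) / (2 * n) : ℕ) : ℤ) - ((c % (4 * n) / (2 * n) : ℕ) : ℤ)| ≤ 1 :=
    abs_natCast_sub_le_one h1 h2
  calc _ ≤ 1 * (m : ℤ) := mul_le_mul this h (abs_nonneg _) (by norm_num)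
    _ = m := one_mul _

/-- The degree of the matrix polynomial applied to the estimate. -/
def degParam (n a : ℕ) : ℕ := 144 * n * n * n * n * a * a

/-- The constants of the classical processing. -/
structure Consts (n m L : ℕ) (M : Mem) : Prop where
  cn : M 0 = n
  cm : M (-1) = m
  cw : M (-8) = (2 * n : ℕ)
  cW : M (-2) = (4 * n : ℕ)
  cL : M (-3) = L
  sq : M (-6) = (4 * n * (4 * n) : ℕ)
  layer : M (-4) = ((L + 1) * (4 * n * (4 * n)) : ℕ)
  total : M (-7) = (L * ((L + 1) * (4 * n * (4 * n))) + 4 * n * (4 * n) : ℕ)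
  scale : M (-5) = (4 * n * m : ℕ)
  denom : M (-9) = (2 * L * (2 * (4 * n * m)) ^ L : ℕ)

/-- The constants occupy addresses from `-9` to `0`, while working cells and arrays lie below `-20`,
so no later computation destroys them. -/
theorem Consts.of_sameOff {n m L : ℕ} {M M' : Mem} (h : Consts n m L M) {lo hi : ℤ}
    (hs : SameOff lo hi M M') (hhi : hi < -20) : Consts n m L M' := by
  have e : ∀ x, -20 ≤ x → M' x = M x := fun x hx => hs x (by omega)
  exact ⟨by rw [e _ (by norm_num), h.cn], by rw [e _ (by norm_num), h.cm],
    by rw [e _ (by norm_num), h.cw], by rw [e _ (by norm_num), h.cW],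
    by rw [e _ (by norm_num), h.cL], by rw [e _ (by norm_num), h.sq],
    by rw [e _ (by norm_num), h.layer], by rw [e _ (by norm_num), h.total],
    by rw [e _ (by norm_num), h.scale], by rw [e _ (by norm_num), h.denom]⟩

/-- Computes the constants. -/
def constProg : Prog :=
  Prog.set (-8) (2 * Expr.var 0) ;;
  Prog.set (-2) (4 * Expr.var 0) ;;
  Prog.set (-3) (144 * Expr.var 0 * Expr.var 0 * Expr.var 0 * Expr.var 0 * Expr.var 1 *
    Expr.var 1) ;;
  Prog.set (-6) (Expr.var (-2) * Expr.var (-2)) ;;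
  Prog.set (-4) ((Expr.var (-3) + 1) * Expr.var (-6)) ;;
  Prog.set (-7) (Expr.var (-3) * Expr.var (-4) + Expr.var (-6)) ;;
  Prog.set (-5) (Expr.var (-2) * Expr.var (-1)) ;;
  Prog.set (-9) (2 * Expr.var (-3)) ;;
  Prog.forTo (-21) (Expr.var (-3)) (Prog.set (-9) (Expr.var (-9) * (2 * Expr.var (-5))))

/-- Bounds for the constants, used for running times. -/
structure ParamBounds (n m L β Y : ℕ) : Prop where
  n_pos : 1 ≤ n
  m_pos : 1 ≤ m
  hm : m + 1 ≤ Y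
  hsq : 4 * n * (4 * n) + 1 ≤ Y
  htotal : L * ((L + 1) * (4 * n * (4 * n))) + 4 * n * (4 * n) + 1 ≤ Y
  hscale : 4 * n * m ≤ Y
  hY : Y ≤ 2 ^ β
  hval : L * (4 * (4 * n * m)) ^ (L * ((L + 1) * (4 * n * (4 * n))) + 4 * n * (4 * n)) ≤ 2 ^ β
  hden : 2 * L * (2 * (4 * n * m)) ^ L ≤ 2 ^ β

theorem ParamBounds.hW {n m L β Y : ℕ} (h : ParamBounds n m L β Y) : 4 * n + 1 ≤ Y := by
  have h1 := h.n_pos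
  have h2 := h.hsq
  nlinarith

theorem ParamBounds.hL {n m L β Y : ℕ} (h : ParamBounds n m L β Y) : L + 1 ≤ Y := by
  have h1 := h.n_pos
  have h2 := h.htotal
  have : L * 1 ≤ L * ((L + 1) * (4 * n * (4 * n))) :=
    Nat.mul_le_mul_left _ (Nat.mul_pos (by omega) (by nlinarith))
  omega

theorem constProg_runs {n a m L : ℕ} (hL : L = degParam n a) (hb : ParamBounds n m L β Y)
    {M : Mem} (hM : MemBd β M) (h0 : M 0 = n) (h1 : M 1 = a) (hm : M (-1) = m) :
    ∃ M', Runs β Y constProg M M' [] ∧ Consts n m L M' ∧ SameOff (-21) (-2) M M' := by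
  have hY := hb.hY
  have hW := hb.hW
  have hsq := hb.hsq
  have htot := hb.htotal
  have hLY := hb.hL
  have hlay : (L + 1) * (4 * n * (4 * n)) ≤ 2 ^ β := by
    rcases Nat.eq_zero_or_pos L with h | h
    · subst h; omega
    · have : 1 * ((L + 1) * (4 * n * (4 * n))) ≤ L * ((L + 1) * (4 * n * (4 * n))) :=
        Nat.mul_le_mul_right _ h
      omega
  have hd0 : 2 * L ≤ 2 ^ β := by
    have := hb.hden
    have h2 : 1 ≤ (2 * (4 * n * m)) ^ L := Nat.one_le_pow _ _ (by
      have := hb.n_pos; have := hb.m_pos; positivity)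
    nlinarith
  set M₁ : Mem := Function.update M (-8) ((2 * n : ℕ) : ℤ)
  set M₂ : Mem := Function.update M₁ (-2) ((4 * n : ℕ) : ℤ) with hM₂
  set M₃ : Mem := Function.update M₂ (-3) (L : ℤ) with hM₃
  set M₄ : Mem := Function.update M₃ (-6) ((4 * n * (4 * n) : ℕ) : ℤ)
  set M₅ : Mem := Function.update M₄ (-4) (((L + 1) * (4 * n * (4 * n)) : ℕ) : ℤ)
  set M₆ : Mem := Function.update M₅ (-7)
    ((L * ((L + 1) * (4 * n * (4 * n))) + 4 * n * (4 * n) : ℕ) : ℤ)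
  set M₇ : Mem := Function.update M₆ (-5) ((4 * n * m : ℕ) : ℤ)
  set M₈ : Mem := Function.update M₇ (-9) ((2 * L : ℕ) : ℤ)
  have s1 : Runs β Y (Prog.set (-8) (2 * Expr.var 0)) M M₁ [] :=
    Runs.store rfl (by simp [h0]) (abs_natCast_le_two_pow (by omega))
  have s2 : Runs β Y (Prog.set (-2) (4 * Expr.var 0)) M₁ M₂ [] :=
    Runs.store rfl (by simp [M₁, h0]) (abs_natCast_le_two_pow (by omega))
  have s3 : Runs β Y (Prog.set (-3) (144 * Expr.var 0 * Expr.var 0 * Expr.var 0 * Expr.var 0 *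
      Expr.var 1 * Expr.var 1)) M₂ M₃ [] :=
    Runs.store rfl (by simp [M₂, M₁, h0, h1, hL, degParam]) (abs_natCast_le_two_pow (by omega))
  have s4 : Runs β Y (Prog.set (-6) (Expr.var (-2) * Expr.var (-2))) M₃ M₄ [] :=
    Runs.store rfl (by simp [M₃, M₂]) (abs_natCast_le_two_pow (by omega))
  have s5 : Runs β Y (Prog.set (-4) ((Expr.var (-3) + 1) * Expr.var (-6))) M₄ M₅ [] :=
    Runs.store rfl (by simp [M₄, M₃]) (abs_natCast_le_two_pow (by omega))
  have s6 : Runs β Y (Prog.set (-7) (Expr.var (-3) * Expr.var (-4) + Expr.var (-6))) M₅ M₆ [] :=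
    Runs.store rfl (by simp [M₅, M₄, M₃]) (abs_natCast_le_two_pow (by omega))
  have s7 : Runs β Y (Prog.set (-5) (Expr.var (-2) * Expr.var (-1))) M₆ M₇ [] :=
    Runs.store rfl (by simp [M₆, M₅, M₄, M₃, M₂, M₁, hm])
      (abs_natCast_le_two_pow (by have := hb.hscale; omega))
  have s8 : Runs β Y (Prog.set (-9) (2 * Expr.var (-3))) M₇ M₈ [] :=
    Runs.store rfl (by simp [M₇, M₆, M₅, M₄, M₃]) (abs_natCast_le_two_pow hd0)
  have hM8 : MemBd β M₈ :=
    (s8 (s7 (s6 (s5 (s4 (s3 (s2 (s1 hM).1).1).1).1).1).1).1).1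
  -- The common denominator `2 L (2D) ^ L`, with `D = 4nm`, is built by `L` multiplications.
  obtain ⟨M', r, i1, i2, i3⟩ := Runs.forTo (β := β) (Y := Y) (i := -21) (e := Expr.var (-3))
    (p := Prog.set (-9) (Expr.var (-9) * (2 * Expr.var (-5)))) (N := L)
    (fun c N => N (-21) = c ∧ N (-9) = (2 * L * (2 * (4 * n * m)) ^ c : ℕ) ∧
      ∀ x, x ≠ -21 → x ≠ -9 → N x = M₈ x)
    (fun _ => []) (by omega) (by exact_mod_cast (show L ≤ 2 ^ β by omega))
    (fun c _ N hi => ⟨hi.1, by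
      simp [hi.2.2 (-3) (by norm_num) (by norm_num), M₈, M₇, M₆, M₅, M₄, M₃]⟩)
    (fun c hc N hN ⟨j1, j2, j3⟩ => by
      refine ⟨_, Runs.store rfl (y := ((2 * L * (2 * (4 * n * m)) ^ (c + 1) : ℕ) : ℤ)) ?_
        (abs_natCast_le_two_pow ((Nat.mul_le_mul_left _ (Nat.pow_le_pow_right ?_ hc)).trans
          hb.hden)), by simp [j1], by simp, by simp, fun x hx hx' => ?_⟩
      · simp only [Expr.eval_mul', Expr.eval_cell', Expr.eval_const', Expr.eval_ofNat', j2,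
          j3 (-5) (by norm_num) (by norm_num)]
        simp [M₈, M₇]
        ring
      · have := hb.n_pos; have := hb.m_pos; positivity
      · simp [hx, hx', j3])
    hM8 ⟨by simp, by simp [M₈], fun x hx _ => by simp [hx]⟩
  refine ⟨M', Runs.seq_nil_left (by omega) s1 fun _ => Runs.seq_nil_left (by omega) s2 fun _ =>
    Runs.seq_nil_left (by omega) s3 fun _ => Runs.seq_nil_left (by omega) s4 fun _ =>
    Runs.seq_nil_left (by omega) s5 fun _ => Runs.seq_nil_left (by omega) s6 fun _ =>
    Runs.seq_nil_left (by omega) s7 fun _ => Runs.seq_nil_left (by omega) s8 fun _ => by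
      simpa [List.flatMap_eq_nil_iff.2] using r, ?_, ?_⟩
  · constructor
    all_goals first
      | exact i2
      | (rw [i3 _ (by norm_num) (by norm_num)]
         simp [M₈, M₇, M₆, M₅, M₄, M₃, M₂, M₁, h0, hm])
  · intro x hx
    rw [i3 x (by omega) (by omega)]
    simp only [M₈, M₇, M₆, M₅, M₄, M₃, M₂, M₁, Function.update_apply]
    simp only [show x ≠ -9 by omega, show x ≠ -5 by omega, show x ≠ -7 by omega,
      show x ≠ -4 by omega, show x ≠ -6 by omega, show x ≠ -3 by omega, show x ≠ -2 by omega,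
      show x ≠ -8 by omega, if_false]

/-! ### Computing the matrix of the estimates -/

/-- Exchanges the operators in the cells `-25` and `-26` unless they are in increasing order,
and clears the sign if they are equal. -/
def swapProg : Prog :=
  Prog.ite (4 * (Expr.var (-25) / 2) + 1 - Expr.var (-25) -
      (4 * (Expr.var (-26) / 2) + 1 - Expr.var (-26)))
    (Prog.set (-27) (Expr.var (-25)) ;; Prog.set (-25) (Expr.var (-26)) ;;
      Prog.set (-26) (Expr.var (-27)) ;; Prog.set (-24) (0 - Expr.var (-24)))
    (Prog.ite (4 * (Expr.var (-26) / 2) + 1 - Expr.var (-26) -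
        (4 * (Expr.var (-25) / 2) + 1 - Expr.var (-25))) Prog.skip (Prog.set (-24) 0))

/-- Splits the operators in the cells `-25` and `-26` into modes and types, and corrects the
sign. -/
def splitProg : Prog :=
  Prog.set (-28) (Expr.var (-25) / 2) ;;
  Prog.set (-29) (Expr.var (-25) - 2 * Expr.var (-28)) ;;
  Prog.set (-30) (Expr.var (-26) / 2) ;;
  Prog.set (-31) (Expr.var (-26) - 2 * Expr.var (-30)) ;;
  Prog.ite (Expr.var (-29) * Expr.var (-31))
    (Prog.set (-24) (0 - Expr.var (-24)))
    (Prog.ite (Expr.var (-28) + 1 - Expr.var (-30)) (Prog.set (-24) (0 - Expr.var (-24)))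
      Prog.skip)

/-- Computes the estimates. -/
def estProg : Prog :=
  Prog.forTo (-21) (Expr.var (-6))
    (Prog.set (-22) (Expr.var (-21) / Expr.var (-2)) ;;
      Prog.set (-23) (Expr.var (-21) - Expr.var (-2) * Expr.var (-22)) ;;
      Prog.set (-25) (Expr.var (-22) / Expr.var (-8)) ;;
      Prog.set (-26) (Expr.var (-23) / Expr.var (-8)) ;;
      Prog.set (-24) (Expr.var (-25) - Expr.var (-26)) ;;
      Prog.set (-25) (Expr.var (-22) - Expr.var (-8) * Expr.var (-25)) ;;
      Prog.set (-26) (Expr.var (-23) - Expr.var (-8) * Expr.var (-26)) ;;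
      swapProg ;; splitProg ;; sampleProg ;;
      Prog.store (Expr.const (-100) - 2 * Expr.var (-21)) (Expr.var (-24) * Expr.var (-33)))

theorem pairKey_cast (x : ℕ) : ((pairKey x : ℕ) : ℤ) = 4 * ((x : ℤ) / 2) + 1 - x := by
  rw [pairKey]; omega

/-- The result is an identity of signed estimates valid for every memory `I`, because the bits are
read later, from a memory with other working cells. -/
theorem swapProg_runs {x y : ℕ} {σ : ℤ} (hY : 1 ≤ Y) (hx : x ≤ 2 ^ β) (hy : y ≤ 2 ^ β)
    (hσ : |σ| ≤ 2 ^ β) {M : Mem} (h24 : M (-24) = σ) (h25 : M (-25) = x) (h26 : M (-26) = y) :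
    ∃ M' x' y' σ', Runs β Y swapProg M M' [] ∧ M' (-24) = σ' ∧ M' (-25) = ((x' : ℕ) : ℤ) ∧
      M' (-26) = ((y' : ℕ) : ℤ) ∧ SameOff (-27) (-24) M M' ∧ pairKey x' ≤ pairKey y' ∧
      |σ'| ≤ |σ| ∧ x' ≤ max x y ∧ y' ≤ max x y ∧
      ∀ (I : Mem) (n m : ℕ), σ * corrEst I n m x y = σ' * ordEst I n m x' y' := by
  by_cases h : pairKey y < pairKey x
  · refine ⟨_, y, x, -σ, Runs.ite_pos hY ?_ (Runs.seq_nil_left hY (Runs.store rfl (y := (x : ℤ))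
      ?_ (abs_natCast_le_two_pow hx)) fun _ => Runs.seq_nil_left hY (Runs.store rfl (y := (y : ℤ))
      ?_ (abs_natCast_le_two_pow hy)) fun _ => Runs.seq_nil_left hY (Runs.store rfl (y := (x : ℤ))
      ?_ (abs_natCast_le_two_pow hx)) fun _ => Runs.store rfl (y := -σ) ?_ (by rwa [abs_neg])),
      ?_, ?_, ?_, ?_, h.le, (abs_neg _).le, le_max_right _ _, le_max_left _ _, fun I n m => ?_⟩
    · have := pairKey_cast x
      have := pairKey_cast y
      simp [h25, h26]; omega
    · simp [h25]
    · simp [h26]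
    · simp
    · simp [h24]
    · simp
    · simp
    · simp
    · exact ((((SameOff.refl _ _ M).update _ (by simp) (by simp)).update _ (by simp)
        (by simp)).update _ (by simp) (by simp)).update _ (by simp) (by simp)
    · rw [corrEst, if_pos h]; ring
  have := pairKey_cast x
  have := pairKey_cast y
  by_cases h' : pairKey x < pairKey y
  · refine ⟨M, x, y, σ, Runs.ite_neg hY ?_ (Runs.ite_pos hY ?_ Runs.skip), h24, h25, h26,
      SameOff.refl _ _ _, not_lt.1 h, le_rfl, le_max_left _ _, le_max_right _ _, fun I n m => ?_⟩
    · simp [h25, h26]; omega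
    · simp [h25, h26]; omega
    · rw [corrEst, if_neg h, if_pos h']
  · refine ⟨_, x, y, 0, Runs.ite_neg hY ?_ (Runs.ite_neg hY ?_ (Runs.store rfl (y := 0) ?_ ?_)),
      ?_, ?_, ?_, (SameOff.refl _ _ _).update _ ?_ ?_, not_lt.1 h, ?_, le_max_left _ _,
      le_max_right _ _, fun I n m => ?_⟩
    · simp [h25, h26]; omega
    · simp [h25, h26]; omega
    · simp
    · simp
    · simp
    · simp [h25]
    · simp [h26]
    · simp
    · simp
    · simp
    · rw [corrEst, if_neg h, if_neg h']; ring

theorem splitProg_runs {x y : ℕ} {σ : ℤ} (hY : 1 ≤ Y) (hx : x ≤ 2 ^ β) (hy : y ≤ 2 ^ β)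
    (hσ : |σ| ≤ 2 ^ β) (hxy : pairKey x ≤ pairKey y) {M : Mem} (h24 : M (-24) = σ)
    (h25 : M (-25) = x) (h26 : M (-26) = y) :
    ∃ M' σ', Runs β Y splitProg M M' [] ∧ M' (-24) = σ' ∧ M' (-28) = (x / 2 : ℕ) ∧
      M' (-29) = (x % 2 : ℕ) ∧ M' (-30) = (y / 2 : ℕ) ∧ M' (-31) = (y % 2 : ℕ) ∧
      SameOff (-31) (-24) M M' ∧ |σ'| = |σ| ∧
      ∀ (I : Mem) (n m : ℕ), σ * ordEst I n m x y =
        σ' * rawEst I n m (x / 2) (x % 2) (y / 2) (y % 2) := by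
  set M₁ : Mem := Function.update M (-28) ((x / 2 : ℕ) : ℤ) with hM₁
  set M₂ : Mem := Function.update M₁ (-29) ((x % 2 : ℕ) : ℤ) with hM₂
  set M₃ : Mem := Function.update M₂ (-30) ((y / 2 : ℕ) : ℤ) with hM₃
  set M₄ : Mem := Function.update M₃ (-31) ((y % 2 : ℕ) : ℤ) with hM₄
  have s1 : Runs β Y (Prog.set (-28) (Expr.var (-25) / 2)) M M₁ [] :=
    Runs.store rfl (by simp [h25]) (abs_natCast_le_two_pow (by omega))
  have s2 : Runs β Y (Prog.set (-29) (Expr.var (-25) - 2 * Expr.var (-28))) M₁ M₂ [] :=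
    Runs.store rfl (by simp [M₁, h25]; omega) (abs_natCast_le_two_pow (by omega))
  have s3 : Runs β Y (Prog.set (-30) (Expr.var (-26) / 2)) M₂ M₃ [] :=
    Runs.store rfl (by simp [M₂, M₁, h26]) (abs_natCast_le_two_pow (by omega))
  have s4 : Runs β Y (Prog.set (-31) (Expr.var (-26) - 2 * Expr.var (-30))) M₃ M₄ [] :=
    Runs.store rfl (by simp [M₃, M₂, M₁, h26]; omega) (abs_natCast_le_two_pow (by omega))
  have hs : SameOff (-31) (-24) M M₄ := ((((SameOff.refl _ _ M).update _ (by simp)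
    (by simp)).update _ (by simp) (by simp)).update _ (by simp) (by simp)).update _ (by simp)
    (by simp)
  have run : ∀ M' q, Runs β Y q M₄ M' [] → Runs β Y (Prog.set (-28) (Expr.var (-25) / 2) ;;
      Prog.set (-29) (Expr.var (-25) - 2 * Expr.var (-28)) ;;
      Prog.set (-30) (Expr.var (-26) / 2) ;;
      Prog.set (-31) (Expr.var (-26) - 2 * Expr.var (-30)) ;; q) M M' [] := fun M' q h =>
    Runs.seq_nil_left hY s1 fun _ => Runs.seq_nil_left hY s2 fun _ => Runs.seq_nil_left hY s3
      fun _ => Runs.seq_nil_left hY s4 fun _ => h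
  have neg : Runs β Y (Prog.set (-24) (0 - Expr.var (-24))) M₄ (Function.update M₄ (-24) (-σ)) [] :=
    Runs.store rfl (by simp [M₄, M₃, M₂, M₁, h24]) (by rwa [abs_neg])
  -- With the modes in order, the test `0 < k + 1 - l` of the program means `k = l`.
  have hk : x / 2 ≤ y / 2 := by simp only [pairKey] at hxy; omega
  by_cases c1 : x % 2 = 1 ∧ y % 2 = 1
  · refine ⟨Function.update M₄ (-24) (-σ), -σ, run _ _ (Runs.ite_pos hY ?_ neg), by simp,
      by simp [M₄, M₃, M₂, M₁], by simp [M₄, M₃, M₂], by simp [M₄, M₃], by simp [M₄],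
      hs.update _ (by simp) (by simp), abs_neg _, fun I n m => ?_⟩
    · simp [M₄, M₃, M₂, c1]
    · rw [ordEst, if_pos (Or.inl c1)]; ring
  have e1 : (Expr.var (-29) * Expr.var (-31)).eval M₄ ≤ 0 := by
    simp only [Expr.eval_mul', Expr.eval_cell', Expr.eval_const']
    have : x % 2 = 0 ∨ y % 2 = 0 := by omega
    rcases this with h | h <;> simp [M₄, M₃, M₂, h]
  by_cases c2 : x / 2 = y / 2
  · refine ⟨Function.update M₄ (-24) (-σ), -σ, run _ _ (Runs.ite_neg hY e1 (Runs.ite_pos hY ?_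
      neg)), by simp, by simp [M₄, M₃, M₂, M₁], by simp [M₄, M₃, M₂], by simp [M₄, M₃],
      by simp [M₄], hs.update _ (by simp) (by simp), abs_neg _, fun I n m => ?_⟩
    · simp [M₄, M₃, M₂, M₁]; omega
    · rw [ordEst, if_pos (Or.inr c2)]; ring
  · refine ⟨M₄, σ, run _ _ (Runs.ite_neg hY e1 (Runs.ite_neg hY ?_ Runs.skip)),
      by simp [M₄, M₃, M₂, M₁, h24], by simp [M₄, M₃, M₂, M₁], by simp [M₄, M₃, M₂],
      by simp [M₄, M₃], by simp [M₄], hs, rfl, fun I n m => ?_⟩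
    · simp [M₄, M₃, M₂, M₁]; omega
    · rw [ordEst, if_neg (by tauto)]; ring

/-- Measured bits are read at nonnegative addresses only, and programs write at negative ones. -/
theorem rawEst_congr {I I' : Mem} (h : ∀ x, 0 ≤ x → I' x = I x) (n m k a l b : ℕ) :
    rawEst I' n m k a l b = rawEst I n m k a l b := by
  unfold rawEst
  refine Finset.sum_congr rfl fun r _ => ?_
  rw [h _ (by positivity)]
  congr 1
  refine Finset.prod_congr rfl fun q _ => ?_
  rw [h _ (by positivity)]

/-- The estimates fill the even addresses `-100 - 2c`; the odd ones below `-100` are left to the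
layers of the recursion, so both arrays can grow without a length computed beforehand. -/
theorem estProg_runs {n m L : ℕ} (hb : ParamBounds n m L β Y) {M : Mem} (hM : MemBd β M)
    (hbit : ∀ x, 3 ≤ x → M x = 0 ∨ M x = 1) (hc : Consts n m L M) :
    ∃ M', Runs β Y estProg M M' [] ∧ Consts n m L M' ∧
      ∀ c < 4 * n * (4 * n), M' (-100 - 2 * c) = dilEst M n m c := by
  have hY := hb.hY
  have hW := hb.hW
  have hsq := hb.hsq
  have hn := hb.n_pos
  have hmY := hb.hm
  obtain ⟨M', r, i1, i2, i3, i4⟩ := Runs.forTo (β := β) (Y := Y) (i := -21) (e := Expr.var (-6))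
    (p := Prog.set (-22) (Expr.var (-21) / Expr.var (-2)) ;;
      Prog.set (-23) (Expr.var (-21) - Expr.var (-2) * Expr.var (-22)) ;;
      Prog.set (-25) (Expr.var (-22) / Expr.var (-8)) ;;
      Prog.set (-26) (Expr.var (-23) / Expr.var (-8)) ;;
      Prog.set (-24) (Expr.var (-25) - Expr.var (-26)) ;;
      Prog.set (-25) (Expr.var (-22) - Expr.var (-8) * Expr.var (-25)) ;;
      Prog.set (-26) (Expr.var (-23) - Expr.var (-8) * Expr.var (-26)) ;;
      swapProg ;; splitProg ;; sampleProg ;;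
      Prog.store (Expr.const (-100) - 2 * Expr.var (-21)) (Expr.var (-24) * Expr.var (-33)))
    (N := 4 * n * (4 * n))
    (fun c N => N (-21) = c ∧ Consts n m L N ∧ (∀ x, 0 ≤ x → N x = M x) ∧
      ∀ c' < c, N (-100 - 2 * c') = dilEst M n m c')
    (fun _ => []) hsq (by exact_mod_cast (show 4 * n * (4 * n) ≤ 2 ^ β by omega))
    (fun c _ N hi => ⟨hi.1, by simp [hi.2.1.sq]⟩)
    (fun c hcN N hN ⟨j1, j2, j3, j4⟩ => by
      have hiW : c / (4 * n) < 4 * n := Nat.div_lt_of_lt_mul hcN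
      have hhW : c % (4 * n) < 4 * n := Nat.mod_lt _ (by omega)
      have hp : c / (4 * n) / (2 * n) < 2 := Nat.div_lt_of_lt_mul (by omega)
      have hq : c % (4 * n) / (2 * n) < 2 := Nat.div_lt_of_lt_mul (by omega)
      have hx : c / (4 * n) % (2 * n) < 2 * n := Nat.mod_lt _ (by omega)
      have hy : c % (4 * n) % (2 * n) < 2 * n := Nat.mod_lt _ (by omega)
      have h2β : (2 : ℤ) ≤ 2 ^ β := by exact_mod_cast (show 2 ≤ 2 ^ β by omega)
      set i := c / (4 * n) with hi
      set h := c % (4 * n) with hh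
      set σ : ℤ := ((i / (2 * n) : ℕ) : ℤ) - ((h / (2 * n) : ℕ) : ℤ) with hσ
      have hσ1 : |σ| ≤ 1 := abs_natCast_sub_le_one (by omega) (by omega)
      have dvh : (c : ℤ) - ((4 * n : ℕ) : ℤ) * (i : ℤ) = (h : ℤ) := by
        have := Nat.div_add_mod c (4 * n); zify at this ⊢; rw [← this]; simp [hi, hh]
      have dvi : (i : ℤ) - ((2 * n : ℕ) : ℤ) * ((i / (2 * n) : ℕ) : ℤ) = ((i % (2 * n) : ℕ) : ℤ) := by
        have := Nat.div_add_mod i (2 * n); zify at this ⊢; linarith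
      have dvj : (h : ℤ) - ((2 * n : ℕ) : ℤ) * ((h / (2 * n) : ℕ) : ℤ) = ((h % (2 * n) : ℕ) : ℤ) := by
        have := Nat.div_add_mod h (2 * n); zify at this ⊢; linarith
      set N₁ : Mem := Function.update N (-22) (i : ℤ)
      set N₂ : Mem := Function.update N₁ (-23) (h : ℤ)
      set N₃ : Mem := Function.update N₂ (-25) ((i / (2 * n) : ℕ) : ℤ)
      set N₄ : Mem := Function.update N₃ (-26) ((h / (2 * n) : ℕ) : ℤ)
      set N₅ : Mem := Function.update N₄ (-24) σ
      set N₆ : Mem := Function.update N₅ (-25) ((i % (2 * n) : ℕ) : ℤ)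
      set N₇ : Mem := Function.update N₆ (-26) ((h % (2 * n) : ℕ) : ℤ)
      have t1 : Runs β Y (Prog.set (-22) (Expr.var (-21) / Expr.var (-2))) N N₁ [] :=
        Runs.store rfl (by simp [j1, j2.cW, hi])
          (abs_natCast_le_two_pow (by omega))
      have t2 : Runs β Y (Prog.set (-23) (Expr.var (-21) - Expr.var (-2) * Expr.var (-22))) N₁ N₂
          [] :=
        Runs.store rfl (by rw [← dvh]; simp [N₁, j1, j2.cW]) (abs_natCast_le_two_pow (by omega))
      have t3 : Runs β Y (Prog.set (-25) (Expr.var (-22) / Expr.var (-8))) N₂ N₃ [] :=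
        Runs.store rfl (by simp [N₂, N₁, j2.cw]) (abs_natCast_le_two_pow (by omega))
      have t4 : Runs β Y (Prog.set (-26) (Expr.var (-23) / Expr.var (-8))) N₃ N₄ [] :=
        Runs.store rfl (by simp [N₃, N₂, N₁, j2.cw]) (abs_natCast_le_two_pow (by omega))
      have t5 : Runs β Y (Prog.set (-24) (Expr.var (-25) - Expr.var (-26))) N₄ N₅ [] :=
        Runs.store rfl (by simp [N₄, N₃, hσ]) (by omega)
      have t6 : Runs β Y (Prog.set (-25) (Expr.var (-22) - Expr.var (-8) * Expr.var (-25))) N₅ N₆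
          [] :=
        Runs.store rfl (by rw [← dvi]; simp [N₅, N₄, N₃, N₂, N₁, j2.cw])
          (abs_natCast_le_two_pow (by omega))
      have t7 : Runs β Y (Prog.set (-26) (Expr.var (-23) - Expr.var (-8) * Expr.var (-26))) N₆ N₇
          [] :=
        Runs.store rfl (by rw [← dvj]; simp [N₆, N₅, N₄, N₃, N₂, N₁, j2.cw])
          (abs_natCast_le_two_pow (by omega))
      have f7 : SameOff (-36) (-22) N N₇ :=
        (((((((SameOff.refl _ _ N).update _ (by simp) (by simp)).update _ (by simp)
          (by simp)).update _ (by simp) (by simp)).update _ (by simp) (by simp)).update _ (by simp)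
          (by simp)).update _ (by simp) (by simp)).update _ (by simp) (by simp)
      obtain ⟨N₈, x', y', σ', t8, k24, k25, k26, f8, hxy, hσ', hx', hy', e8⟩ :=
        swapProg_runs (β := β) (Y := Y) (x := i % (2 * n)) (y := h % (2 * n)) (σ := σ) (M := N₇)
          (by omega) (by omega) (by omega) (by omega) (by simp [N₇, N₆, N₅]) (by simp [N₇, N₆])
          (by simp [N₇])
      obtain ⟨N₉, σ'', t9, l24, l28, l29, l30, l31, f9, hσ'', e9⟩ :=
        splitProg_runs (β := β) (Y := Y) (x := x') (y := y') (σ := σ') (M := N₈)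
          (by omega) (by omega) (by omega) (by omega) hxy k24 k25 k26
      have f8' : SameOff (-36) (-22) N N₈ :=
        f7.trans f8 (by norm_num) (by norm_num) (by norm_num) (by norm_num)
      have f9' : SameOff (-36) (-22) N N₉ :=
        f8'.trans f9 (by norm_num) (by norm_num) (by norm_num) (by norm_num)
      have c9 := j2.of_sameOff f9' (by norm_num)
      have g9 : ∀ x, 0 ≤ x → N₉ x = M x := fun x hx => by rw [f9' x (by omega), j3 x hx]
      obtain ⟨N₁₀, t10, v33, f10⟩ := sampleProg_runs (β := β) (Y := Y) (n := n) (m := m)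
        (k := x' / 2) (a := x' % 2) (l := y' / 2) (b := y' % 2) (M := N₉)
        (by omega) (by omega) (by omega) (by omega) hY
        ((t9 ((t8 (t7 (t6 (t5 (t4 (t3 (t2 (t1 hN).1).1).1).1).1).1).1).1)).1)
        (fun x hx => by rw [g9 x (by omega)]; exact hbit x hx) c9.cn c9.cm l28 l29 l30 l31
      have f10' : SameOff (-36) (-22) N N₁₀ :=
        f9'.trans f10 (by norm_num) (by norm_num) (by norm_num) (by norm_num)
      have val : N₁₀ (-24) * N₁₀ (-33) = dilEst M n m c := by
        rw [f10 (-24) (by norm_num), l24, v33, rawEst_congr g9, ← e9, ← e8, dilEst, hσ]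
      have n21 : N₁₀ (-21) = c := by rw [f10' _ (by norm_num), j1]
      refine ⟨Function.update N₁₀ (-100 - 2 * c) (dilEst M n m c),
        Runs.seq_nil_left (by omega) t1 fun _ => Runs.seq_nil_left (by omega) t2 fun _ =>
        Runs.seq_nil_left (by omega) t3 fun _ => Runs.seq_nil_left (by omega) t4 fun _ =>
        Runs.seq_nil_left (by omega) t5 fun _ => Runs.seq_nil_left (by omega) t6 fun _ =>
        Runs.seq_nil_left (by omega) t7 fun _ => Runs.seq_nil_left (by omega) t8 fun _ =>
        Runs.seq_nil_left (by omega) t9 fun _ => Runs.seq_nil_left (by omega) t10 fun _ =>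
        Runs.store ?_ ?_ ((abs_dilEst_le hbit hcN).trans
          (by exact_mod_cast (show m ≤ 2 ^ β by omega))), ?_, by simp, ?_, ?_, ?_⟩
      · simp [n21]
      · simp [val]
      · rw [Function.update_of_ne (by omega), n21]
      · exact j2.of_sameOff (lo := -100 - 2 * c) (hi := -21) (fun x hx => by
          rw [Function.update_of_ne (by omega), Function.update_of_ne (by omega),
            f10 x (by omega), f9' x (by omega)]) (by norm_num)
      · intro x hx
        rw [Function.update_of_ne (by omega), Function.update_of_ne (by omega),
          f10' x (by omega), j3 x hx]
      · intro c' hc'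
        rw [Function.update_of_ne (by omega)]
        rcases eq_or_ne c' c with rfl | hne
        · simp
        · rw [Function.update_of_ne (by omega), f10' _ (by omega), j4 c' (by omega)])
    hM ⟨by simp, hc.of_sameOff (lo := -21) (hi := -21)
      ((SameOff.refl _ _ M).update _ (by simp) (by simp)) (by norm_num), fun x hx => by
        rw [Function.update_of_ne (by omega)], by simp⟩
  exact ⟨M', by simpa [List.flatMap_eq_nil_iff.2, estProg] using r, i2, i4⟩

end FreeFermion

/-! ### The integer de Casteljau recursion on matrices, its size and its program. -/

open FreeFermion
open scoped Matrix

namespace FreeFermion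

variable {β Y : ℕ}

/-- The sequence defined by course-of-values recursion from `F`. -/
def courseOfValues (F : ℕ → (ℕ → ℤ) → ℤ) (c : ℕ) : ℤ :=
  F c fun x => if _ : x < c then courseOfValues F x else 0

/-- The truncation to `0` beyond `c` in the definition is invisible as soon as `F c` looks only at
earlier terms. -/
theorem courseOfValues_eq (F : ℕ → (ℕ → ℤ) → ℤ) (c : ℕ)
    (h : ∀ f g : ℕ → ℤ, (∀ x < c, f x = g x) → F c f = F c g) :
    courseOfValues F c = F c (courseOfValues F) := by
  rw [courseOfValues]
  exact h _ _ fun x hx => by simp [hx]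

/-- Diagonal blocks of the first layer: the values of the truncation of the identity. -/
def clipNode (n L k : ℕ) : ℤ := max (-L) (min L (4 * n * (2 * k - L)))

/-- One entry of the first layer. -/
def layerInit (n L c : ℕ) : ℤ :=
  if c / (4 * n) % (4 * n) = c % (4 * n) then clipNode n L (c / (4 * n * (4 * n))) else 0

/-- One step of the recursion of the layers, for the position `e` of the preceding layer. -/
def layerStep (S : ℕ → ℤ) (n m e : ℕ) (f : ℕ → ℤ) : ℤ :=
  (4 * n * m : ℕ) * (f e + f (e + 4 * n * (4 * n))) +
    ∑ h ∈ Finset.range (4 * n), S (e / (4 * n) % (4 * n) * (4 * n) + h) *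
      (f (e - e / (4 * n) % (4 * n) * (4 * n) + 4 * n * (4 * n) + h * (4 * n)) -
        f (e - e / (4 * n) % (4 * n) * (4 * n) + h * (4 * n)))

/-- The recursion of the entries of the layers, all in one sequence. -/
def layerRec (S : ℕ → ℤ) (n m L c : ℕ) (f : ℕ → ℤ) : ℤ :=
  if (L + 1) * (4 * n * (4 * n)) ≤ c then layerStep S n m (c - (L + 1) * (4 * n * (4 * n))) f
  else layerInit n L c

/-- The entries of all layers. -/
def layers (S : ℕ → ℤ) (n m L : ℕ) : ℕ → ℤ := courseOfValues (layerRec S n m L)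

theorem row_mul_le (n e : ℕ) : e / (4 * n) % (4 * n) * (4 * n) ≤ e :=
  (Nat.mul_le_mul_right _ (Nat.mod_le _ _)).trans (Nat.div_mul_le_self _ _)

/-- The entry read belongs to the next node of the preceding layer. Layers are `L + 1` nodes apart,
so for `L ≥ 1` that node still lies before the current one. -/
theorem layer_index_lt {n L c h : ℕ} (hL : 1 ≤ L) (hc : (L + 1) * (4 * n * (4 * n)) ≤ c)
    (hh : h < 4 * n) :
    c - (L + 1) * (4 * n * (4 * n)) - (c - (L + 1) * (4 * n * (4 * n))) / (4 * n) % (4 * n) * (4 * n)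
      + 4 * n * (4 * n) + h * (4 * n) < c := by
  have h1 : 2 * (4 * n * (4 * n)) ≤ (L + 1) * (4 * n * (4 * n)) :=
    Nat.mul_le_mul_right _ (by omega)
  have h2 : h * (4 * n) + 4 * n ≤ 4 * n * (4 * n) := by
    have : (h + 1) * (4 * n) ≤ 4 * n * (4 * n) := Nat.mul_le_mul_right _ hh
    linarith [add_mul h 1 (4 * n)]
  omega

theorem layerStep_congr {S : ℕ → ℤ} {n m L c : ℕ} (hL : 1 ≤ L) (hn : 1 ≤ n)
    (hc : (L + 1) * (4 * n * (4 * n)) ≤ c) {f g : ℕ → ℤ} (hfg : ∀ x < c, f x = g x) :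
    layerStep S n m (c - (L + 1) * (4 * n * (4 * n))) f =
      layerStep S n m (c - (L + 1) * (4 * n * (4 * n))) g := by
  have h1 : 2 * (4 * n * (4 * n)) ≤ (L + 1) * (4 * n * (4 * n)) :=
    Nat.mul_le_mul_right _ (by omega)
  have h2 : 0 < 4 * n * (4 * n) := by positivity
  unfold layerStep
  rw [hfg _ (by omega), hfg _ (by omega)]
  congr 1
  refine Finset.sum_congr rfl fun h hh => ?_
  have := layer_index_lt hL hc (Finset.mem_range.1 hh)
  rw [hfg _ this, hfg _ (by omega)]

theorem layers_eq {S : ℕ → ℤ} {n m L : ℕ} (hL : 1 ≤ L) (hn : 1 ≤ n) (c : ℕ) :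
    layers S n m L c = layerRec S n m L c (layers S n m L) := by
  refine courseOfValues_eq _ _ fun f g hfg => ?_
  unfold layerRec
  split_ifs with hc
  · exact layerStep_congr hL hn hc hfg
  · rfl

theorem abs_clipNode_le (n L k : ℕ) : |clipNode n L k| ≤ L := by
  rw [clipNode, abs_le]
  constructor
  · exact le_max_left _ _
  · exact max_le (by omega) (min_le_left _ _)

theorem abs_layerInit_le (n L c : ℕ) : |layerInit n L c| ≤ L := by
  rw [layerInit]
  split_ifs
  · exact abs_clipNode_le _ _ _
  · simp

theorem row_index_lt {n e h : ℕ} (hh : h < 4 * n) :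
    e / (4 * n) % (4 * n) * (4 * n) + h < 4 * n * (4 * n) := by
  have h1 : e / (4 * n) % (4 * n) < 4 * n := Nat.mod_lt _ (by omega)
  have : (e / (4 * n) % (4 * n) + 1) * (4 * n) ≤ 4 * n * (4 * n) := Nat.mul_le_mul_right _ h1
  rw [add_mul] at this
  omega

/-- Bounds for the partial sums of a step. -/
theorem abs_layerStep_partial_le {S : ℕ → ℤ} {n m L c : ℕ} (hL : 1 ≤ L) (hn : 1 ≤ n)
    (hS : ∀ x < 4 * n * (4 * n), |S x| ≤ m) (hc : (L + 1) * (4 * n * (4 * n)) ≤ c)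
    {f : ℕ → ℤ} {B : ℤ} (hf : ∀ x < c, |f x| ≤ B) {N : ℕ} (hN : N ≤ 4 * n) :
    |((4 * n * m : ℕ) : ℤ) * (f (c - (L + 1) * (4 * n * (4 * n))) +
        f (c - (L + 1) * (4 * n * (4 * n)) + 4 * n * (4 * n))) +
      ∑ h ∈ Finset.range N,
        S ((c - (L + 1) * (4 * n * (4 * n))) / (4 * n) % (4 * n) * (4 * n) + h) *
      (f (c - (L + 1) * (4 * n * (4 * n)) -
          (c - (L + 1) * (4 * n * (4 * n))) / (4 * n) % (4 * n) * (4 * n) + 4 * n * (4 * n) +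
          h * (4 * n)) -
        f (c - (L + 1) * (4 * n * (4 * n)) -
          (c - (L + 1) * (4 * n * (4 * n))) / (4 * n) % (4 * n) * (4 * n) + h * (4 * n)))| ≤
      4 * (4 * n * m : ℕ) * B := by
  have h1 : 2 * (4 * n * (4 * n)) ≤ (L + 1) * (4 * n * (4 * n)) :=
    Nat.mul_le_mul_right _ (by omega)
  have h2 : 0 < 4 * n * (4 * n) := by positivity
  have hB : 0 ≤ B := (abs_nonneg _).trans (hf 0 (by omega))
  have idx := fun h (hh : h < 4 * n) => layer_index_lt (n := n) hL hc hh
  set e := c - (L + 1) * (4 * n * (4 * n)) with he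
  have a1 : |((4 * n * m : ℕ) : ℤ) * (f e + f (e + 4 * n * (4 * n)))| ≤
      (4 * n * m : ℕ) * (2 * B) := by
    rw [abs_mul, Nat.abs_cast]
    refine mul_le_mul_of_nonneg_left ((abs_add_le _ _).trans ?_) (by positivity)
    linarith [hf e (by omega), hf (e + 4 * n * (4 * n)) (by omega)]
  have a2 : |∑ h ∈ Finset.range N, S (e / (4 * n) % (4 * n) * (4 * n) + h) *
      (f (e - e / (4 * n) % (4 * n) * (4 * n) + 4 * n * (4 * n) + h * (4 * n)) -
        f (e - e / (4 * n) % (4 * n) * (4 * n) + h * (4 * n)))| ≤ (N : ℤ) * (m * (2 * B)) := by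
    refine (Finset.abs_sum_le_sum_abs _ _).trans ((Finset.sum_le_sum fun h hh => ?_).trans
      (le_of_eq (by rw [Finset.sum_const, Finset.card_range, nsmul_eq_mul])))
    have hh' : h < 4 * n := lt_of_lt_of_le (Finset.mem_range.1 hh) hN
    have := idx h hh'
    rw [abs_mul]
    refine mul_le_mul (hS _ (row_index_lt hh')) ((abs_sub _ _).trans ?_) (abs_nonneg _)
      (by positivity)
    linarith [hf _ this, hf (e - e / (4 * n) % (4 * n) * (4 * n) + h * (4 * n)) (by omega)]
  have a3 : (N : ℤ) * (m * (2 * B)) ≤ ((4 * n : ℕ) : ℤ) * (m * (2 * B)) :=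
    mul_le_mul_of_nonneg_right (by exact_mod_cast hN) (by positivity)
  refine (abs_add_le _ _).trans ?_
  push_cast at *
  linarith

/-- One step multiplies a bound on the earlier entries by at most `4D` with `D = 4nm`: `2D` from the
scalar term and `2D` from the `4n` products with entries of size `m`. Using the position `c` as
exponent, instead of the layer number, is wasteful but keeps the bit length polynomial. -/
theorem abs_layers_le {S : ℕ → ℤ} {n m L : ℕ} (hL : 1 ≤ L) (hn : 1 ≤ n) (hm : 1 ≤ m)
    (hS : ∀ x < 4 * n * (4 * n), |S x| ≤ m) (c : ℕ) :
    |layers S n m L c| ≤ L * ((4 * (4 * n * m) : ℕ) : ℤ) ^ c := by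
  have hD : (1 : ℤ) ≤ ((4 * (4 * n * m) : ℕ) : ℤ) := by
    exact_mod_cast Nat.succ_le_of_lt (by positivity)
  induction c using Nat.strong_induction_on with
  | _ c ih =>
    rw [layers_eq hL hn, layerRec]
    split_ifs with hc
    · have hpos : 0 < (L + 1) * (4 * n * (4 * n)) := by positivity
      obtain ⟨d, rfl⟩ : ∃ d, c = d + 1 := ⟨c - 1, by omega⟩
      refine (abs_layerStep_partial_le hL hn hS hc (B := L * ((4 * (4 * n * m) : ℕ) : ℤ) ^ d)
        (fun x hx => (ih x hx).trans ?_) le_rfl).trans (le_of_eq ?_)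
      · exact mul_le_mul_of_nonneg_left (pow_le_pow_right₀ hD (by omega)) (by positivity)
      · push_cast; ring
    · refine (abs_layerInit_le _ _ _).trans ?_
      exact le_mul_of_one_le_right (by positivity) (one_le_pow₀ hD)

/-- Address of the entry `e` of the sequence of layers. -/
def layerAddr (e : Expr) : Expr := Expr.const (-101) - 2 * e

/-- Computes an entry of the first layer. -/
def layerInitProg : Prog :=
  Prog.set (-22) (Expr.var (-21) / Expr.var (-2)) ;;
  Prog.set (-24) (Expr.var (-21) / Expr.var (-6)) ;;
  Prog.set (-23) 0 ;;
  Prog.set (-25) (Expr.var (-22) - Expr.var (-2) * Expr.var (-24) -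
    (Expr.var (-21) - Expr.var (-2) * Expr.var (-22))) ;;
  Prog.ite (Expr.var (-25)) Prog.skip (Prog.ite (0 - Expr.var (-25)) Prog.skip
    (Prog.ite (Expr.var (-2) * (2 * Expr.var (-24) - Expr.var (-3)) - Expr.var (-3))
      (Prog.set (-23) (Expr.var (-3)))
      (Prog.ite (0 - Expr.var (-3) - Expr.var (-2) * (2 * Expr.var (-24) - Expr.var (-3)))
        (Prog.set (-23) (0 - Expr.var (-3)))
        (Prog.set (-23) (Expr.var (-2) * (2 * Expr.var (-24) - Expr.var (-3)))))))

/-- Computes an entry of a later layer. -/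
def layerStepProg : Prog :=
  Prog.set (-25) (Expr.var (-21) - Expr.var (-4)) ;;
  Prog.set (-22) (Expr.var (-25) / Expr.var (-2) -
    Expr.var (-2) * (Expr.var (-25) / Expr.var (-6))) ;;
  Prog.set (-26) (Expr.var (-25) - Expr.var (-22) * Expr.var (-2)) ;;
  Prog.set (-23) (Expr.var (-5) * (Expr.cell (layerAddr (Expr.var (-25))) +
    Expr.cell (layerAddr (Expr.var (-25) + Expr.var (-6))))) ;;
  Prog.forTo (-24) (Expr.var (-2))
    (Prog.set (-23) (Expr.var (-23) +
      Expr.cell (Expr.const (-100) - 2 * (Expr.var (-22) * Expr.var (-2) + Expr.var (-24))) *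
      (Expr.cell (layerAddr (Expr.var (-26) + Expr.var (-6) + Expr.var (-24) * Expr.var (-2))) -
        Expr.cell (layerAddr (Expr.var (-26) + Expr.var (-24) * Expr.var (-2))))))

/-- Computes the layers. -/
def layersProg : Prog :=
  Prog.forTo (-21) (Expr.var (-7))
    (Prog.ite (Expr.var (-21) + 1 - Expr.var (-4)) layerStepProg layerInitProg ;;
      Prog.store (layerAddr (Expr.var (-21))) (Expr.var (-23)))

theorem sub_mul_div_eq_mod (c k : ℕ) : (c : ℤ) - (k : ℤ) * ((c / k : ℕ) : ℤ) = ((c % k : ℕ) : ℤ) := by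
  have := Nat.div_add_mod c k; zify at this ⊢; linarith

theorem div_sub_mul_div_eq (c k : ℕ) :
    ((c / k : ℕ) : ℤ) - (k : ℤ) * ((c / (k * k) : ℕ) : ℤ) = ((c / k % k : ℕ) : ℤ) := by
  rw [← sub_mul_div_eq_mod, Nat.div_div_eq_div_mul]

theorem layerInitProg_runs {n m L c : ℕ} (hb : ParamBounds n m L β Y) (hcY : c ≤ Y)
    {M : Mem} (hc : Consts n m L M) (h21 : M (-21) = c) :
    ∃ M', Runs β Y layerInitProg M M' [] ∧ M' (-23) = layerInit n L c ∧
      SameOff (-26) (-22) M M' := by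
  have hY := hb.hY
  have hW := hb.hW
  have hn := hb.n_pos
  have hLβ : (L : ℤ) ≤ 2 ^ β := by exact_mod_cast (show L ≤ 2 ^ β by have := hb.hL; omega)
  -- `k` is the number of the node, and `z` the difference of row and column. Off the diagonal `z`
  -- is nonzero and the stored value remains `0`.
  set i := c / (4 * n) with hi
  set k := c / (4 * n * (4 * n)) with hk
  have hiY : i ≤ c := Nat.div_le_self _ _
  have hkY : k ≤ c := Nat.div_le_self _ _
  have hr : i % (4 * n) < 4 * n := Nat.mod_lt _ (by omega)
  have hj : c % (4 * n) < 4 * n := Nat.mod_lt _ (by omega)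
  set z : ℤ := ((i % (4 * n) : ℕ) : ℤ) - ((c % (4 * n) : ℕ) : ℤ) with hz
  have hz' : z = 0 ↔ i % (4 * n) = c % (4 * n) := by rw [hz, sub_eq_zero, Nat.cast_inj]
  set M₁ : Mem := Function.update M (-22) (i : ℤ) with hM1
  set M₂ : Mem := Function.update M₁ (-24) (k : ℤ) with hM2
  set M₃ : Mem := Function.update M₂ (-23) 0 with hM3
  set M₄ : Mem := Function.update M₃ (-25) z with hM4
  have s1 : Runs β Y (Prog.set (-22) (Expr.var (-21) / Expr.var (-2))) M M₁ [] :=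
    Runs.store rfl (by simp [h21, hc.cW, hi]) (abs_natCast_le_two_pow (by omega))
  have s2 : Runs β Y (Prog.set (-24) (Expr.var (-21) / Expr.var (-6))) M₁ M₂ [] :=
    Runs.store rfl (by simp [M₁, h21, hc.sq, hk]) (abs_natCast_le_two_pow (by omega))
  have s3 : Runs β Y (Prog.set (-23) 0) M₂ M₃ [] := Runs.store rfl rfl (by simp)
  have s4 : Runs β Y (Prog.set (-25) (Expr.var (-22) - Expr.var (-2) * Expr.var (-24) -
      (Expr.var (-21) - Expr.var (-2) * Expr.var (-22)))) M₃ M₄ [] := by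
    refine Runs.store rfl ?_ ?_
    · rw [hz, ← sub_mul_div_eq_mod c (4 * n), hi, ← div_sub_mul_div_eq c (4 * n)]
      simp [M₃, M₂, M₁, h21, hc.cW, hi, hk]
    · have h4 : ((4 * n : ℕ) : ℤ) ≤ 2 ^ β := by exact_mod_cast (show 4 * n ≤ 2 ^ β by omega)
      rw [abs_le]; omega
  have f4 : SameOff (-26) (-22) M M₄ := ((((SameOff.refl _ _ M).update _ (by simp)
    (by simp)).update _ (by simp) (by simp)).update _ (by simp) (by simp)).update _ (by simp)
    (by simp)
  have c4 := hc.of_sameOff f4 (by norm_num)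
  have v24 : M₄ (-24) = k := by simp [M₄, M₃, M₂]
  have v25 : M₄ (-25) = z := by simp [M₄]
  have v23 : M₄ (-23) = 0 := by simp [M₄, M₃]
  have run : ∀ M' q, Runs β Y q M₄ M' [] → Runs β Y (Prog.set (-22) (Expr.var (-21) / Expr.var (-2))
      ;; Prog.set (-24) (Expr.var (-21) / Expr.var (-6)) ;; Prog.set (-23) 0 ;;
      Prog.set (-25) (Expr.var (-22) - Expr.var (-2) * Expr.var (-24) -
      (Expr.var (-21) - Expr.var (-2) * Expr.var (-22))) ;; q) M M' [] := fun M' q h =>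
    Runs.seq_nil_left (by omega) s1 fun _ => Runs.seq_nil_left (by omega) s2 fun _ =>
      Runs.seq_nil_left (by omega) s3 fun _ => Runs.seq_nil_left (by omega) s4 fun _ => h
  by_cases hz0 : z = 0
  swap
  · have e : layerInit n L c = 0 := by rw [layerInit, if_neg (fun h => hz0 (hz'.2 h))]
    rcases lt_or_gt_of_ne hz0 with h | h
    · exact ⟨M₄, run _ _ (Runs.ite_neg (by omega) (by simp [v25, h.le])
        (Runs.ite_pos (by omega) (by simp [v25, h]) Runs.skip)), by rw [v23, e], f4⟩
    · exact ⟨M₄, run _ _ (Runs.ite_pos (by omega) (by simp [v25, h]) Runs.skip),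
        by rw [v23, e], f4⟩
  have e : layerInit n L c = clipNode n L k := by rw [layerInit, if_pos (hz'.1 hz0)]
  have e1 : (Expr.var (-25)).eval M₄ ≤ 0 := by simp [v25, hz0]
  have e2 : (0 - Expr.var (-25)).eval M₄ ≤ 0 := by simp [v25, hz0]
  set y : ℤ := 4 * n * (2 * k - L) with hy
  have ey : (Expr.var (-2) * (2 * Expr.var (-24) - Expr.var (-3))).eval M₄ = y := by
    simp [v24, c4.cW, c4.cL, hy]
  have eL : (Expr.var (-3)).eval M₄ = L := by simp [c4.cL]
  have hcl : clipNode n L k = max (-(L : ℤ)) (min (L : ℤ) y) := rfl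
  by_cases h1 : (L : ℤ) < y
  · refine ⟨Function.update M₄ (-23) L, run _ _ (Runs.ite_neg (by omega) e1 (Runs.ite_neg
      (by omega) e2 (Runs.ite_pos (by omega) ?_ (Runs.store rfl eL ?_)))), ?_,
      f4.update _ (by simp) (by simp)⟩
    · rw [Expr.eval_sub', ey, eL]; omega
    · rw [abs_le]; omega
    · rw [e, hcl]; simp; omega
  by_cases h2 : y < -L
  · refine ⟨Function.update M₄ (-23) (-L), run _ _ (Runs.ite_neg (by omega) e1 (Runs.ite_neg
      (by omega) e2 (Runs.ite_neg (by omega) ?_ (Runs.ite_pos (by omega) ?_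
      (Runs.store rfl ?_ ?_))))), ?_, f4.update _ (by simp) (by simp)⟩
    · rw [Expr.eval_sub', ey, eL]; omega
    · rw [Expr.eval_sub', Expr.eval_sub', ey, eL, Expr.eval_zero']; omega
    · rw [Expr.eval_sub', eL, Expr.eval_zero']; omega
    · rw [abs_le]; omega
    · rw [e, hcl]; simp; omega
  · refine ⟨Function.update M₄ (-23) y, run _ _ (Runs.ite_neg (by omega) e1 (Runs.ite_neg
      (by omega) e2 (Runs.ite_neg (by omega) ?_ (Runs.ite_neg (by omega) ?_
      (Runs.store rfl ey ?_))))), ?_, f4.update _ (by simp) (by simp)⟩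
    · rw [Expr.eval_sub', ey, eL]; omega
    · rw [Expr.eval_sub', Expr.eval_sub', ey, eL, Expr.eval_zero']; omega
    · rw [abs_le]; omega
    · rw [e, hcl]; simp; omega

theorem layerStepProg_runs {n m L c : ℕ} (hb : ParamBounds n m L β Y) (hL : 1 ≤ L)
    (hcY : c ≤ Y) (hcK : (L + 1) * (4 * n * (4 * n)) ≤ c) {S f : ℕ → ℤ} {B : ℤ}
    (hS : ∀ x < 4 * n * (4 * n), |S x| ≤ m) (hf : ∀ x < c, |f x| ≤ B)
    (hB : 4 * (4 * n * m : ℕ) * B ≤ 2 ^ β)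
    {M : Mem} (hM : MemBd β M) (hc : Consts n m L M) (h21 : M (-21) = c)
    (hMS : ∀ x < 4 * n * (4 * n), M (-100 - 2 * x) = S x)
    (hMf : ∀ x < c, M (-101 - 2 * x) = f x) :
    ∃ M', Runs β Y layerStepProg M M' [] ∧
      M' (-23) = layerStep S n m (c - (L + 1) * (4 * n * (4 * n))) f ∧
      SameOff (-26) (-22) M M' := by
  have hY := hb.hY
  have hW := hb.hW
  have hn := hb.n_pos
  have h1 : 2 * (4 * n * (4 * n)) ≤ (L + 1) * (4 * n * (4 * n)) :=
    Nat.mul_le_mul_right _ (by omega)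
  have h2 : 0 < 4 * n * (4 * n) := by positivity
  have part := fun N (hN : N ≤ 4 * n) => abs_layerStep_partial_le hL hn hS hcK hf hN
  have idx := fun h (hh : h < 4 * n) => layer_index_lt (n := n) hL hcK hh
  set e := c - (L + 1) * (4 * n * (4 * n)) with he
  set i := e / (4 * n) % (4 * n) with hi
  have hie : i * (4 * n) ≤ e := row_mul_le n e
  have hir : i < 4 * n := Nat.mod_lt _ (by omega)
  -- The partial sums of one matrix product entry. All of them, not only the last, must fit into a
  -- cell, which is the purpose of the bound for arbitrary `N ≤ 4n`.
  set acc : ℕ → ℤ := fun N => ((4 * n * m : ℕ) : ℤ) * (f e + f (e + 4 * n * (4 * n))) +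
    ∑ h ∈ Finset.range N, S (i * (4 * n) + h) *
      (f (e - i * (4 * n) + 4 * n * (4 * n) + h * (4 * n)) - f (e - i * (4 * n) + h * (4 * n)))
    with hacc
  have bacc : ∀ N ≤ 4 * n, |acc N| ≤ 2 ^ β := fun N hN => (part N hN).trans hB
  set M₁ : Mem := Function.update M (-25) (e : ℤ)
  set M₂ : Mem := Function.update M₁ (-22) (i : ℤ)
  set M₃ : Mem := Function.update M₂ (-26) ((e - i * (4 * n) : ℕ) : ℤ)
  set M₄ : Mem := Function.update M₃ (-23) (acc 0)
  have s1 : Runs β Y (Prog.set (-25) (Expr.var (-21) - Expr.var (-4))) M M₁ [] := by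
    refine Runs.store rfl ?_ (abs_natCast_le_two_pow (by omega))
    rw [he, Nat.cast_sub hcK]
    simp [h21, hc.layer]
  have s2 : Runs β Y (Prog.set (-22) (Expr.var (-25) / Expr.var (-2) -
      Expr.var (-2) * (Expr.var (-25) / Expr.var (-6)))) M₁ M₂ [] := by
    refine Runs.store rfl ?_ (abs_natCast_le_two_pow (by omega))
    rw [hi, ← div_sub_mul_div_eq]
    simp [M₁, hc.cW, hc.sq]
  have s3 : Runs β Y (Prog.set (-26) (Expr.var (-25) - Expr.var (-22) * Expr.var (-2))) M₂ M₃
      [] := by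
    refine Runs.store rfl ?_ (abs_natCast_le_two_pow (by omega))
    rw [Nat.cast_sub hie]
    simp [M₂, M₁, hc.cW]
  have f3 : SameOff (-26) (-22) M M₃ := (((SameOff.refl _ _ M).update _ (by simp)
    (by simp)).update _ (by simp) (by simp)).update _ (by simp) (by simp)
  have s4 : Runs β Y (Prog.set (-23) (Expr.var (-5) * (Expr.cell (layerAddr (Expr.var (-25))) +
      Expr.cell (layerAddr (Expr.var (-25) + Expr.var (-6)))))) M₃ M₄ [] := by
    refine Runs.store rfl ?_ (bacc 0 (by omega))
    have c3 := hc.of_sameOff f3 (by norm_num)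
    have v25 : M₃ (-25) = e := by simp [M₃, M₂, M₁]
    have a1 : (layerAddr (Expr.var (-25))).eval M₃ = -101 - 2 * (e : ℤ) := by
      simp [layerAddr, v25]
    have a2 : (layerAddr (Expr.var (-25) + Expr.var (-6))).eval M₃ =
        -101 - 2 * ((e + 4 * n * (4 * n) : ℕ) : ℤ) := by
      simp [layerAddr, v25, c3.sq]
    simp only [Expr.eval_mul', Expr.eval_add', Expr.eval_cell', Expr.eval_const', a1, a2]
    rw [f3 (-5) (by omega), f3 (-101 - 2 * (e : ℤ)) (by omega),
      f3 (-101 - 2 * ((e + 4 * n * (4 * n) : ℕ) : ℤ)) (by omega), hMf e (by omega),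
      hMf (e + 4 * n * (4 * n)) (by omega), hc.scale]
    simp [hacc]
  have f4 : SameOff (-26) (-22) M M₄ := f3.update _ (by simp) (by simp)
  obtain ⟨M', r, i1, i2, i3, i4, i5⟩ := Runs.forTo (β := β) (Y := Y) (i := -24)
    (e := Expr.var (-2))
    (p := Prog.set (-23) (Expr.var (-23) +
      Expr.cell (Expr.const (-100) - 2 * (Expr.var (-22) * Expr.var (-2) + Expr.var (-24))) *
      (Expr.cell (layerAddr (Expr.var (-26) + Expr.var (-6) + Expr.var (-24) * Expr.var (-2))) -
        Expr.cell (layerAddr (Expr.var (-26) + Expr.var (-24) * Expr.var (-2))))))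
    (N := 4 * n)
    (fun h N => N (-24) = h ∧ N (-23) = acc h ∧ N (-22) = i ∧ N (-26) = (e - i * (4 * n) : ℕ) ∧
      SameOff (-26) (-22) M N)
    (fun _ => []) hW (by exact_mod_cast (show 4 * n ≤ 2 ^ β by omega))
    (fun h _ N hi => ⟨hi.1, by simp [hi.2.2.2.2 (-2) (by norm_num), hc.cW]⟩)
    (fun h hh N hN ⟨j1, j2, j3, j4, j5⟩ => by
      have cN := hc.of_sameOff j5 (by norm_num)
      refine ⟨Function.update N (-23) (acc (h + 1)), Runs.store rfl ?_ (bacc _ hh), by simp [j1],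
        by simp, by simp, by simp [j3], by simp [j4],
        (j5.update _ (by simp) (by simp)).update _ (by simp) (by simp)⟩
      have a1 : (Expr.const (-100) - 2 * (Expr.var (-22) * Expr.var (-2) + Expr.var (-24))).eval N =
          -100 - 2 * ((i * (4 * n) + h : ℕ) : ℤ) := by
        simp [j1, j3, cN.cW]
      have a2 : (layerAddr (Expr.var (-26) + Expr.var (-6) + Expr.var (-24) * Expr.var (-2))).eval N
          = -101 - 2 * ((e - i * (4 * n) + 4 * n * (4 * n) + h * (4 * n) : ℕ) : ℤ) := by
        simp [layerAddr, j1, j4, cN.cW, cN.sq]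
      have a3 : (layerAddr (Expr.var (-26) + Expr.var (-24) * Expr.var (-2))).eval N
          = -101 - 2 * ((e - i * (4 * n) + h * (4 * n) : ℕ) : ℤ) := by
        simp [layerAddr, j1, j4, cN.cW]
      have := idx h hh
      rw [Expr.eval_add', Expr.eval_mul', Expr.eval_sub']
      simp only [Expr.eval_cell', Expr.eval_const', a1, a2, a3]
      rw [j5 (-100 - 2 * _) (by omega), j5 (-101 - 2 * ((_ + _ + _ : ℕ) : ℤ)) (by omega),
        j5 (-101 - 2 * ((_ + _ : ℕ) : ℤ)) (by omega), hMS _ (row_index_lt hh), hMf _ this, hMf _ (by omega)]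
      simp only [j2, hacc, Finset.sum_range_succ]
      ring)
    (s4 (s3 (s2 (s1 hM).1).1).1).1
    ⟨by simp, by simp [M₄], by simp [M₄, M₃, M₂], by simp [M₄, M₃],
      f4.update _ (by simp) (by simp)⟩
  exact ⟨M', Runs.seq_nil_left (by omega) s1 fun _ => Runs.seq_nil_left (by omega) s2 fun _ =>
    Runs.seq_nil_left (by omega) s3 fun _ => Runs.seq_nil_left (by omega) s4 fun _ => by
      simpa [List.flatMap_eq_nil_iff.2] using r, i2, i5⟩

theorem layersProg_runs {n m L : ℕ} (hb : ParamBounds n m L β Y) (hL : 1 ≤ L) {S : ℕ → ℤ}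
    (hS : ∀ x < 4 * n * (4 * n), |S x| ≤ m) {M : Mem} (hM : MemBd β M) (hc : Consts n m L M)
    (hMS : ∀ x < 4 * n * (4 * n), M (-100 - 2 * x) = S x) :
    ∃ M', Runs β Y layersProg M M' [] ∧ Consts n m L M' ∧
      ∀ c < L * ((L + 1) * (4 * n * (4 * n))) + 4 * n * (4 * n),
        M' (-101 - 2 * c) = layers S n m L c := by
  have hY := hb.hY
  have hn := hb.n_pos
  have htot := hb.htotal
  set T := L * ((L + 1) * (4 * n * (4 * n))) + 4 * n * (4 * n) with hT
  have hD : 1 ≤ 4 * (4 * n * m) := by have := hb.m_pos; exact Nat.succ_le_of_lt (by positivity)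
  have hval : ∀ c ≤ T, (L : ℤ) * ((4 * (4 * n * m) : ℕ) : ℤ) ^ c ≤ 2 ^ β := fun c hc => by
    exact_mod_cast (Nat.mul_le_mul_left _ (Nat.pow_le_pow_right hD hc)).trans hb.hval
  have habs := abs_layers_le hL hn hb.m_pos hS
  obtain ⟨M', r, i1, i2, i3, i4⟩ := Runs.forTo (β := β) (Y := Y) (i := -21) (e := Expr.var (-7))
    (p := Prog.ite (Expr.var (-21) + 1 - Expr.var (-4)) layerStepProg layerInitProg ;;
      Prog.store (layerAddr (Expr.var (-21))) (Expr.var (-23))) (N := T)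
    (fun c N => N (-21) = c ∧ Consts n m L N ∧
      (∀ x < 4 * n * (4 * n), N (-100 - 2 * x) = S x) ∧
      ∀ x < c, N (-101 - 2 * x) = layers S n m L x)
    (fun _ => []) htot (by exact_mod_cast (show T ≤ 2 ^ β by omega))
    (fun c _ N hi => ⟨hi.1, by simp only [Expr.eval_cell', Expr.eval_const', hi.2.1.total]; rfl⟩)
    (fun c hcT N hN ⟨j1, j2, j3, j4⟩ => by
      have main : ∃ N', Runs β Y (Prog.ite (Expr.var (-21) + 1 - Expr.var (-4)) layerStepProg
          layerInitProg) N N' [] ∧ N' (-23) = layers S n m L c ∧ SameOff (-26) (-22) N N' := by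
        have ev : (Expr.var (-21) + 1 - Expr.var (-4)).eval N =
            c + 1 - ((L + 1) * (4 * n * (4 * n)) : ℕ) := by
          simp only [Expr.eval_sub', Expr.eval_add', Expr.eval_cell', Expr.eval_const', j1,
            j2.layer, Expr.eval_one']
        by_cases hcK : (L + 1) * (4 * n * (4 * n)) ≤ c
        · have hpos : 0 < (L + 1) * (4 * n * (4 * n)) := by positivity
          -- All earlier entries are bounded by the power with exponent `c - 1`; the factor `4D` of
          -- one step restores the exponent `c`.
          obtain ⟨N', t, v, g⟩ := layerStepProg_runs hb hL (by omega) hcK hS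
            (f := layers S n m L) (B := L * ((4 * (4 * n * m) : ℕ) : ℤ) ^ (c - 1))
            (fun x hx => (habs x).trans (mul_le_mul_of_nonneg_left (pow_le_pow_right₀
              (by exact_mod_cast hD) (by omega)) (by positivity)))
            ((le_of_eq (by
              obtain ⟨d, rfl⟩ : ∃ d, c = d + 1 := ⟨c - 1, by omega⟩
              push_cast; simp only [pow_succ]; ring)).trans (hval c hcT.le))
            hN j2 j1 j3 j4
          refine ⟨N', Runs.ite_pos (by omega) (by rw [ev]; omega) t, ?_, g⟩
          rw [v, layers_eq hL hn c, layerRec, if_pos hcK]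
        · obtain ⟨N', t, v, g⟩ := layerInitProg_runs hb (c := c) (by omega) j2 j1
          refine ⟨N', Runs.ite_neg (by omega) (by rw [ev]; omega) t, ?_, g⟩
          rw [v, layers_eq hL hn c, layerRec, if_neg hcK]
      obtain ⟨N', t, v, g⟩ := main
      have n21 : N' (-21) = c := by rw [g _ (by norm_num), j1]
      refine ⟨Function.update N' (-101 - 2 * c) (layers S n m L c),
        Runs.seq_nil_left (by omega) t fun _ => Runs.store ?_ ?_ ((habs c).trans (hval c hcT.le)),
        ?_, by simp, ?_, ?_, ?_⟩
      · simp [layerAddr, n21]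
      · simp [v]
      · rw [Function.update_of_ne (by omega), n21]
      · exact j2.of_sameOff (lo := -101 - 2 * c) (hi := -21) (fun x hx => by
          rw [Function.update_of_ne (by omega), Function.update_of_ne (by omega),
            g x (by omega)]) (by norm_num)
      · intro x hx
        rw [Function.update_of_ne (by omega), Function.update_of_ne (by omega), g _ (by omega),
          j3 x hx]
      · intro x hx
        rw [Function.update_of_ne (by omega)]
        rcases eq_or_ne x c with rfl | hne
        · simp
        · rw [Function.update_of_ne (by omega), g _ (by omega), j4 x (by omega)])
    hM ⟨by simp, hc.of_sameOff (lo := -21) (hi := -21)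
      ((SameOff.refl _ _ M).update _ (by simp) (by simp)) (by norm_num), fun x hx => by
        rw [Function.update_of_ne (by omega), hMS x hx], by simp⟩
  exact ⟨M', by simpa [List.flatMap_eq_nil_iff.2, layersProg] using r, i2, i4⟩

/-! ### Printing the description -/

/-- Prints the description. -/
def printProg : Prog :=
  Prog.emit (Expr.var (-9)) ;;
  Prog.forTo (-21) (Expr.var (-8)) (Prog.forTo (-22) (Expr.var (-8))
    (Prog.emit (
      Expr.cell (layerAddr (Expr.var (-3) * Expr.var (-4) +
        ((Expr.var (-8) + Expr.var (-21)) * Expr.var (-2) + Expr.var (-22)))) -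
      Expr.cell (layerAddr (Expr.var (-3) * Expr.var (-4) +
        ((Expr.var (-8) + Expr.var (-22)) * Expr.var (-2) + Expr.var (-21)))))))

/-- The printed entries. -/
def outEntry (u : ℕ → ℤ) (n L i j : ℕ) : ℤ :=
  u (L * ((L + 1) * (4 * n * (4 * n))) + ((2 * n + i) * (4 * n) + j)) -
    u (L * ((L + 1) * (4 * n * (4 * n))) + ((2 * n + j) * (4 * n) + i))

/-- The offset `L (L + 1) (4n)²` points to node `0` of the last layer, and rows `2n + i` with
columns `j < 2n` form its lower left block. Subtracting the transposed entry antisymmetrizes; the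
factor `1 / 2` is in the denominator. -/
theorem printProg_runs {n m L : ℕ} (hb : ParamBounds n m L β Y) {u : ℕ → ℤ} {M : Mem}
    (hM : MemBd β M) (hc : Consts n m L M)
    (hu : ∀ c < L * ((L + 1) * (4 * n * (4 * n))) + 4 * n * (4 * n), M (-101 - 2 * c) = u c) :
    ∃ M', Runs β Y printProg M M' (((2 * L * (2 * (4 * n * m)) ^ L : ℕ) : ℤ) ::
      (List.range (2 * n)).flatMap fun i => (List.range (2 * n)).flatMap fun j =>
        [outEntry u n L i j]) := by
  have hY := hb.hY
  have hW := hb.hW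
  have idx : ∀ i j, i < 2 * n → j < 2 * n → (2 * n + i) * (4 * n) + j < 4 * n * (4 * n) := by
    intro i j hi hj
    have : (2 * n + i + 1) * (4 * n) ≤ 4 * n * (4 * n) := Nat.mul_le_mul_right _ (by omega)
    rw [add_mul _ 1] at this
    omega
  obtain ⟨M', r, -⟩ := Runs.forTo (β := β) (Y := Y) (i := -21) (e := Expr.var (-8))
    (p := Prog.forTo (-22) (Expr.var (-8)) (Prog.emit (
      Expr.cell (layerAddr (Expr.var (-3) * Expr.var (-4) +
        ((Expr.var (-8) + Expr.var (-21)) * Expr.var (-2) + Expr.var (-22)))) -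
      Expr.cell (layerAddr (Expr.var (-3) * Expr.var (-4) +
        ((Expr.var (-8) + Expr.var (-22)) * Expr.var (-2) + Expr.var (-21))))))) (N := 2 * n)
    (fun i N => N (-21) = i ∧ SameOff (-22) (-21) M N)
    (fun i => (List.range (2 * n)).flatMap fun j => [outEntry u n L i j]) (by omega)
    (by exact_mod_cast (show 2 * n ≤ 2 ^ β by omega))
    (fun i _ N hi => ⟨hi.1, by simp [(hc.of_sameOff hi.2 (by norm_num)).cw]⟩)
    (fun i hi N hN ⟨j1, j2⟩ => by
      obtain ⟨N', t, k1, k2, k3⟩ := Runs.forTo (β := β) (Y := Y) (i := -22) (e := Expr.var (-8))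
        (p := Prog.emit (
          Expr.cell (layerAddr (Expr.var (-3) * Expr.var (-4) +
            ((Expr.var (-8) + Expr.var (-21)) * Expr.var (-2) + Expr.var (-22)))) -
          Expr.cell (layerAddr (Expr.var (-3) * Expr.var (-4) +
            ((Expr.var (-8) + Expr.var (-22)) * Expr.var (-2) + Expr.var (-21)))))) (N := 2 * n)
        (fun j N => N (-22) = j ∧ N (-21) = i ∧ SameOff (-22) (-21) M N)
        (fun j => [outEntry u n L i j]) (by omega)
        (by exact_mod_cast (show 2 * n ≤ 2 ^ β by omega))
        (fun j _ N hi => ⟨hi.1, by simp [(hc.of_sameOff hi.2.2 (by norm_num)).cw]⟩)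
        (fun j hj N hN ⟨l1, l2, l3⟩ => by
          have cN := hc.of_sameOff l3 (by norm_num)
          refine ⟨N, Runs.emit ?_, l1, by simp, by simp [l2],
            l3.update _ (by simp) (by simp)⟩
          have a1 : (layerAddr (Expr.var (-3) * Expr.var (-4) +
              ((Expr.var (-8) + Expr.var (-21)) * Expr.var (-2) + Expr.var (-22)))).eval N =
              -101 - 2 * ((L * ((L + 1) * (4 * n * (4 * n))) +
                ((2 * n + i) * (4 * n) + j) : ℕ) : ℤ) := by
            simp [layerAddr, l1, l2, cN.cw, cN.cW, cN.cL, cN.layer]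
          have a2 : (layerAddr (Expr.var (-3) * Expr.var (-4) +
              ((Expr.var (-8) + Expr.var (-22)) * Expr.var (-2) + Expr.var (-21)))).eval N =
              -101 - 2 * ((L * ((L + 1) * (4 * n * (4 * n))) +
                ((2 * n + j) * (4 * n) + i) : ℕ) : ℤ) := by
            simp [layerAddr, l1, l2, cN.cw, cN.cW, cN.cL, cN.layer]
          have b1 := idx i j hi hj
          have b2 := idx j i hj hi
          rw [Expr.eval_sub']
          simp only [Expr.eval_cell', a1, a2]
          rw [l3 _ (by omega), l3 _ (by omega), hu _ (by omega), hu _ (by omega), outEntry])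
        hN ⟨by simp, by simp [j1], j2.update _ (by simp) (by simp)⟩
      exact ⟨N', t, k2, by simp, k3.update _ (by simp) (by simp)⟩)
    hM ⟨by simp, (SameOff.refl _ _ M).update _ (by simp) (by simp)⟩
  refine ⟨M', ?_⟩
  have h0 : Runs β Y (Prog.emit (Expr.var (-9))) M M
      [((2 * L * (2 * (4 * n * m)) ^ L : ℕ) : ℤ)] := Runs.emit (by
    rw [Expr.eval_cell', Expr.eval_const', hc.denom])
  exact Runs.seq (by omega) h0 fun _ => r

/-- The classical processing of the measured bits. -/
def postProg : Prog := paramProg ;; constProg ;; estProg ;; layersProg ;; printProg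

theorem postProg_runs {n a b : ℕ} (hb : ParamBounds n (repetitions n a b) (degParam n a) β Y)
    (hL : 1 ≤ degParam n a) (hY : logParam n b + 1 ≤ Y) (hℓ : logParam n b ≤ β)
    {M : Mem} (hM : MemBd β M) (h0 : M 0 = n) (h1 : M 1 = a) (h2 : M 2 = b)
    (hbit : ∀ x, 3 ≤ x → M x = 0 ∨ M x = 1) :
    ∃ M', Runs β Y postProg M M'
      (((2 * degParam n a * (2 * (4 * n * repetitions n a b)) ^ degParam n a : ℕ) : ℤ) ::
      (List.range (2 * n)).flatMap fun i => (List.range (2 * n)).flatMap fun j =>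
        [outEntry (layers (dilEst M n (repetitions n a b)) n (repetitions n a b) (degParam n a)) n
          (degParam n a) i j]) := by
  have hYβ := hb.hY
  have hm := hb.hm
  obtain ⟨M₁, r1, m1, f1⟩ := paramProg_runs hY hℓ (by omega) hM h0 h1 h2
  set m := repetitions n a b
  set L := degParam n a with hLdef
  have b1 := (r1 hM).1
  obtain ⟨M₂, r2, c2, f2⟩ := constProg_runs hLdef hb b1 (by rw [f1 0 (by norm_num), h0])
    (by rw [f1 1 (by norm_num), h1]) m1
  have b2 := (r2 b1).1
  have g2 : ∀ x, 0 ≤ x → M₂ x = M x := fun x hx => by rw [f2 x (by omega), f1 x hx]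
  obtain ⟨M₃, r3, c3, d3⟩ := estProg_runs hb b2
    (fun x hx => by rw [g2 x (by omega)]; exact hbit x hx) c2
  have b3 := (r3 b2).1
  have e3 : ∀ c, dilEst M₂ n m c = dilEst M n m c := fun c => by
    simp only [dilEst, corrEst, ordEst, rawEst_congr g2]
  obtain ⟨M₄, r4, c4, d4⟩ := layersProg_runs hb hL (S := dilEst M n m)
    (fun x hx => abs_dilEst_le hbit hx) b3 c3 (fun x hx => by rw [d3 x hx, e3])
  have b4 := (r4 b3).1
  obtain ⟨M₅, r5⟩ := printProg_runs hb b4 c4 d4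
  exact ⟨M₅, Runs.seq_nil_left (by omega) r1 fun _ => Runs.seq_nil_left (by omega) r2 fun _ =>
    Runs.seq_nil_left (by omega) r3 fun _ => Runs.seq_nil_left (by omega) r4 fun _ => r5⟩

end FreeFermion

/-! ### The Clifford algebra of the Majorana operators and Gaussian unitaries. -/

open FreeFermion
open scoped Matrix

namespace FreeFermion

variable {n : ℕ}

/-! ### Tensor products of single-qubit matrices -/

theorem tensor_apply (A : Fin n → Matrix (Fin 2) (Fin 2) ℂ) (x y : Basis n) :
    tensor A x y = ∏ j, A j (x j) (y j) := rfl

theorem tensor_mul (A B : Fin n → Matrix (Fin 2) (Fin 2) ℂ) :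
    tensor A * tensor B = tensor fun j => A j * B j := by
  ext x y
  simp only [Matrix.mul_apply, tensor_apply, Finset.prod_univ_sum, Fintype.piFinset_univ,
    Finset.prod_mul_distrib]

theorem tensor_one : tensor (fun _ : Fin n => (1 : Matrix (Fin 2) (Fin 2) ℂ)) = 1 := by
  ext x y
  rw [tensor_apply, Matrix.one_apply]
  split_ifs with h
  · subst h; simp
  · obtain ⟨j, hj⟩ := Function.ne_iff.1 h
    exact Finset.prod_eq_zero (Finset.mem_univ j) (Matrix.one_apply_ne hj)

theorem tensor_smul (c : Fin n → ℂ) (A : Fin n → Matrix (Fin 2) (Fin 2) ℂ) :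
    tensor (fun j => c j • A j) = (∏ j, c j) • tensor A := by
  ext x y
  simp [tensor_apply, Finset.prod_mul_distrib]

theorem tensor_conjTranspose (A : Fin n → Matrix (Fin 2) (Fin 2) ℂ) :
    (tensor A)ᴴ = tensor fun j => (A j)ᴴ := by
  ext x y
  simp [tensor_apply, Matrix.conjTranspose_apply]

theorem trace_tensor (A : Fin n → Matrix (Fin 2) (Fin 2) ℂ) :
    (tensor A).trace = ∏ j, (A j).trace := by
  simp only [Matrix.trace, Matrix.diag, tensor_apply, Finset.prod_univ_sum,
    Fintype.piFinset_univ]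

/-- Exactly one site contributes a sign. -/
theorem tensor_anticomm (A B : Fin n → Matrix (Fin 2) (Fin 2) ℂ) (j₀ : Fin n)
    (h₀ : A j₀ * B j₀ = -(B j₀ * A j₀)) (h : ∀ j, j ≠ j₀ → A j * B j = B j * A j) :
    tensor A * tensor B = -(tensor B * tensor A) := by
  have e : (fun j => A j * B j) = fun j => (if j = j₀ then (-1 : ℂ) else 1) • (B j * A j) := by
    funext j
    split_ifs with hj
    · subst hj; simp [h₀]
    · simp [h j hj]
  rw [tensor_mul, tensor_mul, e, tensor_smul]
  simp

/-! ### Majorana operators -/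

theorem pauliX_mul_self : pauliX * pauliX = 1 := by
  ext i j; fin_cases i <;> fin_cases j <;> simp [pauliX, Matrix.mul_apply]

theorem pauliY_mul_self : pauliY * pauliY = 1 := by
  ext i j; fin_cases i <;> fin_cases j <;> simp [pauliY, Matrix.mul_apply]

theorem pauliZ_mul_self : pauliZ * pauliZ = 1 := by
  ext i j; fin_cases i <;> fin_cases j <;> simp [pauliZ, Matrix.mul_apply]

theorem pauliX_mul_pauliY : pauliX * pauliY = Complex.I • pauliZ := by
  ext i j; fin_cases i <;> fin_cases j <;> simp [pauliX, pauliY, pauliZ, Matrix.mul_apply]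

theorem pauliY_mul_pauliX : pauliY * pauliX = -(Complex.I • pauliZ) := by
  ext i j; fin_cases i <;> fin_cases j <;> simp [pauliX, pauliY, pauliZ, Matrix.mul_apply]

theorem pauliX_mul_pauliZ : pauliX * pauliZ = -(pauliZ * pauliX) := by
  ext i j; fin_cases i <;> fin_cases j <;> simp [pauliX, pauliZ, Matrix.mul_apply]

theorem pauliY_mul_pauliZ : pauliY * pauliZ = -(pauliZ * pauliY) := by
  ext i j; fin_cases i <;> fin_cases j <;> simp [pauliY, pauliZ, Matrix.mul_apply]

theorem pauliX_conjTranspose : pauliXᴴ = pauliX := by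
  ext i j; fin_cases i <;> fin_cases j <;> simp [pauliX, Matrix.conjTranspose_apply]

theorem pauliY_conjTranspose : pauliYᴴ = pauliY := by
  ext i j; fin_cases i <;> fin_cases j <;> simp [pauliY, Matrix.conjTranspose_apply]

theorem pauliZ_conjTranspose : pauliZᴴ = pauliZ := by
  ext i j; fin_cases i <;> fin_cases j <;> simp [pauliZ, Matrix.conjTranspose_apply]

theorem majorana_conjTranspose (μ : Maj n) : (majorana μ)ᴴ = majorana μ := by
  unfold majorana
  rw [tensor_conjTranspose]
  congr 1
  funext j
  split_ifs <;>
    simp [pauliX_conjTranspose, pauliY_conjTranspose, pauliZ_conjTranspose]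

theorem majorana_mul_self (μ : Maj n) : majorana μ * majorana μ = 1 := by
  unfold majorana
  rw [tensor_mul, ← tensor_one]
  congr 1
  funext j
  split_ifs <;> simp [pauliX_mul_self, pauliY_mul_self, pauliZ_mul_self]

theorem majorana_anticomm_of_lt {μ ν : Maj n} (h : μ.1 < ν.1) :
    majorana μ * majorana ν = -(majorana ν * majorana μ) := by
  unfold majorana
  -- The sign comes from the site of the smaller mode, where X or Y meets the Z of the other string;
  -- at all other sites the factors commute.
  refine tensor_anticomm _ _ μ.1 ?_ fun j hj => ?_
  · simp only [lt_self_iff_false, if_false, if_true, h]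
    split_ifs
    · exact pauliX_mul_pauliZ
    · exact pauliY_mul_pauliZ
  · by_cases h1 : j < μ.1
    · simp [h1, h1.trans h]
    · simp [h1, hj]

theorem majorana_anticomm {μ ν : Maj n} (h : μ ≠ ν) :
    majorana μ * majorana ν = -(majorana ν * majorana μ) := by
  rcases lt_trichotomy μ.1 ν.1 with h1 | h1 | h1
  · exact majorana_anticomm_of_lt h1
  · obtain ⟨k, a⟩ := μ
    obtain ⟨l, b⟩ := ν
    obtain rfl : k = l := h1
    have hab : a ≠ b := fun hab => h (by rw [hab])
    unfold majorana
    refine tensor_anticomm _ _ k ?_ fun j hj => ?_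
    · simp only [lt_self_iff_false, if_false, if_true]
      fin_cases a <;> fin_cases b <;>
        simp_all [pauliX_mul_pauliY, pauliY_mul_pauliX]
    · by_cases h1 : j < k
      · simp [h1]
      · simp [h1, hj]
  · rw [majorana_anticomm_of_lt h1, neg_neg]

/-- The parity operator. -/
def parity (n : ℕ) : Op n := tensor fun _ => pauliZ

theorem parity_mul_self : parity n * parity n = 1 := by
  rw [parity, tensor_mul, ← tensor_one]
  simp only [pauliZ_mul_self]

theorem parity_conjTranspose : (parity n)ᴴ = parity n := by
  rw [parity, tensor_conjTranspose]
  simp only [pauliZ_conjTranspose]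

theorem majorana_mul_parity (μ : Maj n) : majorana μ * parity n = -(parity n * majorana μ) := by
  unfold majorana parity
  refine tensor_anticomm _ _ μ.1 ?_ fun j hj => ?_
  · simp only [lt_self_iff_false, if_false, if_true]
    split_ifs
    · exact pauliX_mul_pauliZ
    · exact pauliY_mul_pauliZ
  · by_cases h1 : j < μ.1
    · simp [h1]
    · simp [h1, hj]

/-! ### Linear combinations of Majorana operators -/

/-- The real vector space spanned by the labels of the Majorana operators. -/
abbrev MajSpace (n : ℕ) : Type := EuclideanSpace ℝ (Maj n)

/-- The real linear combination of Majorana operators with the coefficients `v`. -/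
def gam : MajSpace n →ₗ[ℝ] Op n where
  toFun v := ∑ μ, (v μ : ℂ) • majorana μ
  map_add' v w := by
    simp [add_smul, Finset.sum_add_distrib]
  map_smul' c v := by
    simp [Finset.smul_sum, mul_smul]

theorem gam_apply (v : MajSpace n) : gam v = ∑ μ, (v μ : ℂ) • majorana μ := rfl

theorem gam_single (μ : Maj n) : gam (EuclideanSpace.single μ (1 : ℝ)) = majorana μ := by
  rw [gam_apply, Finset.sum_eq_single μ]
  · simp
  · intro ν _ h; simp [h]
  · simp

theorem majorana_mul_add (μ ν : Maj n) :
    majorana μ * majorana ν + majorana ν * majorana μ = if μ = ν then (2 : ℂ) • 1 else 0 := by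
  split_ifs with h
  · subst h; rw [majorana_mul_self, two_smul]
  · rw [majorana_anticomm h, neg_add_cancel]

/-- The Clifford relation. It makes the description independent of the orthonormal basis: any
orthonormal system of vectors yields operators with the relations of the Majorana operators. -/
theorem gam_mul_add (v w : MajSpace n) :
    gam v * gam w + gam w * gam v = ((2 * inner ℝ v w : ℝ) : ℂ) • (1 : Op n) := by
  have e : gam v * gam w + gam w * gam v = ∑ μ, ∑ ν, ((v μ : ℂ) * (w ν : ℂ)) •
      (majorana μ * majorana ν + majorana ν * majorana μ) := by
    simp only [gam_apply, Finset.sum_mul_sum, smul_add, Finset.sum_add_distrib]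
    congr 1
    · simp only [Matrix.smul_mul, Matrix.mul_smul, smul_smul]
      simp only [mul_comm]
    · rw [Finset.sum_comm]
      simp only [Matrix.smul_mul, Matrix.mul_smul, smul_smul]
  rw [e]
  simp only [majorana_mul_add, smul_ite, smul_zero, Finset.sum_ite_eq, Finset.mem_univ, if_true,
    smul_smul, ← Finset.sum_smul]
  congr 1
  simp [PiLp.inner_apply, Finset.mul_sum]
  refine Finset.sum_congr rfl fun μ _ => ?_
  ring

theorem gam_mul_self (v : MajSpace n) : gam v * gam v = ((‖v‖ ^ 2 : ℝ) : ℂ) • (1 : Op n) := by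
  have h := gam_mul_add v v
  rw [real_inner_self_eq_norm_sq, ← two_smul ℂ, Complex.ofReal_mul, mul_smul] at h
  exact smul_right_injective _ (two_ne_zero (α := ℂ)) (by simpa using h)

theorem gam_anticomm {v w : MajSpace n} (h : inner ℝ v w = 0) :
    gam v * gam w = -(gam w * gam v) := by
  have := gam_mul_add v w
  rw [h, mul_zero, Complex.ofReal_zero, zero_smul] at this
  exact eq_neg_of_add_eq_zero_left this

theorem gam_conjTranspose (v : MajSpace n) : (gam v)ᴴ = gam v := by
  simp [gam_apply, Matrix.conjTranspose_sum, Matrix.conjTranspose_smul, majorana_conjTranspose]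

theorem gam_mul_parity (v : MajSpace n) : gam v * parity n = -(parity n * gam v) := by
  simp [gam_apply, Finset.sum_mul, Finset.mul_sum, majorana_mul_parity]

theorem gam_mem_unitary {v : MajSpace n} (h : ‖v‖ = 1) : gam v ∈ Matrix.unitaryGroup (Basis n) ℂ := by
  rw [Matrix.mem_unitaryGroup_iff, Matrix.star_eq_conjTranspose, gam_conjTranspose, gam_mul_self, h]
  simp

theorem parity_mem_unitary : parity n ∈ Matrix.unitaryGroup (Basis n) ℂ := by
  rw [Matrix.mem_unitaryGroup_iff, Matrix.star_eq_conjTranspose, parity_conjTranspose,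
    parity_mul_self]

/-! ### Free-fermionic unitaries -/

/-- Every orthogonal transformation of the Majorana operators is implemented by a unitary. -/
theorem exists_unitary_of_isometry (φ : MajSpace n ≃ₗᵢ[ℝ] MajSpace n) :
    ∃ U ∈ Matrix.unitaryGroup (Basis n) ℂ, ∀ v, Uᴴ * gam v * U = gam (φ v) := by
  -- Cartan-Dieudonné: it suffices to implement hyperplane reflections, products and inverses.
  have hφ : φ ∈ Subgroup.closure (Set.range fun v : MajSpace n => (ℝ ∙ v)ᗮ.reflection) := by
    rw [LinearIsometryEquiv.reflections_generate]; trivial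
  induction hφ using Subgroup.closure_induction with
  | mem φ h =>
    obtain ⟨v, rfl⟩ := h
    by_cases hv : v = 0
    · refine ⟨1, one_mem _, fun w => ?_⟩
      subst hv
      have : (⊤ : Submodule ℝ (MajSpace n)).reflection w = w :=
        Submodule.reflection_mem_subspace_eq_self Submodule.mem_top
      simp [this]
    · set u : MajSpace n := ‖v‖⁻¹ • v with hu
      have hu1 : ‖u‖ = 1 := by
        rw [hu, norm_smul, norm_inv, norm_norm, inv_mul_cancel₀ (norm_ne_zero_iff.2 hv)]
      have hspan : (ℝ ∙ v) = (ℝ ∙ u) := by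
        rw [hu, Submodule.span_singleton_smul_eq (IsUnit.mk0 _ (by simpa using hv))]
      -- Conjugation by `γ(u)` alone gives minus the reflection. The parity operator anticommutes
      -- with every `γ(w)` and corrects the sign.
      refine ⟨gam u * parity n, mul_mem (gam_mem_unitary hu1) parity_mem_unitary, fun w => ?_⟩
      simp only [hspan]
      rw [Submodule.reflection_orthogonal_apply, Submodule.reflection_singleton_apply, hu1,
        Matrix.conjTranspose_mul, gam_conjTranspose, parity_conjTranspose]
      have h1 : gam u * gam w * gam u = ((2 * inner ℝ u w : ℝ) : ℂ) • gam u - gam w := by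
        have e := gam_mul_add u w
        have e2 : gam u * gam w = ((2 * inner ℝ u w : ℝ) : ℂ) • (1 : Op n) - gam w * gam u :=
          eq_sub_of_add_eq e
        rw [e2, sub_mul, mul_assoc, gam_mul_self, hu1]
        simp
      calc parity n * gam u * gam w * (gam u * parity n)
          = parity n * (gam u * gam w * gam u * parity n) := by simp only [mul_assoc]
        _ = -(gam u * gam w * gam u) := by
          rw [h1, sub_mul, Matrix.smul_mul, gam_mul_parity, gam_mul_parity, mul_sub,
            Matrix.mul_smul, mul_neg, mul_neg, ← mul_assoc, ← mul_assoc, parity_mul_self]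
          simp
          abel
        _ = _ := by
          rw [h1]
          simp [map_sub, map_smul, mul_smul]
          rw [two_smul, two_mul, smul_add]
  | one => exact ⟨1, one_mem _, fun w => by simp⟩
  | mul φ ψ _ _ ihφ ihψ =>
    obtain ⟨U, hU, eU⟩ := ihφ
    obtain ⟨V, hV, eV⟩ := ihψ
    refine ⟨V * U, mul_mem hV hU, fun w => ?_⟩
    rw [Matrix.conjTranspose_mul, LinearIsometryEquiv.coe_mul, Function.comp, ← eU, ← eV]
    simp only [mul_assoc]
  | inv φ _ ih =>
    obtain ⟨U, hU, eU⟩ := ih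
    have h1 : U * Uᴴ = 1 := Matrix.mem_unitaryGroup_iff.1 hU
    refine ⟨Uᴴ, Unitary.star_mem hU, fun w => ?_⟩
    have := eU (φ⁻¹ w)
    rw [show φ (φ⁻¹ w) = w from φ.apply_symm_apply w] at this
    rw [← this, Matrix.conjTranspose_conjTranspose]
    calc U * (Uᴴ * gam (φ⁻¹ w) * U) * Uᴴ = (U * Uᴴ) * gam (φ⁻¹ w) * (U * Uᴴ) := by
          simp only [mul_assoc]
      _ = _ := by rw [h1]; simp

end FreeFermion

/-! ### Normal modes, correlation matrices and antisymmetric contractions. -/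

open FreeFermion
open scoped Matrix

namespace FreeFermion

variable {n : ℕ}

/-! ### Free-fermionic states in terms of orthonormal bases -/

/-- The product state with the `Z` expectations `lam`. -/
noncomputable def diagState (lam : Fin n → ℝ) : Op n :=
  tensor fun j => (1 / 2 : ℂ) • (1 + (lam j : ℂ) • pauliZ)

/-- `ρ` is the free-fermionic state with the normal modes `b` and the expectations `lam`. -/
structure GaussianForm (b : OrthonormalBasis (Maj n) ℝ (MajSpace n)) (lam : Fin n → ℝ)
    (U ρ : Op n) : Prop where
  unitary : U ∈ Matrix.unitaryGroup (Basis n) ℂ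
  conj : ∀ μ, U * majorana μ * Uᴴ = gam (b μ)
  bound : ∀ j, |lam j| ≤ 1
  eq : ρ = U * diagState lam * Uᴴ

theorem IsFreeFermionic.exists_gaussianForm {ρ : Op n} (h : IsFreeFermionic ρ) :
    ∃ b lam U, GaussianForm b lam U ρ := by
  obtain ⟨Q, U, lam, ⟨hQ, hU, hconj⟩, hlam, rfl⟩ := h
  have hQ' : Qᵀ * Q = 1 := (Matrix.mem_orthogonalGroup_iff' _ _).1 hQ
  -- The columns of `Q` are the normal modes: conjugation by `U` in the opposite direction acts by
  -- the transpose of `Q`.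
  have hon : Orthonormal ℝ fun ν : Maj n => (WithLp.toLp 2 fun μ => Q μ ν : MajSpace n) := by
    rw [orthonormal_iff_ite]
    intro ν κ
    have := congrFun (congrFun hQ' ν) κ
    simp only [Matrix.mul_apply, Matrix.transpose_apply, Matrix.one_apply] at this
    rw [← this]
    simp [PiLp.inner_apply, mul_comm]
  obtain ⟨b, hb⟩ := Orthonormal.exists_orthonormalBasis_extension_of_card_eq (𝕜 := ℝ)
    (E := MajSpace n) (ι := Maj n) (by simp) (v := fun ν : Maj n => (WithLp.toLp 2 fun μ => Q μ ν : MajSpace n))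
    (s := Set.univ)
    (hon.comp (fun x : ↥(Set.univ : Set (Maj n)) => x.1) Subtype.val_injective)
  have hUU : U * Uᴴ = 1 := Matrix.mem_unitaryGroup_iff.1 hU
  refine ⟨b, lam, U, hU, fun ν => ?_, hlam, rfl⟩
  have h1 : Uᴴ * gam (b ν) * U = majorana ν := by
    rw [hb ν trivial, gam_apply]
    simp only [Finset.mul_sum, Finset.sum_mul, Matrix.mul_smul, Matrix.smul_mul, hconj,
      Finset.smul_sum, smul_smul]
    rw [Finset.sum_comm]
    simp only [← Finset.sum_smul, ← Complex.ofReal_mul, ← Complex.ofReal_sum]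
    have : ∀ κ, ∑ μ, Q μ ν * Q μ κ = if ν = κ then 1 else 0 := fun κ => by
      have := congrFun (congrFun hQ' ν) κ
      simpa only [Matrix.mul_apply, Matrix.transpose_apply, Matrix.one_apply] using this
    simp only [this]
    simp
  rw [← h1]
  calc U * (Uᴴ * gam (b ν) * U) * Uᴴ = (U * Uᴴ) * gam (b ν) * (U * Uᴴ) := by
        simp only [mul_assoc]
    _ = _ := by rw [hUU]; simp

/-- The isometry sending `b` to the standard basis is implemented by a unitary, and its matrix is
the required `Q`. -/
theorem exists_gaussianForm (b : OrthonormalBasis (Maj n) ℝ (MajSpace n)) {lam : Fin n → ℝ}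
    (hlam : ∀ j, |lam j| ≤ 1) : ∃ U ρ, GaussianForm b lam U ρ ∧ IsFreeFermionic ρ := by
  obtain ⟨U, hU, hconj⟩ := exists_unitary_of_isometry b.repr
  have hUU : U * Uᴴ = 1 := Matrix.mem_unitaryGroup_iff.1 hU
  refine ⟨U, U * diagState lam * Uᴴ, ⟨hU, fun μ => ?_, hlam, rfl⟩,
    Matrix.of fun μ ν => b.repr (EuclideanSpace.single μ 1) ν, U, lam, ⟨?_, hU, fun μ => ?_⟩,
    hlam, rfl⟩
  · rw [← gam_single μ, ← b.repr_self μ, ← hconj]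
    calc U * (Uᴴ * gam (b μ) * U) * Uᴴ = (U * Uᴴ) * gam (b μ) * (U * Uᴴ) := by
          simp only [mul_assoc]
      _ = _ := by rw [hUU]; simp
  · refine (Matrix.mem_orthogonalGroup_iff _ _).2 ?_
    ext μ ν
    have := b.repr.inner_map_map (EuclideanSpace.single ν (1 : ℝ)) (EuclideanSpace.single μ 1)
    rw [PiLp.inner_apply] at this
    simp only [Matrix.mul_apply, Matrix.of_apply, Matrix.transpose_apply, Matrix.one_apply]
    simp only [RCLike.inner_apply, conj_trivial] at this
    rw [this]
    simp [EuclideanSpace.inner_single_left, eq_comm]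
  · rw [← gam_single μ, hconj, gam_apply]
    rfl

/-! ### Correlation matrices -/

theorem correlationMatrix_apply_of_ne (ρ : Op n) {μ ν : Maj n} (h : μ ≠ ν) :
    correlationMatrix ρ μ ν = -Complex.I * (majorana μ * majorana ν * ρ).trace := by
  have e : majorana μ * majorana ν - majorana ν * majorana μ =
      (2 : ℂ) • (majorana μ * majorana ν) := by
    rw [majorana_anticomm h.symm, two_smul, sub_neg_eq_add]
  simp only [correlationMatrix, Matrix.of_apply, e, Matrix.smul_mul, Matrix.trace_smul]
  simp; ring

theorem correlationMatrix_self (ρ : Op n) (μ : Maj n) : correlationMatrix ρ μ μ = 0 := by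
  simp [correlationMatrix]

theorem correlationMatrix_antisymm (ρ : Op n) (μ ν : Maj n) :
    correlationMatrix ρ μ ν = -correlationMatrix ρ ν μ := by
  simp only [correlationMatrix, Matrix.of_apply]
  rw [sub_mul, sub_mul, Matrix.trace_sub, Matrix.trace_sub]
  ring

theorem trace_half_one_add_pauliZ (l : ℂ) : ((1 / 2 : ℂ) • (1 + l • pauliZ)).trace = 1 := by
  simp [Matrix.trace, pauliZ]; ring

/-- At the site of the larger mode the factor is X or Y times a diagonal matrix, which has trace
zero. -/
theorem correlationMatrix_diagState_of_lt (lam : Fin n → ℝ) {μ ν : Maj n} (h : μ.1 < ν.1) :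
    correlationMatrix (diagState lam) μ ν = 0 := by
  rw [correlationMatrix_apply_of_ne _ (fun e => by simp [e] at h)]
  unfold majorana diagState
  rw [tensor_mul, tensor_mul, trace_tensor, Finset.prod_eq_zero (Finset.mem_univ ν.1), mul_zero]
  simp only [lt_self_iff_false, if_false, if_true, not_lt.2 h.le, h.ne']
  split_ifs <;> simp [Matrix.trace, pauliX, pauliY, pauliZ, Matrix.one_fin_two]

theorem correlationMatrix_diagState_pair (lam : Fin n → ℝ) (k : Fin n) :
    correlationMatrix (diagState lam) (k, 0) (k, 1) = lam k := by
  rw [correlationMatrix_apply_of_ne _ (by simp)]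
  unfold majorana diagState
  rw [tensor_mul, tensor_mul, trace_tensor, Finset.prod_eq_single k]
  · simp [Matrix.trace, pauliX, pauliY, pauliZ, Matrix.one_fin_two]
    ring_nf
    simp
  · intro j _ hj
    have key := trace_half_one_add_pauliZ (lam j)
    by_cases h : j < k
    · simp only [h, if_true, pauliZ_mul_self, one_mul, key]
    · simp only [h, hj, if_false, one_mul, key]
  · simp

/-- The antisymmetric matrix with the normal modes `b` and the values `lam`. -/
noncomputable def skewForm (b : OrthonormalBasis (Maj n) ℝ (MajSpace n)) (lam : Fin n → ℝ) :
    Matrix (Maj n) (Maj n) ℝ :=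
  Matrix.of fun μ ν => ∑ j, lam j * (b (j, 0) μ * b (j, 1) ν - b (j, 1) μ * b (j, 0) ν)

theorem majorana_eq_sum_gam (b : OrthonormalBasis (Maj n) ℝ (MajSpace n)) (μ : Maj n) :
    majorana μ = ∑ κ, (b κ μ : ℂ) • gam (b κ) := by
  rw [← gam_single μ, ← b.sum_repr' (EuclideanSpace.single μ (1 : ℝ)), map_sum]
  refine Finset.sum_congr rfl fun κ _ => ?_
  rw [map_smul, EuclideanSpace.inner_single_right]
  simp

/-- Expanding the Majorana operators in the normal modes reduces to the product state, where only
the two operators of one mode are correlated. -/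
theorem GaussianForm.correlationMatrix_eq {b : OrthonormalBasis (Maj n) ℝ (MajSpace n)}
    {lam : Fin n → ℝ} {U ρ : Op n} (h : GaussianForm b lam U ρ) (μ ν : Maj n) :
    correlationMatrix ρ μ ν = (skewForm b lam μ ν : ℂ) := by
  have hUU : Uᴴ * U = 1 := Matrix.mem_unitaryGroup_iff'.1 h.unitary
  have tr : ∀ κ ι, (gam (b κ) * gam (b ι) * ρ).trace =
      (majorana κ * majorana ι * diagState lam).trace := fun κ ι => by
    rw [← h.conj, ← h.conj, h.eq]
    calc _ = (U * (majorana κ * (Uᴴ * U) * majorana ι * (Uᴴ * U) * diagState lam * Uᴴ)).trace := by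
          simp only [mul_assoc]
      _ = _ := by
        rw [hUU, Matrix.trace_mul_comm]
        simp only [mul_one]
        rw [mul_assoc, hUU, mul_one]
  have e1 : correlationMatrix ρ μ ν =
      ∑ κ, ∑ ι, ((b κ μ : ℂ) * (b ι ν : ℂ)) * correlationMatrix (diagState lam) κ ι := by
    simp only [correlationMatrix, Matrix.of_apply, sub_mul, Matrix.trace_sub, ← tr]
    rw [majorana_eq_sum_gam b μ, majorana_eq_sum_gam b ν]
    simp only [Finset.sum_mul, Finset.mul_sum, Matrix.smul_mul, Matrix.mul_smul,
      Matrix.trace_sum, Matrix.trace_smul, smul_eq_mul, mul_sub, Finset.sum_sub_distrib]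
    congr 1
    · rw [Finset.sum_comm]
      refine Finset.sum_congr rfl fun κ _ => Finset.sum_congr rfl fun ι _ => by ring
    · refine Finset.sum_congr rfl fun κ _ => Finset.sum_congr rfl fun ι _ => by ring
  have e2 : ∀ k l : Fin n, k ≠ l → ∀ c d, correlationMatrix (diagState lam) (k, c) (l, d) = 0 := by
    intro k l hkl c d
    rcases lt_or_gt_of_ne hkl with h | h
    · exact correlationMatrix_diagState_of_lt lam h
    · rw [correlationMatrix_antisymm, correlationMatrix_diagState_of_lt lam h, neg_zero]
  rw [e1, skewForm, Matrix.of_apply, Complex.ofReal_sum, Fintype.sum_prod_type]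
  refine Finset.sum_congr rfl fun k _ => ?_
  simp only [Fintype.sum_prod_type, Fin.sum_univ_two]
  rw [← Finset.sum_add_distrib, Finset.sum_eq_single k]
  · rw [correlationMatrix_self, correlationMatrix_self, correlationMatrix_diagState_pair,
      correlationMatrix_antisymm _ (k, 1), correlationMatrix_diagState_pair]
    push_cast
    ring
  · intro l _ hl
    simp [e2 k l hl.symm]
  · simp

/-! ### Normal form of antisymmetric matrices -/

/-- By induction on the number of planes: `T ∘ T` is symmetric, an eigenvector `u` of it that `T`
does not kill spans with `T u` an invariant plane, and antisymmetry makes the orthogonal complement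
invariant. -/
theorem exists_skew_normal_form (m : ℕ) : ∀ (E : Type) [NormedAddCommGroup E]
    [InnerProductSpace ℝ E] [FiniteDimensional ℝ E] (T : E →ₗ[ℝ] E),
    Module.finrank ℝ E = m * 2 → (∀ x y, inner ℝ (T x) y = -inner ℝ x (T y)) →
    ∃ (b : OrthonormalBasis (Fin m × Fin 2) ℝ E) (lam : Fin m → ℝ), ∀ j,
      T (b (j, 1)) = lam j • b (j, 0) ∧ T (b (j, 0)) = -(lam j • b (j, 1)) := by
  induction m with
  | zero =>
    intro E _ _ _ T hE hT
    obtain ⟨b⟩ : Nonempty (OrthonormalBasis (Fin 0 × Fin 2) ℝ E) :=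
      ⟨(stdOrthonormalBasis ℝ E).reindex (Fintype.equivOfCardEq (by simp [hE]))⟩
    exact ⟨b, fun _ => 0, fun j => j.elim0⟩
  | succ m ih =>
    intro E _ _ _ T hE hT
    by_cases hT0 : T = 0
    · obtain ⟨b⟩ : Nonempty (OrthonormalBasis (Fin (m + 1) × Fin 2) ℝ E) :=
        ⟨(stdOrthonormalBasis ℝ E).reindex (Fintype.equivOfCardEq (by simp [hE]))⟩
      exact ⟨b, fun _ => 0, fun j => by simp [hT0]⟩
    have hsym : (T ∘ₗ T).IsSymmetric := fun x y => by
      simp only [LinearMap.comp_apply]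
      rw [hT, hT, neg_neg]
    have hself : ∀ x, inner ℝ (T x) x = 0 := fun x => by
      have := hT x x
      rw [real_inner_comm x (T x)] at this
      rw [real_inner_comm]
      linarith
    -- If `T` killed every unit eigenvector of `T ∘ T`, it would vanish on an eigenbasis.
    obtain ⟨u, hu, μ, hμ, hTu⟩ : ∃ u : E, ‖u‖ = 1 ∧ ∃ μ : ℝ, T (T u) = μ • u ∧ T u ≠ 0 := by
      set e := hsym.eigenvectorBasis rfl
      by_contra hcon
      push Not at hcon
      refine hT0 (e.toBasis.ext fun i => ?_)
      have := hcon (e i) (e.orthonormal.1 i) (hsym.eigenvalues rfl i)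
        (hsym.apply_eigenvectorBasis rfl i)
      simpa using this
    set l := ‖T u‖ with hl
    have hl0 : l ≠ 0 := norm_ne_zero_iff.2 hTu
    have hμl : μ = -l ^ 2 := by
      have h1 : inner ℝ (T (T u)) u = -inner ℝ (T u) (T u) := hT _ _
      rw [hμ, inner_smul_left, real_inner_self_eq_norm_sq, real_inner_self_eq_norm_sq, hu] at h1
      simpa using h1
    set v : E := -(l⁻¹ • T u) with hv
    have hv1 : ‖v‖ = 1 := by
      rw [hv, norm_neg, norm_smul, norm_inv, norm_norm, ← hl, inv_mul_cancel₀ hl0]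
    have huv : inner ℝ u v = 0 := by
      rw [hv, inner_neg_right, inner_smul_right, real_inner_comm, hself, mul_zero, neg_zero]
    have hTu' : T u = -(l • v) := by
      rw [hv, smul_neg, neg_neg, smul_smul, mul_inv_cancel₀ hl0, one_smul]
    have hTv : T v = l • u := by
      rw [hv, map_neg, map_smul, hμ, hμl, smul_smul, ← neg_smul]
      congr 1
      field_simp
    set F : Submodule ℝ E := Submodule.span ℝ {u, v} with hF
    have hfam : Orthonormal ℝ ![u, v] := by
      rw [orthonormal_iff_ite]
      intro i j
      fin_cases i <;> fin_cases j <;> simp [hu, hv1, huv, real_inner_comm u v]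
    have hFrank : Module.finrank ℝ F = 2 := by
      have h2 := finrank_span_eq_card hfam.linearIndependent
      have h3 : Set.range ![u, v] = {u, v} := by
        ext x; simp [eq_comm, or_comm]
      rwa [h3, Fintype.card_fin] at h2
    have hmem : ∀ x, x ∈ Fᗮ ↔ inner ℝ u x = 0 ∧ inner ℝ v x = 0 := fun x => by
      rw [Submodule.mem_orthogonal]
      constructor
      · intro h
        exact ⟨h u (Submodule.subset_span (by simp)), h v (Submodule.subset_span (by simp))⟩
      · rintro ⟨h1, h2⟩ y hy
        obtain ⟨a, c, rfl⟩ := Submodule.mem_span_pair.1 hy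
        simp [inner_add_left, inner_smul_left, h1, h2]
    have hinv : ∀ x ∈ Fᗮ, T x ∈ Fᗮ := fun x hx => by
      rw [hmem] at hx ⊢
      have h1 := hT u x
      have h2 := hT v x
      rw [hTu', inner_neg_left, inner_smul_left, hx.2] at h1
      rw [hTv, inner_smul_left, hx.1] at h2
      simp at h1 h2
      exact ⟨by linarith, by linarith⟩
    have hrank : Module.finrank ℝ Fᗮ = m * 2 := by
      have := Submodule.finrank_add_finrank_orthogonal F
      omega
    obtain ⟨b, lam, hb⟩ := ih Fᗮ (T.restrict hinv) hrank fun x y => hT x y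
    have hbmem : ∀ i, inner ℝ u (b i : E) = 0 ∧ inner ℝ v (b i : E) = 0 := fun i =>
      (hmem _).1 (b i).2
    have hbon : ∀ i j, inner ℝ (b i : E) (b j : E) = if i = j then (1 : ℝ) else 0 := fun i j =>
      orthonormal_iff_ite.1 b.orthonormal i j
    -- The new plane takes the index `0`, the planes of the complement are shifted by one.
    set f : Fin (m + 1) × Fin 2 → E := fun p =>
      Fin.cases (![u, v] p.2) (fun j => (b (j, p.2) : E)) p.1 with hf
    have hfon : Orthonormal ℝ f := by
      rw [orthonormal_iff_ite]
      rintro ⟨i, a⟩ ⟨j, c⟩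
      have h0 := orthonormal_iff_ite.1 hfam a c
      refine Fin.cases ?_ (fun i => ?_) i <;> refine Fin.cases ?_ (fun j => ?_) j
      · simpa [hf] using h0
      · have := hbmem (j, c)
        fin_cases a <;> simp [hf, this, (Fin.succ_ne_zero j).symm]
      · have := hbmem (i, a)
        fin_cases c <;> simp [hf, real_inner_comm, this]
      · simp [hf, hbon]
    obtain ⟨B, hB⟩ := Orthonormal.exists_orthonormalBasis_extension_of_card_eq (𝕜 := ℝ)
      (E := E) (ι := Fin (m + 1) × Fin 2) (by simp [hE]) (v := f) (s := Set.univ)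
      (hfon.comp (fun x : ↥(Set.univ : Set (Fin (m + 1) × Fin 2)) => x.1)
        Subtype.val_injective)
    refine ⟨B, Fin.cases l lam, fun j => ?_⟩
    rw [hB _ trivial, hB _ trivial]
    refine Fin.cases ?_ (fun j => ?_) j
    · simp [hf, hTu', hTv]
    · have := hb j
      exact ⟨by simpa [hf] using congrArg Subtype.val this.1,
        by simpa [hf] using congrArg Subtype.val this.2⟩

theorem inner_eq_sum (x y : MajSpace n) : inner ℝ x y = ∑ μ, x μ * y μ := by
  simp [PiLp.inner_apply, mul_comm]

theorem exists_eq_skewForm (A : Matrix (Maj n) (Maj n) ℝ) (hA : ∀ μ ν, A μ ν = -A ν μ) :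
    ∃ b lam, A = skewForm b lam := by
  have hT : ∀ x y : MajSpace n, inner ℝ (Matrix.toEuclideanLin A x) y =
      -inner ℝ x (Matrix.toEuclideanLin A y) := fun x y => by
    simp only [inner_eq_sum, Matrix.toLpLin_apply, Matrix.mulVec, dotProduct,
      Finset.sum_mul, Finset.mul_sum]
    rw [Finset.sum_comm, ← Finset.sum_neg_distrib]
    refine Finset.sum_congr rfl fun ν _ => ?_
    rw [← Finset.sum_neg_distrib]
    refine Finset.sum_congr rfl fun μ _ => ?_
    rw [hA]; ring
  obtain ⟨b, lam, hb⟩ := exists_skew_normal_form n (MajSpace n) (Matrix.toEuclideanLin A)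
    (by simp) hT
  refine ⟨b, lam, ?_⟩
  ext μ ν
  have e1 : A μ ν = Matrix.toEuclideanLin A (EuclideanSpace.single ν 1) μ := by
    simp [Matrix.toLpLin_apply]
  rw [e1, ← b.sum_repr' (EuclideanSpace.single ν (1 : ℝ)), map_sum, skewForm, Matrix.of_apply]
  simp only [map_smul, EuclideanSpace.inner_single_right, Fintype.sum_prod_type,
    Fin.sum_univ_two, (hb _).1, (hb _).2]
  simp only [WithLp.ofLp_sum, Finset.sum_apply, PiLp.add_apply, PiLp.smul_apply, PiLp.neg_apply,
    smul_eq_mul]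
  refine Finset.sum_congr rfl fun j _ => ?_
  simp
  ring

theorem skewForm_mulVec_inner (b : OrthonormalBasis (Maj n) ℝ (MajSpace n)) (lam : Fin n → ℝ)
    (x : MajSpace n) : Matrix.toEuclideanLin (skewForm b lam) x =
      ∑ j, (lam j • (inner ℝ (b (j, 1)) x • b (j, 0) - inner ℝ (b (j, 0)) x • b (j, 1))) := by
  ext μ
  simp only [Matrix.toLpLin_apply, Matrix.mulVec, dotProduct, skewForm, Matrix.of_apply,
    WithLp.ofLp_sum, Finset.sum_apply, inner_eq_sum, PiLp.smul_apply, PiLp.sub_apply,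
    smul_eq_mul, Finset.sum_mul, mul_sub, Finset.mul_sum, sub_mul, Finset.sum_sub_distrib]
  congr 1
  · rw [Finset.sum_comm]
    exact Finset.sum_congr rfl fun j _ => Finset.sum_congr rfl fun ν _ => by ring
  · rw [Finset.sum_comm]
    exact Finset.sum_congr rfl fun j _ => Finset.sum_congr rfl fun ν _ => by ring

theorem skewForm_apply_basis_one (b : OrthonormalBasis (Maj n) ℝ (MajSpace n)) (lam : Fin n → ℝ)
    (k : Fin n) : Matrix.toEuclideanLin (skewForm b lam) (b (k, 1)) = lam k • b (k, 0) := by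
  rw [skewForm_mulVec_inner, Finset.sum_eq_single k]
  · simp [orthonormal_iff_ite.1 b.orthonormal]
  · intro j _ hj
    simp [orthonormal_iff_ite.1 b.orthonormal, hj]
  · simp

/-- On the plane of mode `k` the operator is a quarter turn scaled by `lam k`. -/
theorem norm_skewForm_le (b : OrthonormalBasis (Maj n) ℝ (MajSpace n)) {lam : Fin n → ℝ}
    (hlam : ∀ j, |lam j| ≤ 1) (x : MajSpace n) :
    ‖Matrix.toEuclideanLin (skewForm b lam) x‖ ≤ ‖x‖ := by
  have h0 : ∀ k, inner ℝ (b (k, 0)) (Matrix.toEuclideanLin (skewForm b lam) x) =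
      lam k * inner ℝ (b (k, 1)) x := fun k => by
    rw [skewForm_mulVec_inner, inner_sum, Finset.sum_eq_single k]
    · simp [inner_smul_right, inner_sub_right, orthonormal_iff_ite.1 b.orthonormal]
    · intro j _ hj
      simp [inner_smul_right, inner_sub_right, orthonormal_iff_ite.1 b.orthonormal, hj.symm]
    · simp
  have h1 : ∀ k, inner ℝ (b (k, 1)) (Matrix.toEuclideanLin (skewForm b lam) x) =
      -(lam k * inner ℝ (b (k, 0)) x) := fun k => by
    rw [skewForm_mulVec_inner, inner_sum, Finset.sum_eq_single k]
    · simp [inner_smul_right, inner_sub_right, orthonormal_iff_ite.1 b.orthonormal]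
    · intro j _ hj
      simp [inner_smul_right, inner_sub_right, orthonormal_iff_ite.1 b.orthonormal, hj.symm]
    · simp
  refine le_of_sq_le_sq ?_ (norm_nonneg _)
  rw [← b.sum_sq_norm_inner_right, ← b.sum_sq_norm_inner_right x]
  simp only [Fintype.sum_prod_type, Fin.sum_univ_two, h0, h1, norm_neg]
  refine Finset.sum_le_sum fun k _ => ?_
  rw [norm_mul, norm_mul, add_comm]
  have hk : ‖lam k‖ ≤ 1 := hlam k
  gcongr <;> exact mul_le_of_le_one_left (norm_nonneg _) hk

theorem skewForm_antisymm (b : OrthonormalBasis (Maj n) ℝ (MajSpace n)) (lam : Fin n → ℝ)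
    (μ ν : Maj n) : skewForm b lam μ ν = -skewForm b lam ν μ := by
  simp only [skewForm, Matrix.of_apply]
  rw [← Finset.sum_neg_distrib]
  exact Finset.sum_congr rfl fun j _ => by ring

/-- Every antisymmetric contraction is the correlation matrix of a free-fermionic state. -/
theorem exists_gaussianForm_of_contraction (A : Matrix (Maj n) (Maj n) ℝ)
    (hA : ∀ μ ν, A μ ν = -A ν μ) (hA1 : ∀ x : MajSpace n, ‖Matrix.toEuclideanLin A x‖ ≤ ‖x‖) :
    ∃ b lam U σ, GaussianForm b lam U σ ∧ IsFreeFermionic σ ∧ A = skewForm b lam := by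
  obtain ⟨b, lam, rfl⟩ := exists_eq_skewForm A hA
  have hlam : ∀ j, |lam j| ≤ 1 := fun j => by
    have := hA1 (b (j, 1))
    rw [skewForm_apply_basis_one, norm_smul, b.orthonormal.1, b.orthonormal.1, mul_one] at this
    exact this
  obtain ⟨U, ρ, h, hρ⟩ := exists_gaussianForm b hlam
  exact ⟨b, lam, U, ρ, h, hρ, rfl⟩

end FreeFermion

/-! ### The exponential form of free-fermionic states and their trace distance. -/

open FreeFermion
open scoped Matrix

namespace FreeFermion

variable {n : ℕ}

/-! ### Exponentials of commuting nilpotent elements -/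

section Exp

variable {R : Type*} [NormedRing R] [NormedAlgebra ℂ R]

/-- The exponential series stops after the linear term. -/
theorem exp_eq_one_add_of_mul_self_eq_zero {a : R} (h : a * a = 0) :
    NormedSpace.exp a = 1 + a := by
  rw [congrFun (NormedSpace.exp_eq_tsum ℂ) a, tsum_eq_sum (s := Finset.range 2)]
  · simp [Finset.sum_range_succ]
  · intro k hk
    have hk2 : 2 ≤ k := not_lt.1 fun h => hk (Finset.mem_range.2 h)
    obtain ⟨j, rfl⟩ := Nat.exists_eq_add_of_le hk2
    rw [pow_add, pow_two, h, zero_mul, smul_zero]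

theorem exp_add_of_commute' [CompleteSpace R] {a b : R} (h : Commute a b) :
    NormedSpace.exp (a + b) = NormedSpace.exp a * NormedSpace.exp b := by
  let _ : NormedAlgebra ℚ R := NormedAlgebra.restrictScalars ℚ ℂ R
  exact NormedSpace.exp_add_of_commute h

end Exp

/-! ### Fermionic superoperators -/

section Superoperators

/-- Linear maps on operators. -/
abbrev SuperOp (n : ℕ) : Type := Module.End ℂ (Op n)

section Norm

attribute [local instance] Matrix.linftyOpNormedRing Matrix.linftyOpNormedAlgebra

/-- A submultiplicative norm on superoperators. -/
@[reducible] noncomputable def superOpNormedRing : NormedRing (SuperOp n) :=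
  NormedRing.induced _ _ (LinearMap.toMatrixAlgEquiv (Matrix.stdBasis ℂ (Basis n) (Basis n)))
    (AlgEquiv.injective _)

/-- Superoperators form a normed algebra. -/
@[reducible] noncomputable def superOpNormedAlgebra :
    letI := superOpNormedRing (n := n)
    NormedAlgebra ℂ (SuperOp n) :=
  letI := superOpNormedRing (n := n)
  NormedAlgebra.induced ℂ _ _
    (LinearMap.toMatrixAlgEquiv (Matrix.stdBasis ℂ (Basis n) (Basis n)))

end Norm

attribute [local instance] superOpNormedRing superOpNormedAlgebra

instance : CompleteSpace (SuperOp n) := FiniteDimensional.complete ℂ _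

/-- `A ↦ (γ(v) A + P A P γ(v)) / 2`. -/
noncomputable def theta (v : MajSpace n) : SuperOp n where
  toFun A := (1 / 2 : ℂ) • (gam v * A + parity n * A * parity n * gam v)
  map_add' A B := by simp only [mul_add, add_mul, smul_add]; abel
  map_smul' c A := by
    simp only [Matrix.mul_smul, Matrix.smul_mul, ← smul_add, RingHom.id_apply]
    rw [smul_comm]

theorem theta_apply (v : MajSpace n) (A : Op n) :
    theta v A = (1 / 2 : ℂ) • (gam v * A + parity n * A * parity n * gam v) := rfl

theorem parity_mul_gam (v : MajSpace n) : parity n * gam v = -(gam v * parity n) := by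
  rw [gam_mul_parity, neg_neg]

theorem theta_mul_apply (v w : MajSpace n) (A : Op n) :
    (theta v * theta w) A = (1 / 4 : ℂ) • (gam v * gam w * A - A * (gam w * gam v) +
      gam v * (parity n * A * parity n) * gam w - gam w * (parity n * A * parity n) * gam v) := by
  have h1 : parity n * (parity n * A * parity n * gam w) * parity n * gam v =
      -(A * (gam w * gam v)) := by
    calc _ = (parity n * parity n) * A * (parity n * gam w) * parity n * gam v := by
          simp only [mul_assoc]
      _ = _ := by
        rw [parity_mul_self, parity_mul_gam, one_mul, mul_neg, neg_mul, neg_mul]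
        rw [mul_assoc A, mul_assoc (gam w), parity_mul_self, mul_one, mul_assoc]
  have h2 : parity n * (gam w * A) * parity n * gam v =
      -(gam w * (parity n * A * parity n) * gam v) := by
    rw [← mul_assoc, parity_mul_gam]
    simp only [neg_mul, mul_assoc]
  rw [Module.End.mul_apply, theta_apply, theta_apply]
  simp only [Matrix.mul_smul, Matrix.smul_mul, ← smul_add, smul_smul, mul_add, add_mul, h1, h2]
  norm_num
  simp only [mul_assoc, ← smul_add, ← smul_neg]
  congr 1
  abel

/-- Conjugation by the parity is the grading of the Clifford algebra, so `theta v` is exterior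
multiplication by `v` under the identification of Clifford and exterior algebra. Hence these maps
anticommute without any orthogonality assumption. -/
theorem theta_anticomm (v w : MajSpace n) : theta v * theta w = -(theta w * theta v) := by
  rw [eq_neg_iff_add_eq_zero]
  refine LinearMap.ext fun A => ?_
  rw [LinearMap.add_apply, theta_mul_apply, theta_mul_apply, ← smul_add]
  have h := gam_mul_add v w
  have h1 : gam v * gam w = ((2 * inner ℝ v w : ℝ) : ℂ) • (1 : Op n) - gam w * gam v :=
    eq_sub_of_add_eq h
  rw [h1]
  simp only [sub_mul, mul_sub, Matrix.smul_mul, Matrix.mul_smul, one_mul, mul_one]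
  rw [LinearMap.zero_apply]
  convert smul_zero _
  abel

theorem theta_mul_self (v : MajSpace n) : theta v * theta v = 0 := by
  have h := theta_anticomm v v
  rw [eq_neg_iff_add_eq_zero, ← two_smul ℂ] at h
  exact (smul_eq_zero.1 h).resolve_left two_ne_zero

/-- Even elements of a Grassmann algebra commute. This makes all quadratic superoperators commute,
even for correlation matrices with different normal modes. -/
theorem theta_pair_commute (v w x y : MajSpace n) :
    Commute (theta v * theta w) (theta x * theta y) := by
  show theta v * theta w * (theta x * theta y) = theta x * theta y * (theta v * theta w)
  calc theta v * theta w * (theta x * theta y)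
      = theta v * (theta w * theta x) * theta y := by simp only [mul_assoc]
    _ = -((theta v * theta x) * (theta w * theta y)) := by
      rw [theta_anticomm w x, mul_neg, neg_mul]; simp only [mul_assoc]
    _ = -(theta x * (theta v * theta y) * theta w) := by
      rw [theta_anticomm v x, theta_anticomm w y, neg_mul_neg]; simp only [mul_assoc]
    _ = _ := by
      rw [theta_anticomm v y, mul_neg, neg_mul, neg_neg]; simp only [mul_assoc]

theorem theta_pair_mul_self (v w : MajSpace n) :
    (theta v * theta w) * (theta v * theta w) = 0 := by
  calc (theta v * theta w) * (theta v * theta w) = theta v * (theta w * theta v) * theta w := by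
        simp only [mul_assoc]
    _ = -((theta v * theta v) * (theta w * theta w)) := by
      rw [theta_anticomm w v, mul_neg, neg_mul]; simp only [mul_assoc]
    _ = 0 := by rw [theta_mul_self, zero_mul, neg_zero]

theorem theta_add (v w : MajSpace n) : theta (v + w) = theta v + theta w := by
  refine LinearMap.ext fun A => ?_
  simp only [LinearMap.add_apply, theta_apply, map_add, add_mul, mul_add, ← smul_add]
  congr 1
  abel

theorem theta_smul (c : ℝ) (v : MajSpace n) : theta (c • v) = (c : ℂ) • theta v := by
  refine LinearMap.ext fun A => ?_
  have : gam (c • v) = (c : ℂ) • gam v := by rw [map_smul]; rfl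
  simp only [LinearMap.smul_apply, theta_apply, this, Matrix.smul_mul, Matrix.mul_smul,
    ← smul_add]
  rw [smul_comm]

theorem theta_zero : theta (0 : MajSpace n) = 0 := by
  have := theta_smul 0 (0 : MajSpace n)
  simpa only [zero_smul, Complex.ofReal_zero] using this

theorem theta_eq_sum (v : MajSpace n) :
    theta v = ∑ μ, (v μ : ℂ) • theta (EuclideanSpace.single μ (1 : ℝ)) := by
  let T : MajSpace n →+ SuperOp n := ⟨⟨theta, theta_zero⟩, theta_add⟩
  have hv : v = ∑ μ, v μ • EuclideanSpace.single μ (1 : ℝ) := by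
    ext ν
    simp [Finset.sum_apply, Pi.single_apply]
  conv_lhs => rw [hv]
  have := map_sum T (fun μ => v μ • EuclideanSpace.single μ (1 : ℝ)) Finset.univ
  rw [show theta _ = T _ from rfl, this]
  exact Finset.sum_congr rfl fun μ _ => theta_smul _ _

/-- The quadratic superoperator of an antisymmetric matrix. -/
noncomputable def quadOp (A : Matrix (Maj n) (Maj n) ℝ) : SuperOp n :=
  -(Complex.I / 2) • ∑ μ, ∑ ν, (A μ ν : ℂ) •
    (theta (EuclideanSpace.single μ (1 : ℝ)) * theta (EuclideanSpace.single ν (1 : ℝ)))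

theorem quadOp_add (A B : Matrix (Maj n) (Maj n) ℝ) : quadOp (A + B) = quadOp A + quadOp B := by
  simp only [quadOp, Matrix.add_apply, Complex.ofReal_add, add_smul, Finset.sum_add_distrib,
    smul_add]

theorem quadOp_smul (c : ℝ) (A : Matrix (Maj n) (Maj n) ℝ) :
    quadOp (c • A) = (c : ℂ) • quadOp A := by
  simp only [quadOp, Matrix.smul_apply, smul_eq_mul, Complex.ofReal_mul, mul_smul,
    ← Finset.smul_sum]
  rw [smul_comm]

theorem quadOp_commute (A B : Matrix (Maj n) (Maj n) ℝ) : Commute (quadOp A) (quadOp B) := by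
  unfold quadOp
  refine Commute.smul_left (Commute.smul_right ?_ _) _
  refine Commute.sum_left _ _ _ fun μ _ => Commute.sum_left _ _ _ fun ν _ =>
    Commute.sum_right _ _ _ fun κ _ => Commute.sum_right _ _ _ fun ι _ => ?_
  exact Commute.smul_left (Commute.smul_right (theta_pair_commute _ _ _ _) _) _

/-- The superoperator of one normal mode. -/
noncomputable def modeOp (v w : MajSpace n) : SuperOp n := -Complex.I • (theta v * theta w)

/-- Bilinearity changes the basis, and anticommutation merges the two orders of each pair,
cancelling the factor `1 / 2`. -/
theorem quadOp_skewForm (b : OrthonormalBasis (Maj n) ℝ (MajSpace n)) (lam : Fin n → ℝ) :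
    quadOp (skewForm b lam) = ∑ j, (lam j : ℂ) • modeOp (b (j, 0)) (b (j, 1)) := by
  have h : ∀ v w : MajSpace n, theta v * theta w = ∑ μ, ∑ ν, ((v μ : ℂ) * (w ν : ℂ)) •
      (theta (EuclideanSpace.single μ (1 : ℝ)) * theta (EuclideanSpace.single ν (1 : ℝ))) :=
    fun v w => by
    rw [theta_eq_sum v, theta_eq_sum w, Finset.sum_mul_sum]
    refine Finset.sum_congr rfl fun μ _ => Finset.sum_congr rfl fun ν _ => ?_
    rw [smul_mul_smul_comm]
  have h2 : ∑ μ, ∑ ν, (skewForm b lam μ ν : ℂ) •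
      (theta (EuclideanSpace.single μ (1 : ℝ)) * theta (EuclideanSpace.single ν (1 : ℝ))) =
      ∑ j, (lam j : ℂ) • (theta (b (j, 0)) * theta (b (j, 1)) -
        theta (b (j, 1)) * theta (b (j, 0))) := by
    have e : ∀ μ ν, (skewForm b lam μ ν : ℂ) •
        (theta (EuclideanSpace.single μ (1 : ℝ)) * theta (EuclideanSpace.single ν (1 : ℝ))) =
        ∑ j, (lam j : ℂ) • ((((b (j, 0) μ : ℂ) * (b (j, 1) ν : ℂ)) • (theta
        (EuclideanSpace.single μ (1 : ℝ)) * theta (EuclideanSpace.single ν (1 : ℝ)))) -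
        ((b (j, 1) μ : ℂ) * (b (j, 0) ν : ℂ)) • (theta
        (EuclideanSpace.single μ (1 : ℝ)) * theta (EuclideanSpace.single ν (1 : ℝ)))) :=
      fun μ ν => by
      simp only [← sub_smul, smul_smul, ← Finset.sum_smul, skewForm, Matrix.of_apply]
      push_cast
      rfl
    simp only [e]
    conv_lhs => enter [2, μ]; rw [Finset.sum_comm]
    rw [Finset.sum_comm]
    refine Finset.sum_congr rfl fun j _ => ?_
    rw [h (b (j, 0)), h (b (j, 1))]
    simp only [← Finset.sum_sub_distrib, Finset.smul_sum]
  rw [quadOp, h2, Finset.smul_sum]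
  refine Finset.sum_congr rfl fun j _ => ?_
  rw [theta_anticomm (b (j, 1)), sub_neg_eq_add, ← two_smul ℂ, modeOp, smul_smul, smul_smul, smul_smul]
  congr 1
  ring

theorem modeOp_commute (v w x y : MajSpace n) : Commute (modeOp v w) (modeOp x y) :=
  Commute.smul_left (Commute.smul_right (theta_pair_commute _ _ _ _) _) _

theorem exp_smul_modeOp (c : ℂ) (v w : MajSpace n) :
    NormedSpace.exp (c • modeOp v w) = 1 + c • modeOp v w := by
  refine exp_eq_one_add_of_mul_self_eq_zero ?_
  rw [modeOp, smul_mul_smul_comm, smul_mul_smul_comm, theta_pair_mul_self]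
  simp

theorem modeOp_apply (v w : MajSpace n) (A : Op n) :
    modeOp v w A = -(Complex.I / 4) • (gam v * gam w * A - A * (gam w * gam v) +
      gam v * (parity n * A * parity n) * gam w - gam w * (parity n * A * parity n) * gam v) := by
  rw [modeOp, LinearMap.smul_apply, theta_mul_apply, smul_smul]
  congr 1
  ring

/-- For an even operator commuting with both vectors, exterior multiplication by an orthogonal pair
is ordinary multiplication. -/
theorem modeOp_apply_of_commute {v w : MajSpace n} (h : inner ℝ v w = 0) {A : Op n}
    (hA : parity n * A * parity n = A) (hv : gam v * A = A * gam v)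
    (hw : gam w * A = A * gam w) : modeOp v w A = -Complex.I • (gam v * gam w * A) := by
  have h1 : gam w * gam v = -(gam v * gam w) := by rw [gam_anticomm h, neg_neg]
  have h2 : A * (gam v * gam w) = gam v * gam w * A := by
    rw [← mul_assoc, ← hv, mul_assoc, ← hw, mul_assoc]
  rw [modeOp_apply, hA, mul_assoc (gam v) A, ← hw, mul_assoc (gam w) A, ← hv,
    ← mul_assoc (gam w), h1, mul_neg, h2, ← mul_assoc, neg_mul, sub_neg_eq_add, sub_neg_eq_add,
    ← two_smul ℂ (gam v * gam w * A)]
  module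

theorem majorana_pair (k : Fin n) :
    majorana (k, 0) * majorana (k, 1) = Complex.I • onQubit k pauliZ := by
  have : (fun j => if j = k then Complex.I • pauliZ else (1 : Matrix (Fin 2) (Fin 2) ℂ)) =
      fun j => (if j = k then Complex.I else 1) • (if j = k then pauliZ else 1) := by
    funext j; split_ifs <;> simp
  have h2 : (∏ j, if j = k then Complex.I else 1) = Complex.I := by simp
  have h3 := tensor_smul (fun j => if j = k then Complex.I else 1)
    (fun j => if j = k then pauliZ else 1)
  rw [h2, ← this] at h3
  rw [onQubit, ← h3]
  unfold majorana
  rw [tensor_mul]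
  congr 1
  funext j
  rcases lt_trichotomy j k with h | h | h
  · simp [h, h.ne, pauliZ_mul_self]
  · subst h; simp [pauliX_mul_pauliY]
  · simp [h.not_gt, h.ne']

/-- The product operator with the factors `1 + lam j Z` at the qubits of `S`. -/
noncomputable def diagFactor (lam : Fin n → ℝ) (S : Finset (Fin n)) : Op n :=
  tensor fun j => if j ∈ S then 1 + (lam j : ℂ) • pauliZ else 1

theorem diagFactor_empty (lam : Fin n → ℝ) : diagFactor lam ∅ = 1 := by
  simp [diagFactor, tensor_one]

theorem diagState_eq (lam : Fin n → ℝ) :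
    diagState lam = ((1 / 2 : ℂ) ^ n) • diagFactor lam Finset.univ := by
  have := tensor_smul (fun _ : Fin n => (1 / 2 : ℂ)) (fun j => 1 + (lam j : ℂ) • pauliZ)
  rw [diagState, this]
  simp [diagFactor]

/-- `-i` times the product of the two Majorana operators of a mode is Z on its qubit. -/
theorem diagFactor_insert (lam : Fin n → ℝ) {S : Finset (Fin n)} {k : Fin n} (hk : k ∉ S) :
    diagFactor lam (insert k S) = diagFactor lam S +
      (lam k : ℂ) • (-Complex.I • (majorana (k, 0) * majorana (k, 1) * diagFactor lam S)) := by
  rw [majorana_pair, Matrix.smul_mul, smul_smul (-Complex.I), neg_mul, Complex.I_mul_I, neg_neg,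
    one_smul, onQubit, diagFactor, diagFactor, tensor_mul]
  ext x y
  simp only [Matrix.add_apply, Matrix.smul_apply, tensor_apply, smul_eq_mul]
  rw [← Finset.mul_prod_erase _ _ (Finset.mem_univ k), ← Finset.mul_prod_erase _ _
    (Finset.mem_univ k), ← Finset.mul_prod_erase _ _ (Finset.mem_univ k)]
  have e1 : ∏ j ∈ Finset.univ.erase k, (if j ∈ insert k S then 1 + (lam j : ℂ) • pauliZ
      else 1 : Matrix (Fin 2) (Fin 2) ℂ) (x j) (y j) = ∏ j ∈ Finset.univ.erase k,
      (if j ∈ S then 1 + (lam j : ℂ) • pauliZ else 1 : Matrix (Fin 2) (Fin 2) ℂ) (x j) (y j) :=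
    Finset.prod_congr rfl fun j hj => by simp [Finset.mem_insert, Finset.ne_of_mem_erase hj]
  have e2 : ∏ j ∈ Finset.univ.erase k, ((if j = k then pauliZ else 1) *
      (if j ∈ S then 1 + (lam j : ℂ) • pauliZ else 1) : Matrix (Fin 2) (Fin 2) ℂ) (x j) (y j) =
      ∏ j ∈ Finset.univ.erase k,
      (if j ∈ S then 1 + (lam j : ℂ) • pauliZ else 1 : Matrix (Fin 2) (Fin 2) ℂ) (x j) (y j) :=
    Finset.prod_congr rfl fun j hj => by simp [Finset.ne_of_mem_erase hj]
  rw [e1, e2]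
  simp [hk]
  ring

/-- Outside the qubit `k` the string consists of Z's and identities, which commute with the diagonal
factors. -/
theorem majorana_commute_diagFactor (lam : Fin n → ℝ) {S : Finset (Fin n)} {k : Fin n}
    (hk : k ∉ S) (c : Fin 2) :
    majorana (k, c) * diagFactor lam S = diagFactor lam S * majorana (k, c) := by
  unfold majorana diagFactor
  rw [tensor_mul, tensor_mul]
  congr 1
  funext j
  by_cases hj : j ∈ S
  · have : j ≠ k := fun h => hk (h ▸ hj)
    by_cases h : j < k
    · simp [h, hj, mul_add, add_mul]
    · simp [h, hj, this]
  · simp [hj]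

/-- Modes are added one by one. The exponential of one mode is `1 + lam k • modeOp`, which acts on
the product of the other modes as multiplication by the conjugate of `1 + lam k Z`. Evenness of the
partial product is carried along because this needs it. -/
theorem GaussianForm.exp_partial {b : OrthonormalBasis (Maj n) ℝ (MajSpace n)} {lam : Fin n → ℝ}
    {U ρ : Op n} (h : GaussianForm b lam U ρ) (S : Finset (Fin n)) :
    NormedSpace.exp (∑ j ∈ S, (lam j : ℂ) • modeOp (b (j, 0)) (b (j, 1))) 1 =
      U * diagFactor lam S * Uᴴ ∧
    parity n * (U * diagFactor lam S * Uᴴ) * parity n = U * diagFactor lam S * Uᴴ := by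
  have hUU : U * Uᴴ = 1 := Matrix.mem_unitaryGroup_iff.1 h.unitary
  have hUU' : Uᴴ * U = 1 := Matrix.mem_unitaryGroup_iff'.1 h.unitary
  have conj_mul : ∀ A B : Op n, U * (A * B) * Uᴴ = (U * A * Uᴴ) * (U * B * Uᴴ) := fun A B => by
    calc U * (A * B) * Uᴴ = U * A * 1 * B * Uᴴ := by simp only [mul_assoc, mul_one]
      _ = _ := by rw [← hUU']; simp only [mul_assoc]
  induction S using Finset.induction_on with
  | empty => simp [diagFactor_empty, hUU, parity_mul_self, NormedSpace.exp_zero]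
  | insert k S hk ih =>
    obtain ⟨ih1, ih2⟩ := ih
    have hins : U * diagFactor lam (insert k S) * Uᴴ = U * diagFactor lam S * Uᴴ + (lam k : ℂ) •
        (-Complex.I • (gam (b (k, 0)) * gam (b (k, 1)) * (U * diagFactor lam S * Uᴴ))) := by
      rw [diagFactor_insert lam hk, mul_add, add_mul, Matrix.mul_smul, Matrix.mul_smul,
        Matrix.smul_mul, Matrix.smul_mul, conj_mul, conj_mul, h.conj, h.conj]
    have hcomm : ∀ c, gam (b (k, c)) * (U * diagFactor lam S * Uᴴ) =
        (U * diagFactor lam S * Uᴴ) * gam (b (k, c)) := fun c => by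
      rw [← h.conj, ← conj_mul, ← conj_mul, majorana_commute_diagFactor lam hk]
    have hort : inner ℝ (b (k, 0)) (b (k, 1)) = 0 := b.orthonormal.2 (by simp)
    rw [hins]
    clear hins
    generalize U * diagFactor lam S * Uᴴ = G at *
    constructor
    · have hc : Commute ((lam k : ℂ) • modeOp (b (k, 0)) (b (k, 1)))
          (∑ j ∈ S, (lam j : ℂ) • modeOp (b (j, 0)) (b (j, 1))) :=
        Commute.sum_right _ _ _ fun j _ =>
          Commute.smul_left (Commute.smul_right (modeOp_commute _ _ _ _) _) _
      rw [Finset.sum_insert hk, exp_add_of_commute' hc, Module.End.mul_apply, ih1,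
        exp_smul_modeOp, LinearMap.add_apply, Module.End.one_apply, LinearMap.smul_apply,
        modeOp_apply_of_commute hort ih2 (hcomm 0) (hcomm 1)]
    · rw [mul_add, add_mul, ih2, Matrix.mul_smul, Matrix.mul_smul, Matrix.smul_mul,
        Matrix.smul_mul]
      congr 3
      calc parity n * (gam (b (k, 0)) * gam (b (k, 1)) * G) * parity n
          = (parity n * gam (b (k, 0))) * gam (b (k, 1)) * G * parity n := by
            simp only [mul_assoc]
        _ = -(gam (b (k, 0)) * (parity n * gam (b (k, 1))) * G * parity n) := by
            rw [parity_mul_gam]; simp only [neg_mul, mul_assoc]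
        _ = gam (b (k, 0)) * gam (b (k, 1)) * (parity n * G * parity n) := by
            rw [parity_mul_gam]; simp only [neg_mul, mul_neg, neg_neg, mul_assoc]
        _ = _ := by rw [ih2]

/-- The state depends on `b` and `lam` only through the correlation matrix, and the exponent is
linear in it. -/
theorem GaussianForm.eq_exp {b : OrthonormalBasis (Maj n) ℝ (MajSpace n)} {lam : Fin n → ℝ}
    {U ρ : Op n} (h : GaussianForm b lam U ρ) :
    ρ = ((1 / 2 : ℂ) ^ n) • NormedSpace.exp (quadOp (skewForm b lam)) 1 := by
  rw [quadOp_skewForm, (h.exp_partial Finset.univ).1, h.eq, diagState_eq, Matrix.mul_smul,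
    Matrix.smul_mul]

/-! ### Expectations of unitaries -/

theorem diagState_apply (lam : Fin n → ℝ) (x y : Basis n) :
    diagState lam x y =
      if x = y then ((∏ j, (1 + lam j * (if x j = 0 then 1 else -1)) / 2 : ℝ) : ℂ) else 0 := by
  rw [diagState, tensor_apply]
  split_ifs with h
  · subst h
    push_cast
    refine Finset.prod_congr rfl fun j _ => ?_
    generalize x j = c
    fin_cases c <;> simp [pauliZ, Matrix.one_fin_two] <;> ring
  · obtain ⟨j, hj⟩ := Function.ne_iff.1 h
    refine Finset.prod_eq_zero (Finset.mem_univ j) ?_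
    revert hj
    generalize x j = c
    generalize y j = d
    fin_cases c <;> fin_cases d <;> simp [pauliZ, Matrix.one_fin_two]

theorem trace_diagState (lam : Fin n → ℝ) : (diagState lam).trace = 1 := by
  rw [diagState, trace_tensor]
  simp only [trace_half_one_add_pauliZ, Finset.prod_const_one]

/-- In the eigenbasis of the state the trace is an average, with probability weights, of diagonal
entries of a unitary. -/
theorem GaussianForm.norm_trace_unitary_mul_le {b : OrthonormalBasis (Maj n) ℝ (MajSpace n)}
    {lam : Fin n → ℝ} {U ρ : Op n} (h : GaussianForm b lam U ρ) {W : Op n}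
    (hW : W ∈ Matrix.unitaryGroup (Basis n) ℂ) : ‖(W * ρ).trace‖ ≤ 1 := by
  set p : Basis n → ℝ := fun x => ∏ j, (1 + lam j * (if x j = 0 then 1 else -1)) / 2 with hp
  have hp0 : ∀ x, 0 ≤ p x := fun x => Finset.prod_nonneg fun j _ => by
    have := abs_le.1 (h.bound j)
    split_ifs <;> linarith
  have hD : diagState lam = Matrix.diagonal fun x => (p x : ℂ) := by
    ext x y
    rw [diagState_apply, Matrix.diagonal_apply]
  have hp1 : ∑ x, p x = 1 := by
    have := trace_diagState lam
    rw [hD, Matrix.trace_diagonal] at this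
    exact_mod_cast this
  set V : Op n := Uᴴ * W * U with hV
  have hVu : V ∈ Matrix.unitaryGroup (Basis n) ℂ :=
    mul_mem (mul_mem (Unitary.star_mem h.unitary) hW) h.unitary
  have e : (W * ρ).trace = ∑ x, V x x * p x := by
    rw [h.eq, ← mul_assoc, Matrix.trace_mul_comm, ← mul_assoc, ← mul_assoc, ← hV, hD,
      Matrix.trace]
    simp [Matrix.mul_diagonal]
  rw [e, ← hp1]
  refine (norm_sum_le _ _).trans (Finset.sum_le_sum fun x _ => ?_)
  rw [norm_mul, Complex.norm_real, Real.norm_of_nonneg (hp0 x)]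
  exact mul_le_of_le_one_left (hp0 x) (entry_norm_bound_of_unitary hVu x x)

/-- By cyclicity each of the four terms is the expectation of a unitary, of modulus at most `1`; the
prefactor has modulus `1 / 4`. -/
theorem GaussianForm.norm_trace_mul_modeOp_le {b : OrthonormalBasis (Maj n) ℝ (MajSpace n)}
    {lam : Fin n → ℝ} {U ρ : Op n} (h : GaussianForm b lam U ρ) {W : Op n}
    (hW : W ∈ Matrix.unitaryGroup (Basis n) ℂ) {v w : MajSpace n} (hv : ‖v‖ = 1) (hw : ‖w‖ = 1) :
    ‖(W * modeOp v w ρ).trace‖ ≤ 1 := by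
  have hv' := gam_mem_unitary hv
  have hw' := gam_mem_unitary hw
  have hP := parity_mem_unitary (n := n)
  have t1 := h.norm_trace_unitary_mul_le (mul_mem hW (mul_mem hv' hw'))
  have t2 := h.norm_trace_unitary_mul_le (mul_mem (mul_mem hw' hv') hW)
  have t3 := h.norm_trace_unitary_mul_le
    (mul_mem (mul_mem (mul_mem hP hw') hW) (mul_mem hv' hP))
  have t4 := h.norm_trace_unitary_mul_le
    (mul_mem (mul_mem (mul_mem hP hv') hW) (mul_mem hw' hP))
  have e : (W * modeOp v w ρ).trace = -(Complex.I / 4) *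
      ((W * (gam v * gam w) * ρ).trace - (gam w * gam v * W * ρ).trace +
        (parity n * gam w * W * (gam v * parity n) * ρ).trace -
        (parity n * gam v * W * (gam w * parity n) * ρ).trace) := by
    rw [modeOp_apply, Matrix.mul_smul, Matrix.trace_smul, smul_eq_mul, mul_sub W, mul_add W, mul_sub W,
      Matrix.trace_sub, Matrix.trace_add, Matrix.trace_sub]
    congr 1
    congr 1
    · congr 1
      · congr 1
        · simp only [mul_assoc]
        · rw [← mul_assoc, Matrix.trace_mul_comm, ← mul_assoc]
      · calc (W * (gam v * (parity n * ρ * parity n) * gam w)).trace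
            = ((W * (gam v * parity n) * ρ) * (parity n * gam w)).trace := by
              simp only [mul_assoc]
          _ = _ := by rw [Matrix.trace_mul_comm]; simp only [mul_assoc]
    · calc (W * (gam w * (parity n * ρ * parity n) * gam v)).trace
          = ((W * (gam w * parity n) * ρ) * (parity n * gam v)).trace := by
            simp only [mul_assoc]
        _ = _ := by rw [Matrix.trace_mul_comm]; simp only [mul_assoc]
  have hI : ‖-(Complex.I / 4)‖ = 1 / 4 := by simp
  rw [e, norm_mul, hI]
  have := (norm_sub_le _ _).trans (add_le_add ((norm_add_le _ _).trans
    (add_le_add ((norm_sub_le _ _).trans (add_le_add t1 t2)) t3)) t4)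
  linarith

/-! ### Trace distance of free-fermionic states -/

/-- Along the segment of correlation matrices the state is `exp (t T)` applied to `ρ₀`, with `T` the
quadratic superoperator of the difference. Its derivative is `T` applied to the state at time `t`, a
sum over the modes of the difference with weights `d j`. The mean value inequality concludes. -/
theorem norm_trace_mul_sub_le {b₀ b₁ b : OrthonormalBasis (Maj n) ℝ (MajSpace n)}
    {l₀ l₁ d : Fin n → ℝ} {U₀ U₁ ρ₀ ρ₁ : Op n} (h₀ : GaussianForm b₀ l₀ U₀ ρ₀)
    (h₁ : GaussianForm b₁ l₁ U₁ ρ₁) (hd : skewForm b₁ l₁ - skewForm b₀ l₀ = skewForm b d)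
    {W : Op n} (hW : W ∈ Matrix.unitaryGroup (Basis n) ℂ) :
    ‖(W * (ρ₁ - ρ₀)).trace‖ ≤ ∑ j, |d j| := by
  set T : SuperOp n := quadOp (skewForm b d) with hT
  set C : ℝ → Matrix (Maj n) (Maj n) ℝ := fun t => skewForm b₀ l₀ + t • skewForm b d with hC
  -- Commuting exponents allow the exponential to be split.
  have hCT : ∀ t, ((1 / 2 : ℂ) ^ n) • NormedSpace.exp (quadOp (C t)) 1 =
      NormedSpace.exp ((t : ℂ) • T) ρ₀ := fun t => by
    have hc : Commute ((t : ℂ) • T) (quadOp (skewForm b₀ l₀)) :=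
      Commute.smul_left (quadOp_commute _ _) _
    rw [hC, quadOp_add, quadOp_smul, ← hT, add_comm, exp_add_of_commute' hc,
      Module.End.mul_apply, h₀.eq_exp, map_smul]
  -- Antisymmetric contractions form a convex set, so every point of the segment is the correlation
  -- matrix of a state; its exponential form identifies that state with the one on the path.
  have hform : ∀ t ∈ Set.Icc (0 : ℝ) 1, ∃ b' l' U',
      GaussianForm b' l' U' (NormedSpace.exp ((t : ℂ) • T) ρ₀) := fun t ht => by
    have hCt : C t = (1 - t) • skewForm b₀ l₀ + t • skewForm b₁ l₁ := by
      rw [hC]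
      simp only [← hd, smul_sub, sub_smul, one_smul]
      abel
    obtain ⟨b', l', U', σ, hσ, -, e⟩ := exists_gaussianForm_of_contraction (C t)
      (fun μ ν => by
        rw [hCt]
        simp only [Matrix.add_apply, Matrix.smul_apply, smul_eq_mul]
        rw [skewForm_antisymm b₀, skewForm_antisymm b₁]
        ring)
      (fun x => by
        rw [hCt, map_add, map_smul, map_smul, LinearMap.add_apply, LinearMap.smul_apply,
          LinearMap.smul_apply]
        refine (norm_add_le _ _).trans ?_
        rw [norm_smul, norm_smul, Real.norm_of_nonneg ht.1, Real.norm_of_nonneg (sub_nonneg.2 ht.2)]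
        have e0 := mul_le_mul_of_nonneg_left (norm_skewForm_le b₀ h₀.bound x) (sub_nonneg.2 ht.2)
        have e1 := mul_le_mul_of_nonneg_left (norm_skewForm_le b₁ h₁.bound x) ht.1
        linarith)
    refine ⟨b', l', U', ?_⟩
    rw [← hCT t, e, ← hσ.eq_exp]
    exact hσ
  let F : SuperOp n →ₗ[ℂ] ℂ :=
    { toFun := fun S => (W * S ρ₀).trace
      map_add' := fun S R => by simp [mul_add]
      map_smul' := fun c S => by simp }
  have hder : ∀ t : ℝ, HasDerivAt (fun s : ℝ => (W * NormedSpace.exp ((s : ℂ) • T) ρ₀).trace)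
      (W * T (NormedSpace.exp ((t : ℂ) • T) ρ₀)).trace t := fun t => by
    have h1 := hasDerivAt_exp_smul_const' T (t : ℂ)
    have h2 := ((LinearMap.toContinuousLinearMap F).hasFDerivAt.comp_hasDerivAt (t : ℂ) h1)
    exact h2.comp_ofReal
  have hbound : ∀ t ∈ Set.Ico (0 : ℝ) 1,
      ‖(W * T (NormedSpace.exp ((t : ℂ) • T) ρ₀)).trace‖ ≤ ∑ j, |d j| := fun t ht => by
    obtain ⟨b', l', U', h'⟩ := hform t ⟨ht.1, ht.2.le⟩
    generalize NormedSpace.exp ((t : ℂ) • T) ρ₀ = σ at h'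
    rw [hT, quadOp_skewForm, LinearMap.sum_apply, Finset.mul_sum, Matrix.trace_sum]
    refine (norm_sum_le _ _).trans (Finset.sum_le_sum fun j _ => ?_)
    rw [LinearMap.smul_apply, Matrix.mul_smul, Matrix.trace_smul, norm_smul, Complex.norm_real]
    exact mul_le_of_le_one_right (abs_nonneg _)
      (h'.norm_trace_mul_modeOp_le hW (b.orthonormal.1 _) (b.orthonormal.1 _))
  have key := norm_image_sub_le_of_norm_deriv_le_segment_01'
    (fun t _ => (hder t).hasDerivWithinAt) hbound
  have e0 : NormedSpace.exp (((0 : ℝ) : ℂ) • T) ρ₀ = ρ₀ := by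
    simp [NormedSpace.exp_zero]
  have e1 : NormedSpace.exp (((1 : ℝ) : ℂ) • T) ρ₀ = ρ₁ := by
    rw [← hCT, h₁.eq_exp, hC]
    simp only [← hd, one_smul, add_sub_cancel]
  rw [e0, e1] at key
  rwa [mul_sub, Matrix.trace_sub]

end Superoperators

/-- The trace norm of a Hermitian matrix is attained at a unitary. -/
theorem exists_unitary_traceNorm {ι : Type*} [Fintype ι] [DecidableEq ι] {A : Matrix ι ι ℂ}
    (hA : A.IsHermitian) :
    ∃ W ∈ Matrix.unitaryGroup ι ℂ, (traceNorm A : ℂ) = (W * A).trace := by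
  set V := (hA.eigenvectorUnitary : Matrix ι ι ℂ) with hV
  have hVu : V ∈ Matrix.unitaryGroup ι ℂ := hA.eigenvectorUnitary.2
  have hVV : Vᴴ * V = 1 := Matrix.mem_unitaryGroup_iff'.1 hVu
  have hspec : A = V * Matrix.diagonal (fun i => (hA.eigenvalues i : ℂ)) * Vᴴ := by
    have := hA.spectral_theorem
    rw [Unitary.conjStarAlgAut_apply] at this
    exact this
  have hnorm : traceNorm A = ∑ i, |hA.eigenvalues i| := by
    have hH := Matrix.isHermitian_conjTranspose_mul_self A
    have hAA : Aᴴ * A = V * Matrix.diagonal (fun i => ((hA.eigenvalues i ^ 2 : ℝ) : ℂ)) * Vᴴ := by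
      rw [hA.eq]
      conv_lhs => rw [hspec]
      calc _ = V * (Matrix.diagonal (fun i => (hA.eigenvalues i : ℂ)) * (Vᴴ * V) *
            Matrix.diagonal (fun i => (hA.eigenvalues i : ℂ))) * Vᴴ := by simp only [mul_assoc]
        _ = _ := by
          rw [hVV, mul_one, Matrix.diagonal_mul_diagonal]
          congr 3
          funext i
          push_cast
          ring
    -- The eigenvalues of `Aᴴ * A` are the squares of those of `A` as multisets; comparing roots of
    -- the characteristic polynomial avoids matching the two orderings.
    have hroots := hH.roots_charpoly_eq_eigenvalues
    have hchar : (Aᴴ * A).charpoly =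
        ∏ i, (Polynomial.X - Polynomial.C ((hA.eigenvalues i ^ 2 : ℝ) : ℂ)) := by
      rw [hAA, Matrix.charpoly_mul_comm, ← mul_assoc, hVV, one_mul, Matrix.charpoly_diagonal]
    have hroots' : (∏ i, (Polynomial.X -
        Polynomial.C ((hA.eigenvalues i ^ 2 : ℝ) : ℂ))).roots =
        Finset.univ.val.map fun i => ((hA.eigenvalues i ^ 2 : ℝ) : ℂ) :=
      Polynomial.roots_multiset_prod_X_sub_C
        (Finset.univ.val.map fun i => ((hA.eigenvalues i ^ 2 : ℝ) : ℂ)) ▸ by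
          rw [Multiset.map_map]; rfl
    rw [hchar, hroots'] at hroots
    have := congrArg (fun m => (m.map fun z : ℂ => Real.sqrt z.re).sum) hroots
    simp only [Multiset.map_map] at this
    unfold traceNorm
    refine Eq.trans ?_ (this.symm.trans ?_)
    · rfl
    · exact Finset.sum_congr rfl fun i _ => Real.sqrt_sq_eq_abs _
  -- The unitary is the sign of `A`, with sign `1` at the eigenvalue `0` to keep it unitary.
  set s : ι → ℂ := fun i => if 0 ≤ hA.eigenvalues i then 1 else -1 with hs
  refine ⟨V * Matrix.diagonal s * Vᴴ, mul_mem (mul_mem hVu ?_) (Unitary.star_mem hVu), ?_⟩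
  · rw [Matrix.mem_unitaryGroup_iff, Matrix.star_eq_conjTranspose, Matrix.diagonal_conjTranspose,
      Matrix.diagonal_mul_diagonal, ← Matrix.diagonal_one]
    congr 1
    funext i
    simp only [hs, Pi.star_apply]
    split_ifs <;> simp
  · rw [hnorm]
    conv_rhs => rw [hspec]
    calc ((∑ i, |hA.eigenvalues i| : ℝ) : ℂ)
        = (Matrix.diagonal s * Matrix.diagonal (fun i => (hA.eigenvalues i : ℂ))).trace := by
          rw [Matrix.diagonal_mul_diagonal, Matrix.trace_diagonal]
          push_cast
          refine Finset.sum_congr rfl fun i _ => ?_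
          simp only [hs]
          split_ifs with h
          · rw [abs_of_nonneg h, one_mul]
          · rw [abs_of_neg (not_le.1 h)]; simp
      _ = (Vᴴ * (V * (Matrix.diagonal s * (Vᴴ * V) *
            Matrix.diagonal (fun i => (hA.eigenvalues i : ℂ))))).trace := by
          rw [hVV, mul_one, ← mul_assoc Vᴴ, hVV, one_mul]
      _ = _ := by
          rw [Matrix.trace_mul_comm]
          simp only [mul_assoc]

theorem GaussianForm.isHermitian {b : OrthonormalBasis (Maj n) ℝ (MajSpace n)}
    {lam : Fin n → ℝ} {U ρ : Op n} (h : GaussianForm b lam U ρ) : ρ.IsHermitian := by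
  have hD : (diagState lam)ᴴ = diagState lam := by
    rw [diagState, tensor_conjTranspose]
    congr 1
    funext j
    simp [Matrix.conjTranspose_smul, pauliZ_conjTranspose]
  rw [Matrix.IsHermitian, h.eq, Matrix.conjTranspose_mul, Matrix.conjTranspose_mul,
    Matrix.conjTranspose_conjTranspose, hD, mul_assoc]

/-- Each value `d j` occurs twice among the singular values, once for each vector of its plane. -/
theorem sum_sq_skewForm (b : OrthonormalBasis (Maj n) ℝ (MajSpace n)) (d : Fin n → ℝ) :
    ∑ μ, ∑ ν, skewForm b d μ ν ^ 2 = 2 * ∑ j, d j ^ 2 := by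
  have h : ∀ v w : MajSpace n, ∑ μ, ∑ ν, skewForm b d μ ν * (v μ * w ν) =
      inner ℝ v (Matrix.toEuclideanLin (skewForm b d) w) := fun v w => by
    simp only [inner_eq_sum, Matrix.toLpLin_apply, Matrix.mulVec, dotProduct, Finset.mul_sum]
    exact Finset.sum_congr rfl fun μ _ => Finset.sum_congr rfl fun ν _ => by ring
  have e : ∀ μ ν, skewForm b d μ ν ^ 2 = ∑ j, d j * (skewForm b d μ ν * (b (j, 0) μ * b (j, 1) ν)
      - skewForm b d μ ν * (b (j, 1) μ * b (j, 0) ν)) := fun μ ν => by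
    rw [pow_two]
    conv_lhs => enter [2]; rw [skewForm, Matrix.of_apply]
    rw [Finset.mul_sum]
    exact Finset.sum_congr rfl fun j _ => by ring
  simp only [e]
  conv_lhs => enter [2, μ]; rw [Finset.sum_comm]
  rw [Finset.sum_comm, Finset.mul_sum]
  refine Finset.sum_congr rfl fun j _ => ?_
  simp only [← Finset.mul_sum, Finset.sum_sub_distrib]
  have h0 : inner ℝ (b (j, 1)) (Matrix.toEuclideanLin (skewForm b d) (b (j, 0))) = -d j := by
    rw [skewForm_mulVec_inner, inner_sum, Finset.sum_eq_single j]
    · simp [inner_smul_right, orthonormal_iff_ite.1 b.orthonormal]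
    · intro i _ hi
      simp [orthonormal_iff_ite.1 b.orthonormal, hi]
    · simp
  rw [h, h, skewForm_apply_basis_one, h0]
  simp [inner_smul_right]
  ring

/-- The trace distance of free-fermionic states is bounded by the Frobenius distance of their
correlation matrices. -/
theorem GaussianForm.traceNorm_sub_sq_le {b₀ b₁ : OrthonormalBasis (Maj n) ℝ (MajSpace n)}
    {l₀ l₁ : Fin n → ℝ} {U₀ U₁ ρ₀ ρ₁ : Op n} (h₀ : GaussianForm b₀ l₀ U₀ ρ₀)
    (h₁ : GaussianForm b₁ l₁ U₁ ρ₁) :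
    2 * traceNorm (ρ₁ - ρ₀) ^ 2 ≤
      n * ∑ μ, ∑ ν, (skewForm b₁ l₁ μ ν - skewForm b₀ l₀ μ ν) ^ 2 := by
  obtain ⟨b, d, hd⟩ := exists_eq_skewForm (skewForm b₁ l₁ - skewForm b₀ l₀) fun μ ν => by
    rw [Matrix.sub_apply, Matrix.sub_apply, skewForm_antisymm b₁, skewForm_antisymm b₀]
    ring
  obtain ⟨W, hW, e⟩ := exists_unitary_traceNorm (h₁.isHermitian.sub h₀.isHermitian)
  have key := norm_trace_mul_sub_le h₀ h₁ hd hW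
  rw [← e, Complex.norm_real] at key
  -- Cauchy-Schwarz over the `n` modes; together with the factor `2` in the Frobenius norm this
  -- gives the constant.
  have hcs : (∑ j, |d j|) ^ 2 ≤ n * ∑ j, d j ^ 2 := by
    have := sq_sum_le_card_mul_sum_sq (s := Finset.univ) (f := fun j => |d j|)
    simpa using this
  have hfr := sum_sq_skewForm b d
  rw [← hd] at hfr
  simp only [Matrix.sub_apply] at hfr
  rw [hfr]
  have h2 : traceNorm (ρ₁ - ρ₀) ^ 2 ≤ (∑ j, |d j|) ^ 2 := by
    rw [← sq_abs (traceNorm _)]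
    exact pow_le_pow_left₀ (abs_nonneg _) key 2
  linarith

end FreeFermion

/-! ### Bell circuits and the observables they measure. -/

open FreeFermion
open scoped Matrix

namespace FreeFermion

variable {n : ℕ}

/-! ### Conjugation of product operators by gates -/

theorem onQubit_conj (q : Fin n) (G : Matrix (Fin 2) (Fin 2) ℂ)
    (A A' : Fin n → Matrix (Fin 2) (Fin 2) ℂ) (hq : A' q = Gᴴ * A q * G)
    (h : ∀ j, j ≠ q → A' j = A j) :
    (onQubit q G)ᴴ * tensor A * onQubit q G = tensor A' := by
  rw [onQubit, tensor_conjTranspose, tensor_mul, tensor_mul]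
  congr 1
  funext j
  by_cases hj : j = q
  · subst hj; simp [hq]
  · simp only [hj, if_false, Matrix.conjTranspose_one, one_mul, mul_one, h j hj]

/-- The gate permutes the basis, so conjugation relabels entries and only the factors at the control
and the target take part. The hypothesis `h` is the resulting identity of their product of entries.
-/
theorem cnot_conj (c t : Fin n) (hct : c ≠ t) (A A' : Fin n → Matrix (Fin 2) (Fin 2) ℂ)
    (hrest : ∀ j, j ≠ c → j ≠ t → A' j = A j)
    (h : ∀ a a' b b' : Fin 2, A c a a' * A t (b + a) (b' + a') = A' c a a' * A' t b b') :
    (Gate.CNOT c t hct).matᴴ * tensor A * (Gate.CNOT c t hct).mat = tensor A' := by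
  set f : Basis n → Basis n := fun y => Function.update y t (y t + y c) with hf
  have hff : ∀ y, f (f y) = y := fun y => by
    have h2 : ∀ a b : Fin 2, a + b + b = a := by decide
    funext j
    by_cases hj : j = t
    · subst hj; simp [hf, hct, h2]
    · simp [hf, hj]
  have hM : ∀ x y, (Gate.CNOT c t hct).mat x y = if x = f y then 1 else 0 := fun x y => rfl
  ext x y
  rw [Matrix.mul_apply]
  simp only [Matrix.mul_apply, Matrix.conjTranspose_apply, hM]
  simp only [apply_ite (star : ℂ → ℂ), star_one, star_zero, ite_mul, one_mul, zero_mul, mul_ite,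
    mul_one, mul_zero, Finset.sum_ite_eq', Finset.mem_univ, if_true]
  rw [tensor_apply, tensor_apply]
  have hsplit : ∀ g : Fin n → ℂ, ∏ j, g j = g c * g t * ∏ j ∈ (Finset.univ.erase c).erase t, g j :=
    fun g => by
    rw [← Finset.mul_prod_erase _ g (Finset.mem_univ c), ← Finset.mul_prod_erase _ g
      (Finset.mem_erase.2 ⟨hct.symm, Finset.mem_univ t⟩), mul_assoc]
  rw [hsplit, hsplit]
  congr 1
  · rw [← h]
    simp [hf, hct]
  · refine Finset.prod_congr rfl fun j hj => ?_
    have h1 := Finset.ne_of_mem_erase hj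
    have h2 := Finset.ne_of_mem_erase (Finset.mem_of_mem_erase hj)
    simp [hf, h1, hrest j h2 h1]

/-! ### Circuits measuring pairs of qubits -/

/-- The gates that measure the qubits `s - l` and `l` jointly. -/
def pairBlock (s τ : ℕ) (l : Fin n) : Circuit n :=
  if h : (l : ℕ) ≤ s ∧ s - l < l then
    (if τ = 1 then [Gate.S l] else []) ++
      [Gate.CNOT ⟨s - l, h.2.trans l.2⟩ l (fun e => h.2.ne (congrArg Fin.val e)),
        Gate.H ⟨s - l, h.2.trans l.2⟩]
  else []

/-- The circuit measuring all pairs of qubits whose indices add up to `s`. -/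
def bellCircuit (n s τ : ℕ) : Circuit n := (List.finRange n).flatMap (pairBlock s τ)

theorem circuit_mat_foldl (C : Circuit n) (V : Op n) :
    C.foldl (fun V g => g.mat * V) V = C.mat * V := by
  induction C using List.reverseRecOn with
  | nil => simp [Circuit.mat]
  | append_singleton C g ih => simp [Circuit.mat, ih, mul_assoc]

theorem circuit_mat_append (C D : Circuit n) : Circuit.mat (C ++ D) = D.mat * C.mat := by
  rw [Circuit.mat, List.foldl_append, circuit_mat_foldl]
  rfl

theorem circuit_mat_nil : Circuit.mat ([] : Circuit n) = 1 := rfl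

theorem circuit_mat_cons (g : Gate n) (C : Circuit n) :
    Circuit.mat (g :: C) = C.mat * g.mat := by
  have := circuit_mat_append [g] C
  simpa [Circuit.mat] using this

/-- `X ^ b * Z ^ c`. -/
noncomputable def xzFactor (b c : Bool) : Matrix (Fin 2) (Fin 2) ℂ :=
  (if b then pauliX else 1) * (if c then pauliZ else 1)

/-- Conjugation by the phase gate. -/
noncomputable def phaseConj (τ : ℕ) (A : Matrix (Fin 2) (Fin 2) ℂ) : Matrix (Fin 2) (Fin 2) ℂ :=
  if τ = 1 then (!![1, 0; 0, Complex.I])ᴴ * A * !![1, 0; 0, Complex.I] else A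

theorem phase_unitary :
    (!![1, 0; 0, Complex.I] : Matrix (Fin 2) (Fin 2) ℂ)ᴴ * !![1, 0; 0, Complex.I] = 1 := by
  ext i j; fin_cases i <;> fin_cases j <;> simp [Matrix.mul_apply, Matrix.conjTranspose_apply]

theorem phaseConj_one (τ : ℕ) : phaseConj τ 1 = 1 := by
  rw [phaseConj, mul_one, phase_unitary, ite_self]

theorem phaseConj_Z (τ : ℕ) : phaseConj τ pauliZ = pauliZ := by
  rw [phaseConj]
  split_ifs
  · ext i j; fin_cases i <;> fin_cases j <;>
      simp [Matrix.mul_apply, Matrix.conjTranspose_apply, pauliZ]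
  · rfl

theorem hadamard_unitary : (((Real.sqrt 2 : ℝ) : ℂ)⁻¹ • !![1, 1; 1, -1] :
    Matrix (Fin 2) (Fin 2) ℂ)ᴴ * (((Real.sqrt 2 : ℝ) : ℂ)⁻¹ • !![1, 1; 1, -1]) = 1 := by
  have h : ((Real.sqrt 2 : ℝ) : ℂ)⁻¹ * ((Real.sqrt 2 : ℝ) : ℂ)⁻¹ = 1 / 2 := by
    rw [← mul_inv, ← Complex.ofReal_mul, Real.mul_self_sqrt (by norm_num)]; norm_num
  ext i j
  fin_cases i <;> fin_cases j <;>
    simp [Matrix.mul_apply, Matrix.conjTranspose_apply, h] <;> norm_num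

theorem hadamard_conj_Z : (((Real.sqrt 2 : ℝ) : ℂ)⁻¹ • !![1, 1; 1, -1] :
    Matrix (Fin 2) (Fin 2) ℂ)ᴴ * pauliZ * (((Real.sqrt 2 : ℝ) : ℂ)⁻¹ • !![1, 1; 1, -1]) =
      pauliX := by
  have h : ((Real.sqrt 2 : ℝ) : ℂ)⁻¹ * ((Real.sqrt 2 : ℝ) : ℂ)⁻¹ = 1 / 2 := by
    rw [← mul_inv, ← Complex.ofReal_mul, Real.mul_self_sqrt (by norm_num)]; norm_num
  ext i j
  fin_cases i <;> fin_cases j <;>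
    simp [Matrix.mul_apply, Matrix.conjTranspose_apply, h, pauliZ, pauliX] <;> norm_num

/-- CNOT copies X from the control to the target and Z from the target to the control. -/
theorem cnot_pair (b c : Bool) (x x' y y' : Fin 2) :
    (if b then pauliX else 1 : Matrix (Fin 2) (Fin 2) ℂ) x x' *
      (if c then pauliZ else 1 : Matrix (Fin 2) (Fin 2) ℂ) (y + x) (y' + x') =
      xzFactor b c x x' * xzFactor b c y y' := by
  unfold xzFactor
  cases b <;> cases c <;> fin_cases x <;> fin_cases x' <;> fin_cases y <;> fin_cases y' <;>
    simp [pauliX, pauliZ, Matrix.one_fin_two, Matrix.mul_apply]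

/-- Pulled back through the block, Z on the smaller qubit becomes XX and Z on the larger one ZZ,
hence both together a multiple of YY. The phase gate on the larger qubit turns these into multiples
of XY, ZZ and YX. -/
theorem pairBlock_conj {s τ : ℕ} {l k : Fin n} (hk : (k : ℕ) = s - l) (hl : (l : ℕ) ≤ s)
    (hkl : (k : ℕ) < l) (b c : Bool) (A A' : Fin n → Matrix (Fin 2) (Fin 2) ℂ)
    (hAk : A k = if b then pauliZ else 1) (hAl : A l = if c then pauliZ else 1)
    (hk' : A' k = xzFactor b c) (hl' : A' l = phaseConj τ (xzFactor b c))
    (hrest : ∀ j, j ≠ k → j ≠ l → A' j = A j) :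
    (pairBlock s τ l).matᴴ * tensor A * (pairBlock s τ l).mat = tensor A' := by
  have hne : k ≠ l := fun e => hkl.ne (congrArg Fin.val e)
  have hkf : (⟨s - l, by omega⟩ : Fin n) = k := Fin.ext hk.symm
  have h1 := onQubit_conj k (((Real.sqrt 2 : ℝ) : ℂ)⁻¹ • !![1, 1; 1, -1]) A
    (fun j => if j = k then (if b then pauliX else 1) else A j) (by
      rw [if_pos rfl, hAk]
      cases b
      · simp only [Bool.false_eq_true, if_false, mul_one, hadamard_unitary]
      · simp only [if_true, hadamard_conj_Z]) (fun j hj => if_neg hj)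
  have h2 := cnot_conj k l hne (fun j => if j = k then (if b then pauliX else 1) else A j)
    (fun j => if j = k ∨ j = l then xzFactor b c else A j)
    (fun j h h' => by simp [h, h']) (fun x x' y y' => by
      have := cnot_pair b c x x' y y'
      simpa only [if_true, hne.symm, if_false, hAl, true_or, or_true] using this)
  rw [pairBlock, dif_pos ⟨hl, hk ▸ hkl⟩, circuit_mat_append, circuit_mat_cons, circuit_mat_cons,
    circuit_mat_nil, one_mul]
  simp only [hkf]
  have e : ∀ V : Op n, ((Gate.H k).mat * (Gate.CNOT k l hne).mat * V)ᴴ * tensor A *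
      ((Gate.H k).mat * (Gate.CNOT k l hne).mat * V) =
      Vᴴ * tensor (fun j => if j = k ∨ j = l then xzFactor b c else A j) * V := fun V => by
    rw [← h2, ← h1]
    simp only [Matrix.conjTranspose_mul, mul_assoc]
    rfl
  rw [e]
  by_cases hτ : τ = 1
  · rw [if_pos hτ, circuit_mat_cons, circuit_mat_nil, one_mul]
    refine onQubit_conj l _ _ _ ?_ fun j hj => ?_
    · rw [hl', phaseConj, if_pos hτ]; simp
    · by_cases hjk : j = k
      · subst hjk; simp [hk']
      · simp [hj, hjk, hrest j hjk hj]
  · rw [if_neg hτ, circuit_mat_nil]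
    simp only [Matrix.conjTranspose_one, one_mul, mul_one]
    congr 1
    funext j
    by_cases hjk : j = k
    · subst hjk; simp [hk']
    · by_cases hj : j = l
      · subst hj; simp [hl', phaseConj, hτ]
      · simp [hj, hjk, hrest j hjk hj]

/-- The factors of the observable measured by the pairs of which the larger qubit is in `L`. -/
noncomputable def pairObs (s τ : ℕ) (B : ℕ → Bool) (L : List (Fin n)) (q : Fin n) :
    Matrix (Fin 2) (Fin 2) ℂ :=
  if q ∈ L ∧ (q : ℕ) ≤ s ∧ s - q < q then phaseConj τ (xzFactor (B (s - q)) (B q))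
  else if (s - q) ∈ L.map Fin.val ∧ (q : ℕ) ≤ s ∧ (q : ℕ) < s - q then xzFactor (B q) (B (s - q))
  else if B q then pauliZ else 1

/-- Blocks of distinct `l` touch disjoint pairs. In the induction the qubits of the new block still
carry Z or the identity, since the list has no repetitions. -/
theorem pairBlocks_conj (s τ : ℕ) (B : ℕ → Bool) (L : List (Fin n)) (hL : L.Nodup) :
    (Circuit.mat (L.flatMap (pairBlock s τ)))ᴴ * tensor (fun q => if B q then pauliZ else 1) *
      Circuit.mat (L.flatMap (pairBlock s τ)) = tensor (pairObs s τ B L) := by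
  induction L with
  | nil =>
    have : pairObs (n := n) s τ B [] = fun q : Fin n => if B q then pauliZ else 1 := by
      funext q; simp [pairObs]
    simp [circuit_mat_nil, this]
  | cons l L ih =>
    obtain ⟨hl, hL'⟩ := List.nodup_cons.1 hL
    rw [List.flatMap_cons, circuit_mat_append, Matrix.conjTranspose_mul]
    have e : ∀ X V W : Op n, Wᴴ * Vᴴ * X * (V * W) = Wᴴ * (Vᴴ * X * V) * W := fun X V W => by
      simp only [mul_assoc]
    rw [e, ih hL']
    by_cases h : (l : ℕ) ≤ s ∧ s - l < l
    · set k : Fin n := ⟨s - l, h.2.trans l.2⟩ with hk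
      have hkv : (k : ℕ) = s - l := rfl
      have hkl : k ≠ l := fun e => h.2.ne (congrArg Fin.val e)
      have hsk : s - (k : ℕ) = l := by omega
      refine pairBlock_conj hkv h.1 h.2 (B k) (B l) _ _ ?_ ?_ ?_ ?_ ?_
      · rw [pairObs, if_neg (by omega), if_neg]
        rw [hsk, List.mem_map]
        rintro ⟨⟨x, hx, hxl⟩, -⟩
        exact hl (Fin.ext hxl ▸ hx)
      · rw [pairObs, if_neg (fun h => hl h.1), if_neg (by omega)]
      · rw [pairObs, if_neg (by omega), if_pos, hsk]
        rw [hsk]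
        exact ⟨by simp, by omega, by omega⟩
      · rw [pairObs, if_pos ⟨by simp, h⟩, hkv]
      · intro j hjk hjl
        have h1 : (j ∈ l :: L) ↔ j ∈ L := by simp [hjl]
        unfold pairObs
        simp only [h1]
        congr 1
        by_cases hj : (j : ℕ) ≤ s ∧ (j : ℕ) < s - j
        · have h2 : ((s - j : ℕ) ∈ (l :: L).map Fin.val) ↔ (s - j : ℕ) ∈ L.map Fin.val := by
            rw [List.map_cons, List.mem_cons, or_iff_right]
            intro h3
            exact hjk (Fin.ext (by omega))
          simp only [h2]
        · rw [if_neg (fun h => hj h.2)]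
          exact (if_neg (fun h => hj h.2)).symm
    · have hb : pairBlock s τ l = [] := by rw [pairBlock, dif_neg h]
      rw [hb, circuit_mat_nil]
      simp only [Matrix.conjTranspose_one, one_mul, mul_one]
      congr 1
      funext j
      unfold pairObs
      have h1 : (j ∈ l :: L ∧ (j : ℕ) ≤ s ∧ s - j < j) ↔ (j ∈ L ∧ (j : ℕ) ≤ s ∧ s - j < j) := by
        constructor
        · rintro ⟨h1, h2⟩
          rcases List.mem_cons.1 h1 with rfl | h1
          · exact absurd h2 h
          · exact ⟨h1, h2⟩
        · rintro ⟨h1, h2⟩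
          exact ⟨List.mem_cons_of_mem _ h1, h2⟩
      have h2 : ((s - j : ℕ) ∈ (l :: L).map Fin.val ∧ (j : ℕ) ≤ s ∧ (j : ℕ) < s - j) ↔
          ((s - j : ℕ) ∈ L.map Fin.val ∧ (j : ℕ) ≤ s ∧ (j : ℕ) < s - j) := by
        rw [List.map_cons, List.mem_cons]
        constructor
        · rintro ⟨h1 | h1, h2⟩
          · exact absurd ⟨by omega, by omega⟩ h
          · exact ⟨h1, h2⟩
        · rintro ⟨h1, h2⟩
          exact ⟨Or.inr h1, h2⟩
      rw [if_congr h1 rfl rfl, if_congr h2 rfl rfl]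

/-- The qubits whose outcomes enter the estimate of the correlation of `(k, a)` and `(l, b)`. -/
def signSet (k l a q : ℕ) : Bool := xor (q = k) (k + l ≤ 2 * q ∧ q + a ≤ l)

theorem signSet_eq_false {k l a q : ℕ} (h : q = k ↔ k + l ≤ 2 * q ∧ q + a ≤ l) :
    signSet k l a q = false := by
  rw [signSet, decide_eq_decide.2 h, Bool.xor_self]

theorem signSet_eq_true {k l a q : ℕ} (h : q = k ↔ ¬(k + l ≤ 2 * q ∧ q + a ≤ l)) :
    signSet k l a q = true := by
  rw [signSet, decide_eq_decide.2 h, decide_not]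
  cases decide (k + l ≤ 2 * q ∧ q + a ≤ l) <;> rfl

/-- In `γ_(k,a) γ_(l,b)` with `k < l` the Z of the second string turns the factor at `k` into a
multiple of Y for `a = 0` and of X for `a = 1`. So `a ≠ b` gives XX or YY on the ends, and `a = b`
gives XY or YX, which require the phase gate. The outcome at `k` supplies the X part. The outcomes
at larger qubits supply ZZ on the inner pairs, Z at an unpaired middle qubit and, for `a = 0`, the Z
part on the ends. Within one mode the product in the order `(k, 1), (k, 0)` is a multiple of Z on
the unpaired qubit `k`. -/
theorem bellCircuit_conj {k l : Fin n} {a b : Fin 2} (h : k < l ∨ k = l ∧ a = 1 ∧ b = 0) :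
    (bellCircuit n (k + l) (if a = b then 1 else 0)).matᴴ *
        tensor (fun q => if signSet k l a q then pauliZ else 1) *
        (bellCircuit n (k + l) (if a = b then 1 else 0)).mat =
      (-Complex.I * (if (a = 1 ∧ b = 1) ∨ k = l then -1 else 1)) •
        (majorana (k, a) * majorana (l, b)) := by
  rw [bellCircuit, pairBlocks_conj _ _ _ _ (List.nodup_finRange n)]
  have hmem : ∀ x : ℕ, x ∈ (List.finRange n).map Fin.val ↔ x < n := fun x => by
    rw [List.map_coe_finRange_eq_range, List.mem_range]
  rcases h with h | ⟨rfl, rfl, rfl⟩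
  · have hv : (k : ℕ) < l := h
    have hn := l.2
    have hne : k ≠ l := h.ne
    set ck : ℂ := if a = 1 then -Complex.I else 1 with hck
    set cl : ℂ := if a = 1 then (if b = 1 then -1 else 1) else -Complex.I with hcl
    -- The scalar `-i` with its sign is split into one factor at qubit `k` and one at qubit `l`, so
    -- that the identity can be checked qubit by qubit.
    have hc : (∏ j, if j = k then ck else if j = l then cl else 1) = ck * cl := by
      rw [← Finset.mul_prod_erase _ _ (Finset.mem_univ k), if_pos rfl]
      congr 1
      rw [Finset.prod_eq_single l]
      · simp [hne.symm]
      · intro j hj hjl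
        simp [Finset.ne_of_mem_erase hj, hjl]
      · simp [hne.symm]
    have hcc : -Complex.I * (if (a = 1 ∧ b = 1) ∨ k = l then -1 else 1) = ck * cl := by
      simp only [hne, or_false, hck, hcl]
      fin_cases a <;> fin_cases b <;> simp
    rw [hcc, ← hc, majorana, majorana, tensor_mul, ← tensor_smul]
    congr 1
    funext j
    rcases lt_trichotomy j k with hj | rfl | hj
    · have hjv : (j : ℕ) < k := hj
      have e1 : signSet k l a j = false := signSet_eq_false (by omega)
      have e2 : signSet k l a (k + l - j) = false := signSet_eq_false (by omega)
      have : pairObs (k + l) (if a = b then 1 else 0) (signSet k l a) (List.finRange n) j = 1 := by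
        unfold pairObs
        rw [e1, e2]
        simp [xzFactor, phaseConj_one]
      rw [this]
      simp [hj, hj.trans h, hj.ne, (hj.trans h).ne, pauliZ_mul_self]
    · have e0 : (j : ℕ) + l - j = l := by omega
      have e1 : signSet j l a j = true := signSet_eq_true (by omega)
      have e2 : pairObs (j + l) (if a = b then 1 else 0) (signSet j l a) (List.finRange n) j =
          xzFactor true (signSet j l a l) := by
        rw [pairObs, if_neg (by omega), if_pos, e0, e1]
        rw [e0, hmem]
        exact ⟨hn, by omega, hv⟩
      rw [e2]
      simp only [lt_self_iff_false, if_false, if_true, h, hck]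
      by_cases ha : a = 1
      · subst ha
        rw [signSet_eq_false (by simp; omega)]
        simp [xzFactor, pauliY_mul_pauliZ]
        ext x y; fin_cases x <;> fin_cases y <;> simp [pauliX, pauliY, pauliZ]
      · have ha0 : a = 0 := by omega
        subst ha0
        rw [signSet_eq_true (by simp; omega)]
        simp [xzFactor]
    · have hjv : (k : ℕ) < j := hj
      rcases lt_trichotomy j l with hjl | rfl | hjl
      · have hjlv : (j : ℕ) < l := hjl
        have : pairObs (k + l) (if a = b then 1 else 0) (signSet k l a) (List.finRange n) j =
            pauliZ := by
          unfold pairObs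
          simp only [hmem]
          have hin : ∀ q : ℕ, (k : ℕ) < q → q < l → k + l ≤ 2 * q → signSet k l a q = true :=
            fun q h1 h2 h3 => signSet_eq_true (by omega)
          have hout : ∀ q : ℕ, (k : ℕ) < q → q < l → 2 * q < k + l → signSet k l a q = false :=
            fun q h1 h2 h3 => signSet_eq_false (by omega)
          rcases lt_trichotomy (2 * (j : ℕ)) (k + l) with h1 | h1 | h1
          · rw [if_neg (by omega), if_pos (by omega), hout j (by omega) (by omega) h1,
              hin _ (by omega) (by omega) (by omega)]
            simp [xzFactor]
          · rw [if_neg (by omega), if_neg (by omega), hin j (by omega) (by omega) (by omega)]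
            simp
          · rw [if_pos ⟨List.mem_finRange j, by omega, by omega⟩,
              hin j (by omega) (by omega) (by omega), hout _ (by omega) (by omega) (by omega)]
            simp [xzFactor, phaseConj_Z]
        rw [this]
        simp [hj.not_gt, hj.ne', hjl, hjl.ne]
      · have e0 : (k : ℕ) + j - j = k := by omega
        have e1 : signSet k j a k = true := signSet_eq_true (by omega)
        have e2 : pairObs (k + j) (if a = b then 1 else 0) (signSet k j a) (List.finRange n) j =
            phaseConj (if a = b then 1 else 0) (xzFactor true (signSet k j a j)) := by
          rw [pairObs, if_pos ⟨List.mem_finRange j, by omega, by omega⟩, e0, e1]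
        rw [e2]
        simp only [lt_self_iff_false, if_false, if_true, hj.not_gt, hj.ne', hcl, one_mul]
        by_cases ha : a = 1
        · subst ha
          rw [signSet_eq_false (by simp; omega)]
          by_cases hb : b = 1
          · subst hb
            ext x y; fin_cases x <;> fin_cases y <;>
              simp [xzFactor, phaseConj, pauliX, pauliY, Matrix.mul_apply,
                Matrix.conjTranspose_apply]
          · have hb0 : b = 0 := by omega
            subst hb0
            simp [xzFactor, phaseConj]
        · have ha0 : a = 0 := by omega
          subst ha0
          rw [signSet_eq_true (by simp; omega)]
          by_cases hb : b = 1
          · subst hb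
            ext x y; fin_cases x <;> fin_cases y <;>
              simp [xzFactor, phaseConj, pauliX, pauliY, pauliZ, Matrix.mul_apply]
          · have hb0 : b = 0 := by omega
            subst hb0
            ext x y; fin_cases x <;> fin_cases y <;>
              simp [xzFactor, phaseConj, pauliX, pauliZ, Matrix.mul_apply,
                Matrix.conjTranspose_apply]
      · have hjlv : (l : ℕ) < j := hjl
        have e1 : signSet k l a j = false := signSet_eq_false (by omega)
        have : pairObs (k + l) (if a = b then 1 else 0) (signSet k l a) (List.finRange n) j = 1 := by
          unfold pairObs
          rw [e1]
          by_cases h1 : (j : ℕ) ≤ (k : ℕ) + l ∧ (k : ℕ) + l - j < j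
          · rw [signSet_eq_false (q := k + l - j) (by omega)]
            simp [xzFactor, phaseConj_one]
          · rw [if_neg (fun h => h1 h.2), if_neg (by omega)]
            simp
        rw [this]
        simp [hj.not_gt, hj.ne', hjl.not_gt, hjl.ne']
  · have h1 : majorana (k, 1) * majorana (k, 0) = -(Complex.I • onQubit k pauliZ) := by
      rw [majorana_anticomm (by simp), majorana_pair]
    rw [h1, ← neg_smul, smul_smul, onQubit]
    have h3 : -Complex.I * (if ((1 : Fin 2) = 1 ∧ (0 : Fin 2) = 1) ∨ k = k then -1 else 1) *
        -Complex.I = 1 := by simp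
    rw [h3, one_smul]
    congr 1
    funext j
    have hs : ∀ q : ℕ, q ≠ k → signSet k k ((1 : Fin 2) : ℕ) q = false := fun q hq =>
      signSet_eq_false (by simp; omega)
    have hp : ∀ q : ℕ, q = k → signSet k k ((1 : Fin 2) : ℕ) q = true := fun q hq =>
      signSet_eq_true (by simp; omega)
    unfold pairObs
    by_cases hj : j = k
    · subst hj
      rw [if_neg (by omega), if_neg (by omega), hp _ rfl]
      simp
    · have hjv : (j : ℕ) ≠ k := fun e => hj (Fin.ext e)
      rw [hs j hjv, if_neg hj]
      by_cases hjs : (j : ℕ) ≤ k + k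
      · rw [hs (k + k - j) (by omega)]
        simp [xzFactor, phaseConj_one]
      · rw [if_neg (by omega), if_neg (by omega)]
        simp

end FreeFermion

/-! ### Outcome distributions, expectations and concentration. -/

open FreeFermion
open scoped Matrix

namespace FreeFermion

variable {n : ℕ}

/-! ### Outcome distributions -/

/-- The conjugation formula with no Z at all: the identity is mapped to the identity. -/
theorem bellCircuit_unitary (s τ : ℕ) :
    (bellCircuit n s τ).matᴴ * (bellCircuit n s τ).mat = 1 := by
  have h := pairBlocks_conj s τ (fun _ => false) (List.finRange n) (List.nodup_finRange n)
  have h1 : pairObs s τ (fun _ => false) (List.finRange n) = fun _ : Fin n => 1 := by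
    funext q
    simp [pairObs, xzFactor, phaseConj_one]
  simpa [h1, tensor_one, bellCircuit] using h

/-- The probability of an outcome of a circuit. -/
noncomputable def circuitProb (ρ : Op n) (C : Circuit n) (x : Basis n) : ℝ :=
  ((C.mat * ρ * C.matᴴ) x x).re

theorem GaussianForm.circuitProb_nonneg {b : OrthonormalBasis (Maj n) ℝ (MajSpace n)}
    {lam : Fin n → ℝ} {U ρ : Op n} (h : GaussianForm b lam U ρ) (C : Circuit n) (x : Basis n) :
    0 ≤ circuitProb ρ C x := by
  set p : Basis n → ℝ := fun x => ∏ j, (1 + lam j * (if x j = 0 then 1 else -1)) / 2 with hp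
  have hp0 : ∀ x, 0 ≤ p x := fun x => Finset.prod_nonneg fun j _ => by
    have := abs_le.1 (h.bound j)
    split_ifs <;> linarith
  have hD : diagState lam = Matrix.diagonal fun x => (p x : ℂ) := by
    ext x y
    rw [diagState_apply, Matrix.diagonal_apply]
  have e : C.mat * ρ * C.matᴴ = (C.mat * U) * diagState lam * (C.mat * U)ᴴ := by
    rw [h.eq, Matrix.conjTranspose_mul]; simp only [mul_assoc]
  rw [circuitProb, e, hD]
  generalize C.mat * U = V
  rw [Matrix.mul_apply, Complex.re_sum]
  refine Finset.sum_nonneg fun y _ => ?_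
  rw [Matrix.mul_diagonal, Matrix.conjTranspose_apply, mul_right_comm, Complex.star_def,
    Complex.mul_conj, ← Complex.ofReal_mul, Complex.ofReal_re]
  exact mul_nonneg (Complex.normSq_nonneg _) (hp0 y)

theorem GaussianForm.trace_eq_one {b : OrthonormalBasis (Maj n) ℝ (MajSpace n)}
    {lam : Fin n → ℝ} {U ρ : Op n} (h : GaussianForm b lam U ρ) : ρ.trace = 1 := by
  have hUU : Uᴴ * U = 1 := Matrix.mem_unitaryGroup_iff'.1 h.unitary
  rw [h.eq, Matrix.trace_mul_comm, ← mul_assoc, hUU, one_mul, trace_diagState]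

theorem GaussianForm.sum_circuitProb {b : OrthonormalBasis (Maj n) ℝ (MajSpace n)}
    {lam : Fin n → ℝ} {U ρ : Op n} (h : GaussianForm b lam U ρ) (s τ : ℕ) :
    ∑ x, circuitProb ρ (bellCircuit n s τ) x = 1 := by
  unfold circuitProb
  rw [← Complex.re_sum]
  change Complex.re (Matrix.trace (_ : Op n)) = 1
  rw [Matrix.trace_mul_comm, ← mul_assoc, bellCircuit_unitary, one_mul, h.trace_eq_one,
    Complex.one_re]

/-- The sign computed from the outcomes of the qubits in `signSet`. -/
def signValue (k l a : ℕ) (x : Basis n) : ℤ :=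
  ∏ q : Fin n, if signSet k l a q then 1 - 2 * ((x q : ℕ) : ℤ) else 1

theorem signValue_sq (k l a : ℕ) (x : Basis n) : signValue k l a x = 1 ∨ signValue k l a x = -1 := by
  refine Finset.prod_induction _ (fun z : ℤ => z = 1 ∨ z = -1) ?_ (Or.inl rfl) fun q _ => ?_
  · rintro _ _ (rfl | rfl) (rfl | rfl) <;> simp
  · generalize x q = c
    split_ifs
    · fin_cases c <;> simp
    · simp

/-- The sign is the eigenvalue of a product of Z's, and its expectation after the circuit is that of
the pulled back observable, namely a correlation. -/
theorem GaussianForm.sum_circuitProb_mul_signValue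
    {B : OrthonormalBasis (Maj n) ℝ (MajSpace n)} {lam : Fin n → ℝ} {U ρ : Op n}
    (hρ : GaussianForm B lam U ρ) {k l : Fin n} {a b : Fin 2}
    (h : k < l ∨ k = l ∧ a = 1 ∧ b = 0) :
    ∑ x, circuitProb ρ (bellCircuit n (k + l) (if a = b then 1 else 0)) x *
        (signValue k l a x : ℝ) =
      (if (a = 1 ∧ b = 1) ∨ k = l then -1 else 1) * skewForm B lam (k, a) (l, b) := by
  set C := bellCircuit n (k + l) (if a = b then 1 else 0) with hC
  set D : Op n := tensor (fun q => if signSet k l a q then pauliZ else 1) with hD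
  have hDd : D = Matrix.diagonal fun x => ((signValue k l a x : ℝ) : ℂ) := by
    ext x y
    rw [hD, tensor_apply, Matrix.diagonal_apply]
    split_ifs with hxy
    · subst hxy
      rw [signValue]
      push_cast
      refine Finset.prod_congr rfl fun q _ => ?_
      generalize x q = c
      split_ifs <;> fin_cases c <;> norm_num [pauliZ]
    · obtain ⟨j, hj⟩ := Function.ne_iff.1 hxy
      refine Finset.prod_eq_zero (Finset.mem_univ j) ?_
      split_ifs
      · revert hj
        generalize x j = c
        generalize y j = d
        fin_cases c <;> fin_cases d <;> simp [pauliZ]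
      · exact Matrix.one_apply_ne hj
  have hne : ((k, a) : Maj n) ≠ (l, b) := by
    rintro ⟨⟩
    rcases h with h | ⟨-, h1, h2⟩
    · exact lt_irrefl _ h
    · simp [h1] at h2
  have key : (D * (C.mat * ρ * C.matᴴ)).trace =
      (((if (a = 1 ∧ b = 1) ∨ k = l then -1 else 1) * skewForm B lam (k, a) (l, b) : ℝ) : ℂ) := by
    have e : (D * (C.mat * ρ * C.matᴴ)).trace = (C.matᴴ * D * C.mat * ρ).trace := by
      rw [← mul_assoc, Matrix.trace_mul_comm]
      simp only [mul_assoc]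
    rw [e, hD, hC, bellCircuit_conj h, Matrix.smul_mul, Matrix.trace_smul, smul_eq_mul,
      Complex.ofReal_mul, ← hρ.correlationMatrix_eq, correlationMatrix_apply_of_ne _ hne]
    split_ifs <;> simp
  have h2 := congrArg Complex.re key
  rw [Complex.ofReal_re] at h2
  rw [← h2, hDd, Matrix.trace, Complex.re_sum]
  refine Finset.sum_congr rfl fun x _ => ?_
  rw [Matrix.diag_apply, Matrix.diagonal_mul, Complex.re_ofReal_mul, mul_comm]
  rfl

/-! ### Concentration -/

/-- Follows from `exp x ≤ 1 + x + x²`. It bounds the moment generating function of a centred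
variable without a second moment: the linear term averages to zero. -/
theorem exp_le_add_exp_sq {x : ℝ} (hx : |x| ≤ 1) : Real.exp x ≤ x + Real.exp (x ^ 2) := by
  have h1 := (abs_le.1 (Real.abs_exp_sub_one_sub_id_le hx)).2
  have h2 := Real.add_one_le_exp (x ^ 2)
  linarith

section Concentration

variable {N : ℕ} {α : Type*} [Fintype α]

theorem sum_prod_eq_prod_sum (f : Fin N → α → ℝ) :
    ∑ x : Fin N → α, ∏ i, f i (x i) = ∏ i, ∑ y, f i y := by
  classical
  rw [Finset.prod_univ_sum, Fintype.piFinset_univ]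

-- Chernoff's method: the indicator is dominated by an exponential, which factors over the
-- independent coordinates; coordinates outside `T` contribute the factor `1`.
open Classical in
theorem sum_upper_tail_le {p g : Fin N → α → ℝ} (hp : ∀ i y, 0 ≤ p i y) (hp1 : ∀ i, ∑ y, p i y = 1)
    (hg : ∀ i, ∑ y, p i y * g i y = 0) (T : Finset (Fin N)) (hg2 : ∀ i y, |g i y| ≤ 2)
    {t : ℝ} (ht : 0 ≤ t) (ht1 : t ≤ 1) :
    (∑ x : Fin N → α, if T.card * t < ∑ i ∈ T, g i (x i) then ∏ i, p i (x i) else 0) ≤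
      Real.exp (-(T.card * t ^ 2 / 16)) := by
  -- Minimizes `4 s ^ 2 - s t`, the exponent per coordinate, with minimum `-t ^ 2 / 16`; it also
  -- keeps the argument of the exponential within `[-1, 1]`.
  set s : ℝ := t / 8 with hs
  have hs0 : 0 ≤ s := by positivity
  have mgf : ∀ i, ∑ y, p i y * Real.exp (s * g i y) ≤ Real.exp (4 * s ^ 2) := fun i => by
    calc ∑ y, p i y * Real.exp (s * g i y)
        ≤ ∑ y, (s * (p i y * g i y) + p i y * Real.exp (4 * s ^ 2)) := by
          refine Finset.sum_le_sum fun y _ => ?_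
          have h1 : |s * g i y| ≤ 1 := by
            rw [abs_mul, abs_of_nonneg hs0]
            nlinarith [hg2 i y, abs_nonneg (g i y)]
          have h2 := exp_le_add_exp_sq h1
          have h3 : (s * g i y) ^ 2 ≤ 4 * s ^ 2 := by
            have := sq_le_sq' (by linarith [(abs_le.1 (hg2 i y)).1]) (abs_le.1 (hg2 i y)).2
            rw [mul_pow]
            nlinarith [sq_nonneg s]
          have h4 := Real.exp_le_exp.2 h3
          have := mul_le_mul_of_nonneg_left (h2.trans (add_le_add_right h4 _)) (hp i y)
          linarith
      _ = Real.exp (4 * s ^ 2) := by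
          rw [Finset.sum_add_distrib, ← Finset.mul_sum, hg, ← Finset.sum_mul, hp1]
          ring
  have hfac : ∀ x : Fin N → α, (if T.card * t < ∑ i ∈ T, g i (x i) then ∏ i, p i (x i) else 0) ≤
      Real.exp (-(s * (T.card * t))) *
        ∏ i, (p i (x i) * if i ∈ T then Real.exp (s * g i (x i)) else 1) := fun x => by
    have hP : 0 ≤ ∏ i, p i (x i) := Finset.prod_nonneg fun i _ => hp i _
    have e : ∏ i, (if i ∈ T then Real.exp (s * g i (x i)) else 1) =
        Real.exp (s * ∑ i ∈ T, g i (x i)) := by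
      rw [Finset.prod_ite_mem, Finset.univ_inter, Finset.mul_sum, Real.exp_sum]
    rw [Finset.prod_mul_distrib, e, mul_left_comm, ← Real.exp_add]
    split_ifs with h
    · refine le_mul_of_one_le_right hP (Real.one_le_exp ?_)
      have := mul_le_mul_of_nonneg_left h.le hs0
      linarith
    · positivity
  refine (Finset.sum_le_sum fun x _ => hfac x).trans ?_
  rw [← Finset.mul_sum, sum_prod_eq_prod_sum
    (fun i y => p i y * if i ∈ T then Real.exp (s * g i y) else 1)]
  have hprod : ∏ i, ∑ y, (p i y * if i ∈ T then Real.exp (s * g i y) else 1) ≤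
      Real.exp (T.card * (4 * s ^ 2)) := by
    have h1 : ∏ i : Fin N, (if i ∈ T then Real.exp (4 * s ^ 2) else 1) =
        Real.exp (T.card * (4 * s ^ 2)) := by
      rw [Finset.prod_ite_mem, Finset.univ_inter, Finset.prod_const, ← Real.exp_nat_mul]
    rw [← h1]
    refine Finset.prod_le_prod (fun i _ => Finset.sum_nonneg fun y _ => mul_nonneg (hp i y) ?_)
      fun i _ => ?_
    · split_ifs <;> positivity
    · split_ifs with hi
      · exact mgf i
      · simp [hp1]
  refine (mul_le_mul_of_nonneg_left hprod (Real.exp_pos _).le).trans_eq ?_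
  rw [← Real.exp_add]
  congr 1
  rw [hs]; ring

open Classical in
/-- A two-sided tail bound for sums of independent random variables. -/
theorem sum_tail_le {p g : Fin N → α → ℝ} (hp : ∀ i y, 0 ≤ p i y) (hp1 : ∀ i, ∑ y, p i y = 1)
    (T : Finset (Fin N)) (hg : ∀ i ∈ T, ∑ y, p i y * g i y = 0) (hg2 : ∀ i y, |g i y| ≤ 2)
    {t : ℝ} (ht : 0 ≤ t) (ht1 : t ≤ 1) :
    (∑ x : Fin N → α, if T.card * t < |∑ i ∈ T, g i (x i)| then ∏ i, p i (x i) else 0) ≤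
      2 * Real.exp (-(T.card * t ^ 2 / 16)) := by
  -- The variables are centred on `T` only, so they are replaced by zero elsewhere.
  set g' : Fin N → α → ℝ := fun i y => if i ∈ T then g i y else 0 with hg'
  have e : ∀ x : Fin N → α, ∑ i ∈ T, g' i (x i) = ∑ i ∈ T, g i (x i) := fun x =>
    Finset.sum_congr rfl fun i hi => by simp [hg', hi]
  have hz : ∀ i, ∑ y, p i y * g' i y = 0 := fun i => by
    by_cases hi : i ∈ T
    · simpa [hg', hi] using hg i hi
    · simp [hg', hi]
  have hb : ∀ i y, |g' i y| ≤ 2 := fun i y => by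
    simp only [hg']; split_ifs
    · exact hg2 i y
    · simp
  have u1 := sum_upper_tail_le hp hp1 hz T hb ht ht1
  have u2 := sum_upper_tail_le (g := fun i y => -g' i y) hp hp1 (fun i => by simp [hz]) T
    (fun i y => by rw [abs_neg]; exact hb i y) ht ht1
  simp only [Finset.sum_neg_distrib, e] at u1 u2
  rw [two_mul]
  refine le_trans ?_ (add_le_add u1 u2)
  rw [← Finset.sum_add_distrib]
  refine Finset.sum_le_sum fun x _ => ?_
  have hP : 0 ≤ ∏ i, p i (x i) := Finset.prod_nonneg fun i _ => hp i _
  by_cases h : (T.card : ℝ) * t < |∑ i ∈ T, g i (x i)|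
  · rw [if_pos h]
    rcases lt_abs.1 h with h | h
    · rw [if_pos h]
      split_ifs <;> linarith
    · rw [if_pos h]
      split_ifs <;> linarith
  · rw [if_neg h]
    split_ifs <;> linarith

end Concentration

end FreeFermion

/-! ### Batches of repetitions and the probability that all estimates are accurate. -/

open FreeFermion
open scoped Matrix

namespace FreeFermion

variable {n : ℕ}

/-! ### The measurement -/

/-- The list of measurement circuits: `m` copies of each Bell circuit. -/
def measurement (n m : ℕ) : List (Circuit n) :=
  (List.range (4 * n * m)).map fun i => bellCircuit n (i / m / 2) (i / m % 2)

theorem measurement_length (n m : ℕ) : (measurement n m).length = 4 * n * m := by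
  simp [measurement]

theorem measurement_get {m : ℕ} (i : Fin (measurement n m).length) :
    (measurement n m).get i = bellCircuit n (i / m / 2) (i / m % 2) := by
  show (measurement n m)[(i : ℕ)] = _
  simp only [measurement, List.getElem_map, List.getElem_range]

/-- Links the printed tokens with the circuit; the program's natural number test is the one in the
definition of the gates. -/
theorem pairBlock_code (s τ : ℕ) (l : Fin n) :
    (pairBlock s τ l).flatMap Gate.code = blockCode s τ l := by
  rw [pairBlock, blockCode]
  split_ifs with h1 h2
  · simp [Gate.code, Nat.cast_sub h1.1]
  · simp [Gate.code, Nat.cast_sub h1.1]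
  · rfl

theorem circuitsCode_measurement (n m : ℕ) : circuitsCode (measurement n m) =
    (List.range (4 * n * m)).flatMap fun i =>
      ((List.range n).flatMap fun l => blockCode (i / m / 2) (i / m % 2) l) ++ [4] := by
  rw [circuitsCode, measurement, List.flatMap_map]
  congr 1
  funext i
  congr 1
  rw [bellCircuit, List.flatMap_assoc, ← List.map_coe_finRange_eq_range, List.flatMap_map]
  congr 1
  funext l
  exact pairBlock_code _ _ l

theorem length_pairBlock_le (s τ : ℕ) (l : Fin n) : (pairBlock s τ l).length ≤ 3 := by
  rw [pairBlock]
  split_ifs <;> simp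

theorem quantumOps_measurement_le (n m : ℕ) :
    quantumOps (measurement n m) ≤ 4 * n * m * (4 * n) := by
  have h : ∀ i, (bellCircuit n (i / m / 2) (i / m % 2)).length + n ≤ 4 * n := fun i => by
    have : (bellCircuit n (i / m / 2) (i / m % 2)).length ≤ n * 3 := by
      rw [bellCircuit, List.length_flatMap]
      refine (List.sum_le_card_nsmul _ 3 ?_).trans (by simp)
      intro y hy
      obtain ⟨l, -, rfl⟩ := List.mem_map.1 hy
      exact length_pairBlock_le _ _ l
    omega
  rw [quantumOps, measurement, List.map_map]
  refine (List.sum_le_card_nsmul _ (4 * n) ?_).trans (by simp)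
  intro y hy
  obtain ⟨i, -, rfl⟩ := List.mem_map.1 hy
  exact h i

/-! ### Batches of repetitions -/

/-- The indices of the circuits in the batch `j`. -/
def batch (N m j : ℕ) : Finset (Fin N) := Finset.univ.filter fun i => (i : ℕ) / m = j

theorem sum_batch {M : Type*} [AddCommMonoid M] {N m j : ℕ} (hm : 0 < m) (h : (j + 1) * m ≤ N)
    (f : Fin N → M) (g : ℕ → M) (hfg : ∀ i : Fin N, f i = g i) :
    ∑ i ∈ batch N m j, f i = ∑ r ∈ Finset.range m, g (j * m + r) := by
  symm
  have hlt : ∀ r, r < m → j * m + r < N := fun r hr => by nlinarith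
  refine Finset.sum_bij' (fun r hr => ⟨j * m + r, hlt r (Finset.mem_range.1 hr)⟩)
    (fun i _ => (i : ℕ) % m) ?_ ?_ ?_ ?_ ?_
  · intro r hr
    rw [batch, Finset.mem_filter]
    refine ⟨Finset.mem_univ _, ?_⟩
    show (j * m + r) / m = j
    rw [mul_comm, Nat.mul_add_div hm, Nat.div_eq_of_lt (Finset.mem_range.1 hr), add_zero]
  · intro i _
    exact Finset.mem_range.2 (Nat.mod_lt _ hm)
  · intro r hr
    show (j * m + r) % m = r
    rw [mul_comm, Nat.mul_add_mod, Nat.mod_eq_of_lt (Finset.mem_range.1 hr)]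
  · intro i hi
    rw [batch, Finset.mem_filter] at hi
    refine Fin.ext ?_
    show j * m + (i : ℕ) % m = i
    rw [← hi.2, mul_comm]
    exact Nat.div_add_mod _ _
  · intro r hr
    rw [hfg]

theorem card_batch {N m j : ℕ} (hm : 0 < m) (h : (j + 1) * m ≤ N) : (batch N m j).card = m := by
  rw [Finset.card_eq_sum_ones, sum_batch hm h _ (fun _ => 1) fun _ => rfl]
  simp

/-- Signs square to one, so a qubit counted twice drops out; this is the exclusive or in `signSet`.
-/
theorem prod_range_signSet (k l a : ℕ) (hk : k < n) (f : ℕ → ℤ) (hf : ∀ q, f q = 1 ∨ f q = -1) :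
    (f k * ∏ q ∈ Finset.range n, if k + l ≤ 2 * q ∧ q + a ≤ l then f q else 1) =
      ∏ q ∈ Finset.range n, if signSet k l a q then f q else 1 := by
  have h1 : f k = ∏ q ∈ Finset.range n, if q = k then f q else 1 := by
    rw [Finset.prod_ite_eq' (Finset.range n) k f, if_pos (Finset.mem_range.2 hk)]
  conv_lhs => rw [h1]
  rw [← Finset.prod_mul_distrib]
  refine Finset.prod_congr rfl fun q _ => ?_
  by_cases c1 : q = k
  · by_cases c2 : k + l ≤ 2 * q ∧ q + a ≤ l
    · rw [if_pos c1, if_pos c2, signSet_eq_false (by tauto)]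
      rcases hf q with h | h <;> simp [h]
    · rw [if_pos c1, if_neg c2, signSet_eq_true (by tauto)]
      simp
  · by_cases c2 : k + l ≤ 2 * q ∧ q + a ≤ l
    · rw [if_neg c1, if_pos c2, signSet_eq_true (by tauto)]
      simp
    · rw [if_neg c1, if_neg c2, signSet_eq_false (by tauto)]
      simp

/-- The memory `I` holds the bits of the record `x`. -/
def HoldsRecord (I : Mem) {N : ℕ} (x : Fin N → Basis n) : Prop :=
  ∀ (i : Fin N) (q : Fin n), I (3 + (i : ℕ) * n + (q : ℕ)) = ((x i q : Fin 2) : ℕ)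

theorem rawEst_eq_sum_batch {I : Mem} {N m : ℕ} {x : Fin N → Basis n} (hI : HoldsRecord I x)
    (hm : 0 < m) (hN : 4 * n * m ≤ N) (k l : Fin n) (a b : Fin 2) :
    rawEst I n m k a l b =
      ∑ i ∈ batch N m (2 * (k + l) + if a = b then 1 else 0), signValue k l a (x i) := by
  set j : ℕ := 2 * (k + l) + if a = b then 1 else 0 with hj
  -- Since `k + l ≤ 2 n - 2`, the setting number is below `4 n`: the batch lies inside the record.
  have hj1 : j + 1 ≤ 4 * n := by
    have := k.2
    have := l.2
    rw [hj]; split_ifs <;> omega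
  have hjN : (j + 1) * m ≤ N := (Nat.mul_le_mul_right m hj1).trans hN
  have hab : ((a : ℕ) = (b : ℕ)) ↔ a = b := Fin.val_inj
  rw [sum_batch hm hjN _ (fun i => if h : i < N then signValue k l a (x ⟨i, h⟩) else 0)
    (fun i => by rw [dif_pos i.2]), rawEst]
  refine Finset.sum_congr rfl fun r hr => ?_
  have hlt : j * m + r < N := by
    have := Finset.mem_range.1 hr
    nlinarith
  rw [dif_pos hlt]
  simp only [hab, ← hj]
  have hbit := hI ⟨j * m + r, hlt⟩
  simp only at hbit
  set y := x ⟨j * m + r, hlt⟩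
  set f : ℕ → ℤ := fun q => if h : q < n then 1 - 2 * ((y ⟨q, h⟩ : ℕ) : ℤ) else 1 with hf
  have hfq : ∀ q : Fin n, f q = 1 - 2 * ((y q : ℕ) : ℤ) := fun q => by
    rw [hf]; simp
  have hIf : ∀ q, q < n → 1 - 2 * I (3 + ((j * m + r : ℕ) : ℤ) * n + q) = f q := fun q hq => by
    have := hbit ⟨q, hq⟩
    rw [this, hfq ⟨q, hq⟩]
  have h2 := prod_range_signSet (n := n) k l a k.2 f (fun q => by
    simp only [hf]
    split_ifs with h
    · generalize y ⟨q, h⟩ = c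
      fin_cases c <;> simp
    · exact Or.inl rfl)
  rw [signValue, hIf k k.2]
  have h3 : ∀ q ∈ Finset.range n, (if (k : ℕ) + l ≤ 2 * q ∧ q + a ≤ l then
      1 - 2 * I (3 + ((j * m + r : ℕ) : ℤ) * n + q) else 1) =
      if (k : ℕ) + l ≤ 2 * q ∧ q + a ≤ l then f q else 1 := fun q hq => by
    rw [hIf q (Finset.mem_range.1 hq)]
  rw [Finset.prod_congr rfl h3, h2, Finset.prod_range]
  exact Finset.prod_congr rfl fun q _ => by rw [hfq]

/-! ### The probability of accurate estimates -/

/-- The sign relating a correlation to the measured parity. -/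
def corrSign (k l a b : ℕ) : ℤ := if (a = 1 ∧ b = 1) ∨ k = l then -1 else 1

/-- Union bound over the `4 n ^ 2` pairs of Majorana operators, each failing with probability at
most twice the Chernoff term. Pairs in the wrong order count as never failing. -/
theorem GaussianForm.one_sub_le_recordProb {B : OrthonormalBasis (Maj n) ℝ (MajSpace n)}
    {lam : Fin n → ℝ} {U ρ : Op n} (hρ : GaussianForm B lam U ρ) {m : ℕ} (hm : 0 < m) {t : ℝ}
    (ht : 0 ≤ t) (ht1 : t ≤ 1) (P : Outcomes (measurement n m) → Prop)
    (hP : ∀ x, (∀ (k l : Fin n) (a b : Fin 2), (k < l ∨ k = l ∧ a = 1 ∧ b = 0) →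
      |∑ i ∈ batch _ m (2 * (k + l) + if a = b then 1 else 0), (signValue k l a (x i) : ℝ) -
        m * (corrSign k l a b * skewForm B lam (k, a) (l, b))| ≤ m * t) → P x) :
    1 - 8 * n ^ 2 * Real.exp (-(m * t ^ 2 / 16)) ≤ recordProb ρ (measurement n m) P := by
  classical
  set p : Fin (measurement n m).length → Basis n → ℝ :=
    fun i y => circuitProb ρ ((measurement n m).get i) y with hp
  have hp0 : ∀ i y, 0 ≤ p i y := fun i y => hρ.circuitProb_nonneg _ _
  have hp1 : ∀ i, ∑ y, p i y = 1 := fun i => by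
    simp only [hp, measurement_get]
    exact hρ.sum_circuitProb _ _
  set bad : Maj n × Maj n → Outcomes (measurement n m) → Prop := fun c x =>
    (c.1.1 < c.2.1 ∨ c.1.1 = c.2.1 ∧ c.1.2 = 1 ∧ c.2.2 = 0) ∧
      m * t < |∑ i ∈ batch _ m (2 * (c.1.1 + c.2.1) + if c.1.2 = c.2.2 then 1 else 0),
        (signValue c.1.1 c.2.1 c.1.2 (x i) : ℝ) -
        m * (corrSign c.1.1 c.2.1 c.1.2 c.2.2 * skewForm B lam c.1 c.2)| with hbad
  have hone : ∀ c, (∑ x, if bad c x then ∏ i, p i (x i) else 0) ≤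
      2 * Real.exp (-(m * t ^ 2 / 16)) := fun c => by
    obtain ⟨⟨k, a⟩, ⟨l, b⟩⟩ := c
    by_cases hv : k < l ∨ k = l ∧ a = 1 ∧ b = 0
    · set T := batch (measurement n m).length m (2 * (k + l) + if a = b then 1 else 0) with hT
      have hj : 2 * ((k : ℕ) + l) + (if a = b then 1 else 0) + 1 ≤ 4 * n := by
        have := k.2
        have := l.2
        split_ifs <;> omega
      have hcard : T.card = m := card_batch hm
        ((Nat.mul_le_mul_right m hj).trans (measurement_length n m).ge)
      set c : ℝ := corrSign k l a b * skewForm B lam (k, a) (l, b) with hc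
      have hmean := hρ.sum_circuitProb_mul_signValue hv
      have hce : c = (if (a = 1 ∧ b = 1) ∨ k = l then -1 else 1) *
          skewForm B lam (k, a) (l, b) := by
        have h1 : ((a : ℕ) = 1 ∧ (b : ℕ) = 1) ∨ (k : ℕ) = l ↔ (a = 1 ∧ b = 1) ∨ k = l := by
          rw [Fin.val_inj, ← Fin.val_inj (a := a), ← Fin.val_inj (a := b)]; rfl
        rw [hc, corrSign]
        simp only [h1]
        push_cast
        rfl
      rw [← hce] at hmean
      have hs : ∀ y : Basis n, |(signValue k l a y : ℝ)| ≤ 1 := fun y => by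
        rcases signValue_sq k l a y with h | h <;> simp [h]
      -- The correlation is the mean of a sign, so the centred sign is bounded by `2` as the tail
      -- bound requires.
      have hc1 : |c| ≤ 1 := by
        rw [← hmean, ← hρ.sum_circuitProb (k + l) (if a = b then 1 else 0)]
        refine (Finset.abs_sum_le_sum_abs _ _).trans (Finset.sum_le_sum fun y _ => ?_)
        have h0 := hρ.circuitProb_nonneg (bellCircuit n (k + l) (if a = b then 1 else 0)) y
        rw [abs_mul, abs_of_nonneg h0]
        exact mul_le_of_le_one_right h0 (hs y)
      have htail := sum_tail_le (g := fun _ y => (signValue k l a y : ℝ) - c) hp0 hp1 T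
        (fun i hi => by
          have hi' : (i : ℕ) / m = 2 * (k + l) + if a = b then 1 else 0 :=
            (Finset.mem_filter.1 hi).2
          have e1 : (i : ℕ) / m / 2 = k + l := by rw [hi']; split_ifs <;> omega
          have e2 : (i : ℕ) / m % 2 = if a = b then 1 else 0 := by rw [hi']; split_ifs <;> omega
          have h1 := hp1 i
          simp only [hp, measurement_get, e1, e2] at h1 ⊢
          simp only [mul_sub, Finset.sum_sub_distrib]
          rw [hmean, ← Finset.sum_mul, h1]
          ring)
        (fun _ y => by
          have h1 := abs_le.1 (hs y)
          have h2 := abs_le.1 hc1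
          rw [abs_le]; constructor <;> linarith) ht ht1
      rw [hcard] at htail
      refine le_of_eq_of_le (Finset.sum_congr rfl fun x _ => ?_) htail
      refine if_congr ?_ rfl rfl
      rw [Finset.sum_sub_distrib, Finset.sum_const, hcard, nsmul_eq_mul]
      simp only [hbad, hv, true_and]
      rfl
    · have : ∀ x, ¬bad ((k, a), (l, b)) x := fun x h => hv h.1
      simp only [this, if_false, Finset.sum_const_zero]
      positivity
  have htot : ∑ x : Outcomes (measurement n m), ∏ i, p i (x i) = 1 := by
    rw [sum_prod_eq_prod_sum p]
    simp [hp1]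
  have hrec : recordProb ρ (measurement n m) P = ∑ x, if P x then ∏ i, p i (x i) else 0 := by
    rw [recordProb]
    exact Finset.sum_congr rfl fun x _ => by congr
  have hle : ∀ x : Outcomes (measurement n m), ∏ i, p i (x i) ≤
      (if P x then ∏ i, p i (x i) else 0) + ∑ c, if bad c x then ∏ i, p i (x i) else 0 :=
    fun x => by
    have hw : 0 ≤ ∏ i, p i (x i) := Finset.prod_nonneg fun i _ => hp0 _ _
    have hnn : ∀ c ∈ Finset.univ, 0 ≤ if bad c x then ∏ i, p i (x i) else 0 := fun c _ => by
      split_ifs <;> simp [hw]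
    by_cases hx : P x
    · rw [if_pos hx]
      exact le_add_of_nonneg_right (Finset.sum_nonneg hnn)
    · rw [if_neg hx, zero_add]
      obtain ⟨c, hc⟩ : ∃ c, bad c x := by
        by_contra hcon
        push Not at hcon
        refine hx (hP x fun k l a b hv => ?_)
        have := hcon ((k, a), (l, b))
        simp only [hbad, not_and, not_lt] at this
        exact this hv
      have := Finset.single_le_sum hnn (Finset.mem_univ c)
      rwa [if_pos hc] at this
  have hsum := Finset.sum_le_sum fun x (_ : x ∈ Finset.univ) => hle x
  rw [htot, Finset.sum_add_distrib, ← hrec, Finset.sum_comm] at hsum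
  have hall := Finset.sum_le_sum fun c (_ : c ∈ Finset.univ) => hone c
  rw [Finset.sum_const, nsmul_eq_mul] at hall
  have hcard : ((Finset.univ : Finset (Maj n × Maj n)).card : ℝ) = 4 * n ^ 2 := by
    rw [Finset.card_univ, Fintype.card_prod, Fintype.card_prod, Fintype.card_fin,
      Fintype.card_fin]
    push_cast
    ring
  rw [hcard] at hall
  linarith

end FreeFermion

/-! ### Bernstein approximation of the clipping function and functional calculus. -/

open FreeFermion
open scoped Matrix

namespace FreeFermion

/-! ### Bernstein approximation -/

/-- De Casteljau's scheme on `[-1, 1]`. -/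
noncomputable def deCasteljau (f : ℕ → ℝ) (z : ℝ) : ℕ → ℕ → ℝ
  | 0, k => f k
  | r + 1, k => (1 + z) / 2 * deCasteljau f z r (k + 1) + (1 - z) / 2 * deCasteljau f z r k

/-- For `z` in `[-1, 1]` each step is a convex combination, so the scheme is a positive operator
fixing constants. -/
theorem abs_deCasteljau_sub_le {f g : ℕ → ℝ} {z c : ℝ} (hz : |z| ≤ 1)
    (h : ∀ k, |f k - c| ≤ g k) (r k : ℕ) :
    |deCasteljau f z r k - c| ≤ deCasteljau g z r k := by
  have h1 := abs_le.1 hz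
  induction r generalizing k with
  | zero => exact h k
  | succ r ih =>
    have e : deCasteljau f z (r + 1) k - c = (1 + z) / 2 * (deCasteljau f z r (k + 1) - c) +
        (1 - z) / 2 * (deCasteljau f z r k - c) := by
      rw [deCasteljau]; ring
    rw [e, deCasteljau]
    refine (abs_add_le _ _).trans ?_
    rw [abs_mul, abs_mul, abs_of_nonneg (show 0 ≤ (1 + z) / 2 by linarith),
      abs_of_nonneg (show 0 ≤ (1 - z) / 2 by linarith)]
    exact add_le_add (mul_le_mul_of_nonneg_left (ih _) (by linarith))
      (mul_le_mul_of_nonneg_left (ih _) (by linarith))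

theorem deCasteljau_const (c z : ℝ) (r k : ℕ) : deCasteljau (fun _ => c) z r k = c := by
  induction r generalizing k with
  | zero => rfl
  | succ r ih => rw [deCasteljau, ih, ih]; ring

/-- The scheme is the expectation over a binomial walk with `r` steps of size `e` and success
probability `(1 + z) / 2`: the square of the mean plus the variance. -/
theorem deCasteljau_sq (A B e y z : ℝ) (r k : ℕ) :
    deCasteljau (fun k => A + B * (y + k * e) ^ 2) z r k =
      A + B * ((y + k * e + r * ((1 + z) / 2 * e)) ^ 2 + r * ((1 + z) * (1 - z) / 4 * e ^ 2)) := by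
  induction r generalizing k with
  | zero => simp [deCasteljau]
  | succ r ih => rw [deCasteljau, ih, ih]; push_cast; ring

/-- The nearest point of `[-1, 1]`. -/
noncomputable def clip (x : ℝ) : ℝ := max (-1) (min 1 x)

theorem abs_clip_le (x : ℝ) : |clip x| ≤ 1 :=
  abs_le.2 ⟨le_max_left _ _, max_le (by norm_num) (min_le_left _ _)⟩

theorem clip_eq_self {x : ℝ} (h : |x| ≤ 1) : clip x = x := by
  rw [clip, min_eq_right (abs_le.1 h).2, max_eq_right (abs_le.1 h).1]

theorem abs_clip_sub_clip_le (x y : ℝ) : |clip x - clip y| ≤ |x - y| := by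
  unfold clip
  refine (abs_max_sub_max_le_max _ _ _ _).trans ?_
  rw [sub_self, abs_zero]
  refine max_le (abs_nonneg _) ((abs_min_sub_min_le_max _ _ _ _).trans ?_)
  rw [sub_self, abs_zero]
  exact max_le (abs_nonneg _) le_rfl

/-- `clip` is Lipschitz, so the error is at most the mean of `|u|` with `u` the deviation times `w`.
The inequality `|u| ≤ η / 2 + u ^ 2 / (2 η)` reduces this to the second moment, and the walk,
centred at `z`, has variance `(1 - z ^ 2) / L`. -/
theorem abs_deCasteljau_clip_sub_le {L : ℕ} (hL : 1 ≤ L) {w η z : ℝ} (hη : 0 < η) (hz : |z| ≤ 1) :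
    |deCasteljau (fun k => clip (w * (2 * k - L) / L)) z L 0 - clip (w * z)| ≤
      η / 2 + w ^ 2 / (2 * η * L) := by
  have hL0 : (0 : ℝ) < L := by exact_mod_cast hL
  have h1 := abs_le.1 hz
  have h := abs_deCasteljau_sub_le (f := fun k => clip (w * (2 * k - L) / L))
    (g := fun k => η / 2 + w ^ 2 / (2 * η) * ((-1 - z) + k * (2 / L)) ^ 2) hz (c := clip (w * z))
    (fun k => by
      refine (abs_clip_sub_clip_le _ _).trans ?_
      have e : w * (2 * k - L) / L - w * z = w * ((-1 - z) + k * (2 / L)) := by field_simp; ring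
      rw [e]
      set u := w * ((-1 - z) + k * (2 / L)) with hu
      have e2 : w ^ 2 / (2 * η) * ((-1 - z) + k * (2 / L)) ^ 2 = |u| ^ 2 / (2 * η) := by
        rw [sq_abs, hu]; ring
      have e3 : η / 2 + |u| ^ 2 / (2 * η) - |u| = (|u| - η) ^ 2 / (2 * η) := by field_simp; ring
      have e4 : 0 ≤ (|u| - η) ^ 2 / (2 * η) := by positivity
      show |u| ≤ η / 2 + w ^ 2 / (2 * η) * ((-1 - z) + k * (2 / L)) ^ 2
      rw [e2]
      linarith) L 0
  rw [deCasteljau_sq] at h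
  refine h.trans ?_
  have e : w ^ 2 / (2 * η) * ((-1 - z + (0 : ℕ) * (2 / L) + L * ((1 + z) / 2 * (2 / L))) ^ 2 +
      L * ((1 + z) * (1 - z) / 4 * (2 / L) ^ 2)) = w ^ 2 / (2 * η * L) * (1 - z ^ 2) := by
    push_cast
    field_simp
    ring
  rw [e]
  have : w ^ 2 / (2 * η * L) * (1 - z ^ 2) ≤ w ^ 2 / (2 * η * L) :=
    mul_le_of_le_one_right (by positivity) (by nlinarith [sq_nonneg z])
  linarith

/-! ### Functions of symmetric matrices -/

section Matrices

variable {ι : Type*} [Fintype ι] [DecidableEq ι]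

theorem toEuclideanLin_apply_apply (M : Matrix ι ι ℝ) (x : EuclideanSpace ℝ ι) (i : ι) :
    Matrix.toEuclideanLin M x i = ∑ j, M i j * x j := by
  simp [Matrix.toLpLin_apply, Matrix.mulVec, dotProduct]

theorem sum_norm_sq_basis (M : Matrix ι ι ℝ) (u : OrthonormalBasis ι ℝ (EuclideanSpace ℝ ι)) :
    ∑ i, ‖Matrix.toEuclideanLin M (u i)‖ ^ 2 = ∑ i, ∑ j, M i j ^ 2 := by
  have h : ∀ i μ, Matrix.toEuclideanLin M (u i) μ =
      inner ℝ (WithLp.toLp 2 (M μ) : EuclideanSpace ℝ ι) (u i) := fun i μ => by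
    rw [toEuclideanLin_apply_apply, PiLp.inner_apply]
    simp [mul_comm]
  simp only [EuclideanSpace.norm_sq_eq, h]
  rw [Finset.sum_comm]
  refine Finset.sum_congr rfl fun μ _ => ?_
  rw [u.sum_sq_norm_inner_left, EuclideanSpace.norm_sq_eq]
  simp

/-- `F` is the function `f` of the symmetric matrix with eigenvectors `u` and eigenvalues `α`. -/
def ActsOn (u : OrthonormalBasis ι ℝ (EuclideanSpace ℝ ι)) (F : Matrix ι ι ℝ) (f : ι → ℝ) : Prop :=
  ∀ i, Matrix.toEuclideanLin F (u i) = f i • u i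

theorem exists_actsOn {A : Matrix ι ι ℝ} (hA : A.IsSymm) : ∃ u α, ActsOn u A α := by
  have hH : A.IsHermitian := by
    rw [Matrix.IsHermitian, Matrix.conjTranspose_eq_transpose_of_trivial]; exact hA
  refine ⟨hH.eigenvectorBasis, hH.eigenvalues, fun i => ?_⟩
  have := hH.mulVec_eigenvectorBasis i
  ext j
  rw [Matrix.toLpLin_apply]
  exact congrFun this j

theorem ActsOn.norm_le {u : OrthonormalBasis ι ℝ (EuclideanSpace ℝ ι)} {F : Matrix ι ι ℝ}
    {f : ι → ℝ} (h : ActsOn u F f) (hf : ∀ i, |f i| ≤ 1) (x : EuclideanSpace ℝ ι) :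
    ‖Matrix.toEuclideanLin F x‖ ≤ ‖x‖ := by
  have e : Matrix.toEuclideanLin F x = ∑ i, (f i * inner ℝ (u i) x) • u i := by
    conv_lhs => rw [← u.sum_repr' x]
    rw [map_sum]
    refine Finset.sum_congr rfl fun i _ => ?_
    rw [map_smul, h i, smul_smul, mul_comm]
  have e2 : ∀ i, inner ℝ (u i) (Matrix.toEuclideanLin F x) = f i * inner ℝ (u i) x := fun i => by
    rw [e, inner_sum, Finset.sum_eq_single i]
    · simp [inner_smul_right]
    · intro j _ hj
      simp [inner_smul_right, orthonormal_iff_ite.1 u.orthonormal, hj.symm]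
    · simp
  refine le_of_sq_le_sq ?_ (norm_nonneg _)
  rw [← u.sum_sq_norm_inner_right, ← u.sum_sq_norm_inner_right x]
  refine Finset.sum_le_sum fun i _ => ?_
  rw [e2, norm_mul]
  exact pow_le_pow_left₀ (by positivity) (mul_le_of_le_one_left (norm_nonneg _) (hf i)) 2

theorem inner_toEuclideanLin_of_isSymm {A : Matrix ι ι ℝ} (hA : A.IsSymm)
    (x y : EuclideanSpace ℝ ι) :
    inner ℝ x (Matrix.toEuclideanLin A y) = inner ℝ (Matrix.toEuclideanLin A x) y := by
  simp only [PiLp.inner_apply, toEuclideanLin_apply_apply, RCLike.inner_apply, conj_trivial,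
    Finset.sum_mul, Finset.mul_sum]
  rw [Finset.sum_comm]
  refine Finset.sum_congr rfl fun j _ => Finset.sum_congr rfl fun i _ => ?_
  rw [hA.apply]; ring

/-- If `F` is close to the function `clip` of `A`, then it is almost as close to a symmetric
contraction as `A` is. -/
theorem ActsOn.sum_sq_sub_le {u : OrthonormalBasis ι ℝ (EuclideanSpace ℝ ι)}
    {A F S : Matrix ι ι ℝ} {α f : ι → ℝ} (hA : ActsOn u A α) (hF : ActsOn u F f)
    (hS : S.IsSymm) (hS1 : ∀ x : EuclideanSpace ℝ ι, ‖Matrix.toEuclideanLin S x‖ ≤ ‖x‖) {η : ℝ}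
    (hf : ∀ i, |f i - clip (α i)| ≤ η) :
    ∑ i, ∑ j, (F i j - S i j) ^ 2 ≤
      2 * ∑ i, ∑ j, (A i j - S i j) ^ 2 + 2 * η ^ 2 * Fintype.card ι := by
  obtain ⟨w, β, hβ⟩ := exists_actsOn hS
  have hβ1 : ∀ j, |β j| ≤ 1 := fun j => by
    have := hS1 (w j)
    rwa [hβ j, norm_smul, w.orthonormal.1, mul_one] at this
  -- The Frobenius norm of `g(A) - S` in the two eigenbases: both sides become sums with the same
  -- nonnegative weights, so the comparison can be made for each pair of eigenvalues.
  have key : ∀ (M : Matrix ι ι ℝ) (g : ι → ℝ), ActsOn u M g →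
      ∑ i, ∑ j, (M i j - S i j) ^ 2 = ∑ i, ∑ j, (g i - β j) ^ 2 * inner ℝ (w j) (u i) ^ 2 :=
    fun M g hM => by
    have h1 := sum_norm_sq_basis (M - S) u
    simp only [Matrix.sub_apply] at h1
    rw [← h1]
    refine Finset.sum_congr rfl fun i _ => ?_
    rw [← w.sum_sq_norm_inner_right]
    refine Finset.sum_congr rfl fun j _ => ?_
    rw [map_sub, LinearMap.sub_apply, hM i, inner_sub_right, inner_smul_right,
      inner_toEuclideanLin_of_isSymm hS, hβ j, inner_smul_left, Real.norm_eq_abs, sq_abs]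
    simp only [conj_trivial]
    ring
  rw [key F f hF, key A α hA]
  have hone : ∑ i, ∑ j, inner ℝ (w j) (u i) ^ 2 = (Fintype.card ι : ℝ) := by
    have : ∀ i, ∑ j, inner ℝ (w j) (u i) ^ 2 = (1 : ℝ) := fun i => by
      have h2 := w.sum_sq_norm_inner_right (u i)
      rw [u.orthonormal.1, one_pow] at h2
      simpa [Real.norm_eq_abs, sq_abs] using h2
    simp [this]
  rw [← hone, Finset.mul_sum, Finset.mul_sum, ← Finset.sum_add_distrib]
  refine Finset.sum_le_sum fun i _ => ?_
  rw [Finset.mul_sum, Finset.mul_sum, ← Finset.sum_add_distrib]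
  refine Finset.sum_le_sum fun j _ => ?_
  -- `clip` is a contraction on the line and fixes the eigenvalues of `S`, hence does not increase
  -- distances to them.
  have h1 : |f i - β j| ≤ η + |α i - β j| := by
    have h2 := abs_clip_sub_clip_le (α i) (β j)
    rw [clip_eq_self (hβ1 j)] at h2
    calc |f i - β j| = |(f i - clip (α i)) + (clip (α i) - β j)| := by ring_nf
      _ ≤ _ := (abs_add_le _ _).trans (add_le_add (hf i) h2)
  have h3 : (f i - β j) ^ 2 ≤ 2 * (α i - β j) ^ 2 + 2 * η ^ 2 := by
    rw [← sq_abs (f i - β j), ← sq_abs (α i - β j)]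
    have := pow_le_pow_left₀ (abs_nonneg _) h1 2
    nlinarith [sq_nonneg (η - |α i - β j|)]
  nlinarith [mul_le_mul_of_nonneg_right h3 (sq_nonneg (inner ℝ (w j) (u i)))]

/-- An eigenvalue is at most the Frobenius norm. -/
theorem ActsOn.abs_le_of_entries {u : OrthonormalBasis ι ℝ (EuclideanSpace ℝ ι)}
    {A : Matrix ι ι ℝ} {α : ι → ℝ} (hA : ActsOn u A α) {m : ℝ} (hm : ∀ i j, |A i j| ≤ m) (i : ι) :
    |α i| ≤ Fintype.card ι * m := by
  have hm0 : 0 ≤ m := (abs_nonneg _).trans (hm i i)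
  have h1 := sum_norm_sq_basis A u
  have h2 : ‖Matrix.toEuclideanLin A (u i)‖ ^ 2 ≤ ∑ i, ‖Matrix.toEuclideanLin A (u i)‖ ^ 2 :=
    Finset.single_le_sum (fun i _ => sq_nonneg ‖Matrix.toEuclideanLin A (u i)‖)
      (Finset.mem_univ i)
  rw [h1, hA i, norm_smul, u.orthonormal.1, mul_one] at h2
  have h3 : ∑ i, ∑ j, A i j ^ 2 ≤ ∑ _i : ι, ∑ _j : ι, m ^ 2 :=
    Finset.sum_le_sum fun i _ => Finset.sum_le_sum fun j _ => by
      rw [← sq_abs]; exact pow_le_pow_left₀ (abs_nonneg _) (hm i j) 2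
  refine le_of_sq_le_sq ?_ (by positivity)
  refine (h2.trans h3).trans_eq ?_
  simp
  ring

/-- The transpose of a contraction is a contraction. -/
theorem norm_transpose_le {B : Matrix ι ι ℝ}
    (hB : ∀ x : EuclideanSpace ℝ ι, ‖Matrix.toEuclideanLin B x‖ ≤ ‖x‖) (x : EuclideanSpace ℝ ι) :
    ‖Matrix.toEuclideanLin Bᵀ x‖ ≤ ‖x‖ := by
  set y := Matrix.toEuclideanLin Bᵀ x with hy
  have h : inner ℝ y y = inner ℝ x (Matrix.toEuclideanLin B y) := by
    conv_lhs => enter [2]; rw [hy]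
    simp only [PiLp.inner_apply, toEuclideanLin_apply_apply, RCLike.inner_apply, conj_trivial,
      Finset.sum_mul, Finset.mul_sum, Matrix.transpose_apply]
    rw [Finset.sum_comm]
    exact Finset.sum_congr rfl fun j _ => Finset.sum_congr rfl fun i _ => by ring
  have h2 : ‖y‖ ^ 2 ≤ ‖x‖ * ‖y‖ := by
    rw [← real_inner_self_eq_norm_sq, h]
    exact (real_inner_le_norm _ _).trans (mul_le_mul_of_nonneg_left (hB y) (norm_nonneg _))
  by_contra hcon
  push Not at hcon
  nlinarith [norm_nonneg x]

end Matrices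

end FreeFermion

/-! ### The integer layers as functions of the symmetric matrix. -/

open FreeFermion
open scoped Matrix

namespace FreeFermion

variable {n : ℕ}

/-! ### Index computations -/

/-- The position of a Majorana operator in the usual order. -/
def majIdx (μ : Maj n) : ℕ := 2 * (μ.1 : ℕ) + (μ.2 : ℕ)

/-- The position of an index of the dilation. -/
def flatIdx (p : Fin 2 × Maj n) : ℕ := (p.1 : ℕ) * (2 * n) + majIdx p.2

theorem majIdx_lt (μ : Maj n) : majIdx μ < 2 * n := by
  have := μ.1.2
  have := μ.2.2
  rw [majIdx]; omega

theorem majIdx_div (μ : Maj n) : majIdx μ / 2 = μ.1 := by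
  have := μ.2.2
  rw [majIdx]; omega

theorem majIdx_mod (μ : Maj n) : majIdx μ % 2 = μ.2 := by
  have := μ.2.2
  rw [majIdx]; omega

theorem flatIdx_lt (p : Fin 2 × Maj n) : flatIdx p < 4 * n := by
  have h1 := majIdx_lt p.2
  have h2 := p.1.2
  have h3 : (p.1 : ℕ) * (2 * n) ≤ 1 * (2 * n) := Nat.mul_le_mul_right _ (by omega)
  rw [flatIdx]; omega

theorem flatIdx_div (p : Fin 2 × Maj n) : flatIdx p / (2 * n) = p.1 := by
  have h1 := majIdx_lt p.2
  rw [flatIdx, mul_comm, Nat.mul_add_div (by omega), Nat.div_eq_of_lt h1, add_zero]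

theorem flatIdx_mod (p : Fin 2 × Maj n) : flatIdx p % (2 * n) = majIdx p.2 := by
  rw [flatIdx, mul_comm, Nat.mul_add_mod, Nat.mod_eq_of_lt (majIdx_lt p.2)]

theorem flatIdx_injective : Function.Injective (flatIdx (n := n)) := fun p q h => by
  have h1 : (p.1 : ℕ) = q.1 := by rw [← flatIdx_div, ← flatIdx_div, h]
  have h2 : majIdx p.2 = majIdx q.2 := by rw [← flatIdx_mod, ← flatIdx_mod, h]
  have h3 : (p.2.1 : ℕ) = q.2.1 := by rw [← majIdx_div, ← majIdx_div, h2]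
  have h4 : (p.2.2 : ℕ) = q.2.2 := by rw [← majIdx_mod, ← majIdx_mod, h2]
  exact Prod.ext (Fin.ext h1) (Prod.ext (Fin.ext h3) (Fin.ext h4))

theorem sum_range_mul {M : Type*} [AddCommMonoid M] (a b : ℕ) (f : ℕ → M) :
    ∑ h ∈ Finset.range (a * b), f h = ∑ i ∈ Finset.range a, ∑ j ∈ Finset.range b, f (i * b + j) := by
  induction a with
  | zero => simp
  | succ a ih => rw [Nat.succ_mul, Finset.sum_range_add, ih, Finset.sum_range_succ]

theorem sum_flatIdx {M : Type*} [AddCommMonoid M] (f : ℕ → M) :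
    ∑ h ∈ Finset.range (4 * n), f h = ∑ p : Fin 2 × Maj n, f (flatIdx p) := by
  rw [show 4 * n = 2 * (n * 2) by ring, sum_range_mul, Fintype.sum_prod_type, Finset.sum_range]
  refine Finset.sum_congr rfl fun c _ => ?_
  rw [sum_range_mul, Fintype.sum_prod_type, Finset.sum_range]
  refine Finset.sum_congr rfl fun k _ => ?_
  rw [Finset.sum_range]
  refine Finset.sum_congr rfl fun a _ => ?_
  congr 1
  rw [flatIdx, majIdx]
  ring

/-! ### The layers of de Casteljau's scheme as matrices -/

/-- The matrix with the flat list of entries `S`. -/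
noncomputable def flatMat (n : ℕ) (S : ℕ → ℤ) : Matrix (Fin 2 × Maj n) (Fin 2 × Maj n) ℝ :=
  Matrix.of fun p q => (S (flatIdx p * (4 * n) + flatIdx q) : ℝ)

/-- The matrix of the node `k` in the layer `r`. -/
noncomputable def layerMat (n : ℕ) (S : ℕ → ℤ) (m L r k : ℕ) :
    Matrix (Fin 2 × Maj n) (Fin 2 × Maj n) ℝ :=
  flatMat n fun e => layers S n m L ((r * (L + 1) + k) * (4 * n * (4 * n)) + e)

theorem flat_div {i j c : ℕ} (hj : j < 4 * n) :
    (c * (4 * n * (4 * n)) + (i * (4 * n) + j)) / (4 * n) = c * (4 * n) + i := by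
  rw [show c * (4 * n * (4 * n)) + (i * (4 * n) + j) = 4 * n * (c * (4 * n) + i) + j by ring,
    Nat.mul_add_div (by omega), Nat.div_eq_of_lt hj, add_zero]

theorem flat_mod {i j c : ℕ} (hj : j < 4 * n) :
    (c * (4 * n * (4 * n)) + (i * (4 * n) + j)) % (4 * n) = j := by
  rw [show c * (4 * n * (4 * n)) + (i * (4 * n) + j) = 4 * n * (c * (4 * n) + i) + j by ring,
    Nat.mul_add_mod, Nat.mod_eq_of_lt hj]

theorem flat_row {i j c : ℕ} (hi : i < 4 * n) (hj : j < 4 * n) :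
    (c * (4 * n * (4 * n)) + (i * (4 * n) + j)) / (4 * n) % (4 * n) = i := by
  rw [flat_div hj, mul_comm, Nat.mul_add_mod, Nat.mod_eq_of_lt hi]

theorem layerMat_zero {S : ℕ → ℤ} {m L k : ℕ} (hL : 1 ≤ L) (hn : 1 ≤ n) (hk : k ≤ L) :
    layerMat n S m L 0 k = (clipNode n L k : ℝ) • 1 := by
  ext p q
  have hp := flatIdx_lt p
  have hq := flatIdx_lt q
  rw [layerMat, flatMat, Matrix.of_apply, zero_mul, zero_add, layers_eq hL hn, layerRec, if_neg,
    layerInit, flat_row hp hq, flat_mod hq]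
  · have h3 : (k * (4 * n * (4 * n)) + (flatIdx p * (4 * n) + flatIdx q)) / (4 * n * (4 * n)) =
        k := by
      rw [← Nat.div_div_eq_div_mul, flat_div hq, mul_comm, Nat.mul_add_div (by omega),
        Nat.div_eq_of_lt hp, add_zero]
    rw [h3, Matrix.smul_apply, Matrix.one_apply]
    by_cases h : p = q
    · subst h; simp
    · rw [if_neg (fun e => h (flatIdx_injective e)), if_neg h]; simp
  · have h1 : flatIdx p * (4 * n) + flatIdx q < 4 * n * (4 * n) := by nlinarith
    have h2 : k * (4 * n * (4 * n)) ≤ L * (4 * n * (4 * n)) := Nat.mul_le_mul_right _ hk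
    rw [not_le, add_mul L, one_mul]
    omega

/-- With `z = S / D` and `D = 4nm`, the right side is `2D` times a step of de Casteljau's scheme,
`(1 + z) / 2` applied to node `k + 1` plus `(1 - z) / 2` applied to node `k`. Clearing `2D` keeps
everything integral. -/
theorem layerMat_succ {S : ℕ → ℤ} {m L r k : ℕ} (hL : 1 ≤ L) (hn : 1 ≤ n) :
    layerMat n S m L (r + 1) k = ((4 * n * m : ℕ) : ℝ) • (layerMat n S m L r k +
      layerMat n S m L r (k + 1)) + flatMat n S * (layerMat n S m L r (k + 1) -
      layerMat n S m L r k) := by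
  ext p q
  have hp := flatIdx_lt p
  have hq := flatIdx_lt q
  set c := r * (L + 1) + k with hc
  set e := c * (4 * n * (4 * n)) + (flatIdx p * (4 * n) + flatIdx q) with he
  have h1 : ((r + 1) * (L + 1) + k) * (4 * n * (4 * n)) + (flatIdx p * (4 * n) + flatIdx q) =
      (L + 1) * (4 * n * (4 * n)) + e := by rw [he, hc]; ring
  have h2 : e + 4 * n * (4 * n) = (r * (L + 1) + (k + 1)) * (4 * n * (4 * n)) +
      (flatIdx p * (4 * n) + flatIdx q) := by rw [he, hc]; ring
  have h3 : e / (4 * n) % (4 * n) = flatIdx p := flat_row hp hq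
  have h4 : e - flatIdx p * (4 * n) = c * (4 * n * (4 * n)) + flatIdx q := by
    rw [he]; omega
  rw [Matrix.add_apply, Matrix.mul_apply, Matrix.smul_apply, Matrix.add_apply, layerMat, flatMat,
    Matrix.of_apply, h1, layers_eq hL hn, layerRec, if_pos (Nat.le_add_right _ _),
    Nat.add_sub_cancel_left, layerStep, h3, h4, sum_flatIdx]
  push_cast
  simp only [layerMat, flatMat, Matrix.of_apply, Matrix.sub_apply, smul_eq_mul]
  rw [h2]
  congr 1
  refine Finset.sum_congr rfl fun s _ => ?_
  congr 3
  · congr 1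
    rw [hc]; ring
  · congr 1
    rw [hc]; ring

theorem clipNode_cast {L : ℕ} (hL : 1 ≤ L) (k : ℕ) :
    (clipNode n L k : ℝ) = L * clip ((4 * n : ℕ) * (2 * k - L) / L) := by
  have hL0 : (0 : ℝ) < L := by exact_mod_cast hL
  rw [clipNode, clip, mul_max_of_nonneg _ _ hL0.le, mul_min_of_nonneg _ _ hL0.le,
    mul_div_cancel₀ _ hL0.ne']
  push_cast
  simp

/-- All layers are polynomials in the same symmetric matrix and share its eigenvectors. The factor
`L` comes from the integral nodes, and `2D` from each step. The condition `k + r ≤ L` excludes the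
nodes at the end of each layer, which are computed from a neighbouring layer and carry no meaning.
-/
theorem layerMat_actsOn {u : OrthonormalBasis (Fin 2 × Maj n) ℝ (EuclideanSpace ℝ (Fin 2 × Maj n))}
    {S : ℕ → ℤ} {m L : ℕ} (hL : 1 ≤ L) (hn : 1 ≤ n) (hm : 1 ≤ m) {α : Fin 2 × Maj n → ℝ}
    (hα : ActsOn u (flatMat n S) α) (r : ℕ) : ∀ k, k + r ≤ L → ActsOn u (layerMat n S m L r k)
      fun i => L * (2 * (4 * n * m : ℕ)) ^ r *
        deCasteljau (fun k => clip ((4 * n : ℕ) * (2 * k - L) / L)) (α i / (4 * n * m : ℕ)) r k := by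
  have hD : ((4 * n * m : ℕ) : ℝ) ≠ 0 := by
    have : 0 < 4 * n * m := by positivity
    exact_mod_cast this.ne'
  induction r with
  | zero =>
    intro k hk i
    rw [layerMat_zero hL hn (show k ≤ L by omega), clipNode_cast hL]
    simp [deCasteljau]
  | succ r ih =>
    intro k hk i
    have e1 := ih k (by omega) i
    have e2 := ih (k + 1) (by omega) i
    rw [layerMat_succ hL hn]
    simp only [deCasteljau]
    set D : ℝ := ((4 * n * m : ℕ) : ℝ) with hDdef
    have hmul : ∀ (A B : Matrix (Fin 2 × Maj n) (Fin 2 × Maj n) ℝ) x,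
        Matrix.toEuclideanLin (A * B) x = Matrix.toEuclideanLin A (Matrix.toEuclideanLin B x) :=
      fun A B x => by
      ext j
      simp [Matrix.toLpLin_apply, Matrix.mulVec_mulVec]
    rw [map_add, LinearMap.add_apply, map_smul, LinearMap.smul_apply, map_add,
      LinearMap.add_apply, hmul, map_sub, LinearMap.sub_apply, e1, e2, ← sub_smul, ← add_smul,
      map_smul, hα i, smul_smul, smul_smul, ← add_smul]
    congr 1
    field_simp
    ring

end FreeFermion

/-! ### The rounded estimate is a contraction and close to the true matrix. -/

open FreeFermion
open scoped Matrix

namespace FreeFermion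

variable {n : ℕ}

/-! ### The estimated correlation matrix -/

theorem sum_fin_two_prod {ι : Type*} [Fintype ι] (g : Fin 2 × ι → ℝ) :
    ∑ p, g p = ∑ μ, g (0, μ) + ∑ μ, g (1, μ) := by
  rw [Fintype.sum_prod_type, Fin.sum_univ_two]

/-- The symmetric dilation of an antisymmetric matrix. -/
noncomputable def dilMat (A : Matrix (Maj n) (Maj n) ℝ) :
    Matrix (Fin 2 × Maj n) (Fin 2 × Maj n) ℝ :=
  Matrix.of fun p q => (((p.1 : ℕ) : ℝ) - ((q.1 : ℕ) : ℝ)) * A p.2 q.2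

theorem dilMat_isSymm {A : Matrix (Maj n) (Maj n) ℝ} (hA : ∀ μ ν, A μ ν = -A ν μ) :
    (dilMat A).IsSymm := by
  ext p q
  rw [Matrix.transpose_apply, dilMat, Matrix.of_apply, Matrix.of_apply, hA]
  ring

/-- The dilation applies `A` to each half of the vector and exchanges the halves up to a sign. -/
theorem dilMat_norm_le {A : Matrix (Maj n) (Maj n) ℝ}
    (hA : ∀ x : MajSpace n, ‖Matrix.toEuclideanLin A x‖ ≤ ‖x‖)
    (x : EuclideanSpace ℝ (Fin 2 × Maj n)) : ‖Matrix.toEuclideanLin (dilMat A) x‖ ≤ ‖x‖ := by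
  have h := fun c : Fin 2 => pow_le_pow_left₀ (norm_nonneg _)
    (hA (WithLp.toLp 2 fun μ => x (c, μ))) 2
  have h0 := h 0
  have h1 := h 1
  simp only [EuclideanSpace.norm_sq_eq, toEuclideanLin_apply_apply] at h0 h1
  refine le_of_sq_le_sq ?_ (norm_nonneg _)
  simp only [EuclideanSpace.norm_sq_eq, Fintype.sum_prod_type (f := fun p : Fin 2 × Maj n => _),
    Fin.sum_univ_two, toEuclideanLin_apply_apply, dilMat, Matrix.of_apply]
  simp only [Fin.val_zero, Fin.val_one, Nat.cast_zero, Nat.cast_one, sub_self, zero_mul, zero_sub,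
    sub_zero, one_mul, neg_mul, Finset.sum_const_zero, zero_add, add_zero,
    Finset.sum_neg_distrib, norm_neg]
  linarith

/-- The lower left block of the approximated function of the dilation. -/
noncomputable def estBlock (n : ℕ) (S : ℕ → ℤ) (m L : ℕ) : Matrix (Maj n) (Maj n) ℝ :=
  Matrix.of fun μ ν =>
    (((L : ℝ) * (2 * (4 * n * m : ℕ)) ^ L)⁻¹ • layerMat n S m L L 0) (1, μ) (0, ν)

/-- The estimated correlation matrix. -/
noncomputable def estMat (n : ℕ) (S : ℕ → ℤ) (m L : ℕ) : Matrix (Maj n) (Maj n) ℝ :=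
  (1 / 2 : ℝ) • (estBlock n S m L - (estBlock n S m L)ᵀ)

theorem estMat_apply {S : ℕ → ℤ} {m L : ℕ} (μ ν : Maj n) : estMat n S m L μ ν =
    (outEntry (layers S n m L) n L (majIdx μ) (majIdx ν) : ℝ) /
      ((2 * L * (2 * (4 * n * m)) ^ L : ℕ) : ℝ) := by
  have h : ∀ μ ν : Maj n, layerMat n S m L L 0 (1, μ) (0, ν) =
      (layers S n m L (L * ((L + 1) * (4 * n * (4 * n))) +
        ((2 * n + majIdx μ) * (4 * n) + majIdx ν)) : ℝ) := fun μ ν => by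
    rw [layerMat, flatMat, Matrix.of_apply, flatIdx, flatIdx]
    congr 2
    simp only [Fin.val_zero, Fin.val_one]
    ring
  simp only [estMat, estBlock, Matrix.smul_apply, Matrix.sub_apply, Matrix.transpose_apply,
    Matrix.of_apply, h, outEntry, smul_eq_mul]
  push_cast
  ring

theorem estMat_antisymm {S : ℕ → ℤ} {m L : ℕ} (μ ν : Maj n) :
    estMat n S m L μ ν = -estMat n S m L ν μ := by
  simp only [estMat, Matrix.smul_apply, Matrix.sub_apply, Matrix.transpose_apply, smul_eq_mul]
  ring

variable {S : ℕ → ℤ} {m L : ℕ} {G : Maj n → Maj n → ℤ}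

theorem flatMat_eq_dilMat
    (hS : ∀ p q : Fin 2 × Maj n, S (flatIdx p * (4 * n) + flatIdx q) =
      (((p.1 : ℕ) : ℤ) - ((q.1 : ℕ) : ℤ)) * G p.2 q.2) :
    flatMat n S = dilMat (Matrix.of fun μ ν => (G μ ν : ℝ)) := by
  ext p q
  rw [flatMat, Matrix.of_apply, hS, dilMat, Matrix.of_apply, Matrix.of_apply]
  push_cast
  rfl

/-- The `4n` eigenvalues of a matrix with entries at most `m` lie in `[-4nm, 4nm]`, so after
division by `4nm` they are admissible arguments of the scheme. -/
theorem exists_actsOn_layers (hL : 1 ≤ L) (hn : 1 ≤ n) (hm : 1 ≤ m)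
    (hS : ∀ p q : Fin 2 × Maj n, S (flatIdx p * (4 * n) + flatIdx q) =
      (((p.1 : ℕ) : ℤ) - ((q.1 : ℕ) : ℤ)) * G p.2 q.2)
    (hG : ∀ μ ν, G μ ν = -G ν μ) (hGm : ∀ μ ν, |G μ ν| ≤ m) :
    ∃ u α, ActsOn u (flatMat n S) α ∧ (∀ i, |α i / (4 * n * m : ℕ)| ≤ 1) ∧
      ActsOn u (((L : ℝ) * (2 * (4 * n * m : ℕ)) ^ L)⁻¹ • layerMat n S m L L 0) fun i =>
        deCasteljau (fun k => clip ((4 * n : ℕ) * (2 * k - L) / L)) (α i / (4 * n * m : ℕ)) L 0 := by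
  have hsymm : (flatMat n S).IsSymm := by
    rw [flatMat_eq_dilMat hS]
    refine dilMat_isSymm fun μ ν => ?_
    rw [Matrix.of_apply, Matrix.of_apply, hG]
    push_cast
    rfl
  obtain ⟨u, α, hα⟩ := exists_actsOn hsymm
  have hD : (0 : ℝ) < (4 * n * m : ℕ) := by
    have : 0 < 4 * n * m := by positivity
    exact_mod_cast this
  refine ⟨u, α, hα, fun i => ?_, fun i => ?_⟩
  · rw [abs_div, abs_of_pos hD, div_le_one hD]
    refine (hα.abs_le_of_entries (m := m) (fun p q => ?_) i).trans_eq ?_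
    · rw [flatMat, Matrix.of_apply, hS]
      have h1 : |((p.1 : ℕ) : ℤ) - ((q.1 : ℕ) : ℤ)| ≤ 1 := by
        have := p.1.2
        have := q.1.2
        rw [abs_le]; omega
      have h2 : |(((p.1 : ℕ) : ℤ) - ((q.1 : ℕ) : ℤ)) * G p.2 q.2| ≤ m := by
        rw [abs_mul]
        exact (mul_le_of_le_one_left (abs_nonneg _) h1).trans (hGm _ _)
      exact_mod_cast h2
    · simp only [Fintype.card_prod, Fintype.card_fin]
      push_cast
      ring
  · have hL0 : (0 : ℝ) < L := by exact_mod_cast hL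
    rw [map_smul, LinearMap.smul_apply, layerMat_actsOn hL hn hm hα L 0 (by omega) i, smul_smul,
      ← mul_assoc, inv_mul_cancel₀ (by positivity), one_mul]

/-- The Bernstein polynomial stays in `[-1, 1]` because its nodes do, so the whole matrix is exactly
a contraction. Applied to vectors supported on the first half, it shows the same for the block. -/
theorem estBlock_norm_le (hL : 1 ≤ L) (hn : 1 ≤ n) (hm : 1 ≤ m)
    (hS : ∀ p q : Fin 2 × Maj n, S (flatIdx p * (4 * n) + flatIdx q) =
      (((p.1 : ℕ) : ℤ) - ((q.1 : ℕ) : ℤ)) * G p.2 q.2)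
    (hG : ∀ μ ν, G μ ν = -G ν μ) (hGm : ∀ μ ν, |G μ ν| ≤ m) (x : MajSpace n) :
    ‖Matrix.toEuclideanLin (estBlock n S m L) x‖ ≤ ‖x‖ := by
  obtain ⟨u, α, -, hα1, hQ⟩ := exists_actsOn_layers hL hn hm hS hG hGm
  set Q := ((L : ℝ) * (2 * (4 * n * m : ℕ)) ^ L)⁻¹ • layerMat n S m L L 0 with hQdef
  have hc := hQ.norm_le (fun i => by
    have := abs_deCasteljau_sub_le (f := fun k => clip ((4 * n : ℕ) * (2 * k - L) / L))
      (g := fun _ => 1) (c := 0) (hα1 i) (fun k => by rw [sub_zero]; exact abs_clip_le _) L 0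
    rwa [sub_zero, deCasteljau_const] at this)
  set X : EuclideanSpace ℝ (Fin 2 × Maj n) :=
    WithLp.toLp 2 fun p => if p.1 = 0 then x p.2 else 0 with hX
  have h := pow_le_pow_left₀ (norm_nonneg _) (hc X) 2
  refine le_of_sq_le_sq ?_ (norm_nonneg _)
  simp only [EuclideanSpace.norm_sq_eq] at h ⊢
  simp only [sum_fin_two_prod] at h
  have e1 : ∀ μ, Matrix.toEuclideanLin Q X (1, μ) = Matrix.toEuclideanLin (estBlock n S m L) x μ :=
    fun μ => by
    rw [toEuclideanLin_apply_apply, toEuclideanLin_apply_apply, sum_fin_two_prod]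
    simp [hX, estBlock, hQdef]
  have e2 : ∀ μ, X (0, μ) = x μ := fun μ => by simp [hX]
  have e3 : ∀ μ, X (1, μ) = 0 := fun μ => by simp [hX]
  simp only [e1, e2, e3, norm_zero, ne_eq, OfNat.ofNat_ne_zero, not_false_eq_true, zero_pow,
    Finset.sum_const_zero, add_zero] at h
  exact (le_add_of_nonneg_left (Finset.sum_nonneg fun μ _ => sq_nonneg _)).trans h

theorem estMat_norm_le (hL : 1 ≤ L) (hn : 1 ≤ n) (hm : 1 ≤ m)
    (hS : ∀ p q : Fin 2 × Maj n, S (flatIdx p * (4 * n) + flatIdx q) =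
      (((p.1 : ℕ) : ℤ) - ((q.1 : ℕ) : ℤ)) * G p.2 q.2)
    (hG : ∀ μ ν, G μ ν = -G ν μ) (hGm : ∀ μ ν, |G μ ν| ≤ m) (x : MajSpace n) :
    ‖Matrix.toEuclideanLin (estMat n S m L) x‖ ≤ ‖x‖ := by
  have h1 := estBlock_norm_le hL hn hm hS hG hGm
  have h2 := norm_transpose_le h1 x
  rw [estMat, map_smul, LinearMap.smul_apply, map_sub, LinearMap.sub_apply, norm_smul]
  have h3 := (norm_sub_le _ _).trans (add_le_add (h1 x) h2)
  have h4 : ‖(1 / 2 : ℝ)‖ = 1 / 2 := by norm_num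
  rw [h4]
  linarith

/-- The dilation doubles the squared error `4 n ^ 2 t ^ 2` of the estimates, clipping doubles it
again and adds `2 η ^ 2` for each of the `4n` eigenvalues. Passing to a block and to the
antisymmetric part does not increase the error. -/
theorem sum_sq_estMat_sub_le (hL : 1 ≤ L) (hn : 1 ≤ n) (hm : 1 ≤ m)
    (hS : ∀ p q : Fin 2 × Maj n, S (flatIdx p * (4 * n) + flatIdx q) =
      (((p.1 : ℕ) : ℤ) - ((q.1 : ℕ) : ℤ)) * G p.2 q.2)
    (hG : ∀ μ ν, G μ ν = -G ν μ) (hGm : ∀ μ ν, |G μ ν| ≤ m) {A : Matrix (Maj n) (Maj n) ℝ}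
    (hA : ∀ μ ν, A μ ν = -A ν μ) (hA1 : ∀ x : MajSpace n, ‖Matrix.toEuclideanLin A x‖ ≤ ‖x‖)
    {t η : ℝ} (hGA : ∀ μ ν, |(G μ ν : ℝ) / m - A μ ν| ≤ t) (hη : 0 < η)
    (hηL : ((4 * n : ℕ) : ℝ) ^ 2 / (2 * η * L) ≤ η / 2) :
    ∑ μ, ∑ ν, (estMat n S m L μ ν - A μ ν) ^ 2 ≤ 16 * n ^ 2 * t ^ 2 + 8 * n * η ^ 2 := by
  obtain ⟨u, α, hα, hα1, hQ⟩ := exists_actsOn_layers hL hn hm hS hG hGm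
  set Q := ((L : ℝ) * (2 * (4 * n * m : ℕ)) ^ L)⁻¹ • layerMat n S m L L 0 with hQdef
  have hm0 : (m : ℝ) ≠ 0 := by
    have : 0 < m := hm
    exact_mod_cast this.ne'
  have hn0 : (n : ℝ) ≠ 0 := by
    have : 0 < n := hn
    exact_mod_cast this.ne'
  have hα' : ActsOn u ((m : ℝ)⁻¹ • flatMat n S) fun i => α i / m := fun i => by
    rw [map_smul, LinearMap.smul_apply, hα i, smul_smul]
    show _ = (α i / m) • u i
    rw [div_eq_inv_mul]
  -- The nodes carry the slope `w = 4n`, because the argument is scaled by `4nm` while the estimate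
  -- is scaled by `m`.
  have hη' : ∀ i, |deCasteljau (fun k => clip ((4 * n : ℕ) * (2 * k - L) / L))
      (α i / (4 * n * m : ℕ)) L 0 - clip (α i / m)| ≤ η := fun i => by
    have h := abs_deCasteljau_clip_sub_le hL (w := (4 * n : ℕ)) hη (hα1 i)
    have e : ((4 * n : ℕ) : ℝ) * (α i / (4 * n * m : ℕ)) = α i / m := by
      push_cast
      field_simp
    rw [e] at h
    exact h.trans (by linarith)
  have key := hα'.sum_sq_sub_le hQ (dilMat_isSymm hA) (dilMat_norm_le hA1) hη'
  have e1 : ∑ p, ∑ q, (((m : ℝ)⁻¹ • flatMat n S) p q - dilMat A p q) ^ 2 ≤ 8 * n ^ 2 * t ^ 2 := by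
    have h1 : ∀ p q : Fin 2 × Maj n, ((m : ℝ)⁻¹ • flatMat n S) p q - dilMat A p q =
        (((p.1 : ℕ) : ℝ) - ((q.1 : ℕ) : ℝ)) * ((G p.2 q.2 : ℝ) / m - A p.2 q.2) := fun p q => by
      rw [flatMat_eq_dilMat hS]
      simp only [dilMat, Matrix.smul_apply, Matrix.of_apply, smul_eq_mul]
      ring
    have h2 : ∑ μ, ∑ ν, ((G μ ν : ℝ) / m - A μ ν) ^ 2 ≤ ∑ _μ : Maj n, ∑ _ν : Maj n, t ^ 2 :=
      Finset.sum_le_sum fun μ _ => Finset.sum_le_sum fun ν _ => by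
        rw [← sq_abs]; exact pow_le_pow_left₀ (abs_nonneg _) (hGA μ ν) 2
    have h3 : ∑ _μ : Maj n, ∑ _ν : Maj n, t ^ 2 = 4 * n ^ 2 * t ^ 2 := by
      simp
      ring
    simp only [h1, Fintype.sum_prod_type (f := fun p : Fin 2 × Maj n => _), Fin.sum_univ_two]
    simp only [Fin.val_zero, Fin.val_one, Nat.cast_zero, Nat.cast_one, sub_self, zero_mul,
      zero_sub, sub_zero, one_mul, neg_mul, neg_sq, ne_eq, OfNat.ofNat_ne_zero,
      not_false_eq_true, zero_pow, Finset.sum_const_zero, zero_add, add_zero]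
    linarith
  have e2 : (Fintype.card (Fin 2 × Maj n) : ℝ) = 4 * n := by
    simp
    ring
  rw [e2] at key
  have e3 : ∑ μ, ∑ ν, (estBlock n S m L μ ν - A μ ν) ^ 2 ≤ ∑ p, ∑ q, (Q p q - dilMat A p q) ^ 2 := by
    rw [sum_fin_two_prod]
    refine le_trans ?_ (le_add_of_nonneg_left (Finset.sum_nonneg fun μ _ =>
      Finset.sum_nonneg fun q _ => sq_nonneg _))
    refine Finset.sum_le_sum fun μ _ => ?_
    rw [sum_fin_two_prod]
    refine le_trans (le_of_eq ?_) (le_add_of_nonneg_right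
      (Finset.sum_nonneg fun q _ => sq_nonneg _))
    refine Finset.sum_congr rfl fun ν _ => ?_
    simp [estBlock, dilMat, hQdef]
  have e4 : ∑ μ, ∑ ν, (estMat n S m L μ ν - A μ ν) ^ 2 ≤
      ∑ μ, ∑ ν, (estBlock n S m L μ ν - A μ ν) ^ 2 := by
    set d : Maj n → Maj n → ℝ := fun μ ν => estBlock n S m L μ ν - A μ ν with hd
    have h1 : ∀ μ ν, estMat n S m L μ ν - A μ ν = (d μ ν - d ν μ) / 2 := fun μ ν => by
      simp only [hd, estMat, Matrix.smul_apply, Matrix.sub_apply, Matrix.transpose_apply,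
        smul_eq_mul]
      rw [hA ν μ]
      ring
    have h2 : ∑ μ, ∑ ν, d ν μ ^ 2 = ∑ μ, ∑ ν, d μ ν ^ 2 := Finset.sum_comm
    calc ∑ μ, ∑ ν, (estMat n S m L μ ν - A μ ν) ^ 2
        ≤ ∑ μ, ∑ ν, (1 / 2 * d μ ν ^ 2 + 1 / 2 * d ν μ ^ 2) :=
          Finset.sum_le_sum fun μ _ => Finset.sum_le_sum fun ν _ => by
            rw [h1]
            nlinarith [sq_nonneg (d μ ν + d ν μ)]
      _ = ∑ μ, ∑ ν, d μ ν ^ 2 := by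
          simp only [Finset.sum_add_distrib, ← Finset.mul_sum]
          rw [h2]
          ring
  linarith

end FreeFermion

/-! ### From memory contents to estimates, descriptions and inputs. -/

open FreeFermion
open scoped Matrix

namespace FreeFermion

variable {n : ℕ}

/-! ### The estimates of the correlations -/

theorem pairKey_majIdx (μ : Maj n) : pairKey (majIdx μ) = 2 * μ.1 + 1 - μ.2 := by
  have := μ.2.2
  rw [pairKey, majIdx_div, majIdx]
  omega

theorem corrEst_antisymm (I : Mem) (n m x y : ℕ) : corrEst I n m x y = -corrEst I n m y x := by
  unfold corrEst
  split_ifs <;> omega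

theorem dilEst_flatIdx (I : Mem) (m : ℕ) (p q : Fin 2 × Maj n) :
    dilEst I n m (flatIdx p * (4 * n) + flatIdx q) =
      (((p.1 : ℕ) : ℤ) - ((q.1 : ℕ) : ℤ)) * corrEst I n m (majIdx p.2) (majIdx q.2) := by
  have hq := flatIdx_lt q
  have h1 : (flatIdx p * (4 * n) + flatIdx q) / (4 * n) = flatIdx p := by
    rw [mul_comm, Nat.mul_add_div (by omega), Nat.div_eq_of_lt hq, add_zero]
  have h2 : (flatIdx p * (4 * n) + flatIdx q) % (4 * n) = flatIdx q := by
    rw [mul_comm, Nat.mul_add_mod, Nat.mod_eq_of_lt hq]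
  rw [dilEst, h1, h2, flatIdx_div, flatIdx_div, flatIdx_mod, flatIdx_mod]

theorem corrSign_mul_self (k l a b : ℕ) : corrSign k l a b * corrSign k l a b = 1 := by
  rw [corrSign]; split_ifs <;> norm_num

/-- The ordering by `pairKey` puts `(k, 1)` before `(k, 0)`, which is exactly the range of pairs the
circuits treat. Other pairs follow by antisymmetry, and equal ones are zero on both sides. -/
theorem abs_corrEst_div_sub_le {I : Mem} {N m : ℕ} {x : Fin N → Basis n} (hI : HoldsRecord I x)
    (hm : 0 < m) (hN : 4 * n * m ≤ N) {A : Matrix (Maj n) (Maj n) ℝ}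
    (hA : ∀ μ ν, A μ ν = -A ν μ) {t : ℝ}
    (hx : ∀ (k l : Fin n) (a b : Fin 2), (k < l ∨ k = l ∧ a = 1 ∧ b = 0) →
      |∑ i ∈ batch N m (2 * (k + l) + if a = b then 1 else 0), (signValue k l a (x i) : ℝ) -
        m * (corrSign k l a b * A (k, a) (l, b))| ≤ m * t) (ht : 0 ≤ t) (μ ν : Maj n) :
    |(corrEst I n m (majIdx μ) (majIdx ν) : ℝ) / m - A μ ν| ≤ t := by
  have hm' : (0 : ℝ) < m := by exact_mod_cast hm
  have hord : ∀ μ ν : Maj n, pairKey (majIdx μ) < pairKey (majIdx ν) →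
      |(ordEst I n m (majIdx μ) (majIdx ν) : ℝ) / m - A μ ν| ≤ t := fun μ ν h => by
    obtain ⟨k, a⟩ := μ
    obtain ⟨l, b⟩ := ν
    rw [pairKey_majIdx, pairKey_majIdx] at h
    have ha := a.2
    have hb := b.2
    have hc : k < l ∨ k = l ∧ a = 1 ∧ b = 0 := by
      simp only [Fin.lt_def, Fin.ext_iff, Fin.val_one, Fin.val_zero]
      simp only at h
      omega
    have h1 := hx k l a b hc
    set s : ℝ := ∑ i ∈ batch N m (2 * (k + l) + if a = b then 1 else 0), (signValue k l a (x i) : ℝ)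
    have e : (ordEst I n m (majIdx (k, a)) (majIdx (l, b)) : ℝ) = corrSign k l a b * s := by
      rw [ordEst, majIdx_div, majIdx_div, majIdx_mod, majIdx_mod,
        rawEst_eq_sum_batch hI hm hN k l a b, corrSign]
      push_cast
      rfl
    have h2 : ((corrSign k l a b : ℤ) : ℝ) * corrSign k l a b = 1 := by
      exact_mod_cast corrSign_mul_self k l a b
    have h3 : |((corrSign k l a b : ℤ) : ℝ)| = 1 := by
      rw [← sq_eq_sq₀ (abs_nonneg _) zero_le_one, sq_abs, sq, h2, one_pow]
    have h4 : (corrSign k l a b * s) / m - A (k, a) (l, b) =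
        corrSign k l a b * (s - m * (corrSign k l a b * A (k, a) (l, b))) / m := by
      field_simp
      linear_combination (m * A (k, a) (l, b)) * h2
    rw [e, h4, abs_div, abs_mul, h3, one_mul, abs_of_pos hm', div_le_iff₀ hm']
    linarith
  rw [corrEst]
  split_ifs with h1 h2
  · have h := hord ν μ h1
    rw [hA μ ν, ← abs_neg]
    convert h using 2
    push_cast
    ring
  · exact hord μ ν h2
  · have e : μ = ν := by
      have h := pairKey_majIdx μ
      have h' := pairKey_majIdx ν
      have ha := μ.2.2
      have hb := ν.2.2
      refine Prod.ext (Fin.ext ?_) (Fin.ext ?_) <;> omega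
    subst e
    have : A μ μ = 0 := by linarith [hA μ μ]
    rw [this]
    simpa using ht

/-! ### Descriptions of states -/

theorem map_majIdx_finRange (n : ℕ) :
    (List.finRange n ×ˢ List.finRange 2).map majIdx = List.range (2 * n) := by
  have h1 : (List.finRange n ×ˢ List.finRange 2).map majIdx =
      ((List.finRange n).map Fin.val).flatMap fun k => [2 * k, 2 * k + 1] := by
    simp only [SProd.sprod, List.product, List.map_flatMap, List.flatMap_map, List.map_map]
    rfl
  rw [h1, List.map_coe_finRange_eq_range]
  clear h1
  induction n with
  | zero => rfl
  | succ n ih =>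
    rw [List.range_succ, List.flatMap_append, ih, show 2 * (n + 1) = 2 * n + 1 + 1 by ring,
      List.range_succ, List.range_succ]
    simp

theorem rowMajor_majIdx (f : ℕ → ℕ → ℤ) :
    rowMajor (Matrix.of fun μ ν : Maj n => f (majIdx μ) (majIdx ν)) =
      (List.range (2 * n)).flatMap fun i => (List.range (2 * n)).flatMap fun j => [f i j] := by
  rw [← map_majIdx_finRange, List.flatMap_map, rowMajor]
  congr 1
  funext μ
  rw [List.flatMap_map, List.map_eq_flatMap]
  rfl

/-! ### Input memories -/

theorem getD_flatMap_finRange {N : ℕ} (f : Fin N → Fin n → ℤ) (i : Fin N) (q : Fin n) :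
    ((List.finRange N).flatMap fun i => (List.finRange n).map fun q => f i q).getD
      ((i : ℕ) * n + q) 0 = f i q := by
  have h1 : ((List.finRange N).flatMap fun i => (List.finRange n).map fun q => f i q) =
      List.ofFn fun c : Fin (N * n) => f c.divNat c.modNat := by
    rw [List.ofFn_mul, List.flatMap, List.ofFn_eq_map]
    congr 1
    refine List.map_congr_left fun i _ => ?_
    rw [List.ofFn_eq_map]
    refine List.map_congr_left fun q _ => ?_
    congr 1
    · ext
      simp only [Fin.divNat]
      rw [mul_comm, Nat.mul_add_div (by have := q.2; omega), Nat.div_eq_of_lt q.2, add_zero]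
    · ext
      simp only [Fin.modNat]
      rw [mul_comm, Nat.mul_add_mod, Nat.mod_eq_of_lt q.2]
  have h2 : (i : ℕ) * n + q < N * n := by
    have := i.2
    have := q.2
    nlinarith
  rw [h1, List.getD_eq_getElem _ _ (by simpa using h2), List.getElem_ofFn]
  congr 1
  · ext
    simp only [Fin.divNat]
    rw [mul_comm, Nat.mul_add_div (by have := q.2; omega), Nat.div_eq_of_lt q.2, add_zero]
  · ext
    simp only [Fin.modNat]
    rw [mul_comm, Nat.mul_add_mod, Nat.mod_eq_of_lt q.2]

/-- The three parameters precede the bits, hence the offset `3` in all bit addresses. -/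
theorem inputMem_three_add (u v w : ℤ) (xs : List ℤ) (c : ℕ) :
    inputMem ([u, v, w] ++ xs) (3 + c) = xs.getD c 0 := by
  rw [inputMem, if_pos (by omega), show ((3 : ℤ) + c).toNat = c + 1 + 1 + 1 by omega]
  rfl

theorem holdsRecord_inputMem {Cs : List (Circuit n)} (u v w : ℤ) (x : Outcomes Cs) :
    HoldsRecord (inputMem ([u, v, w] ++ outcomesCode x)) x := fun i q => by
  rw [show (3 : ℤ) + (i : ℕ) * n + (q : ℕ) = 3 + ((i * n + q : ℕ) : ℤ) by push_cast; ring,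
    inputMem_three_add, outcomesCode, getD_flatMap_finRange]

theorem inputMem_bit {Cs : List (Circuit n)} (u v w : ℤ) (x : Outcomes Cs) (c : ℤ) (hc : 3 ≤ c) :
    inputMem ([u, v, w] ++ outcomesCode x) c = 0 ∨ inputMem ([u, v, w] ++ outcomesCode x) c = 1 := by
  obtain ⟨c, rfl⟩ : ∃ d : ℕ, c = 3 + d := ⟨(c - 3).toNat, by omega⟩
  rw [inputMem_three_add]
  by_cases h : c < (outcomesCode x).length
  · rw [List.getD_eq_getElem _ _ h]
    have h1 := List.getElem_mem h
    generalize (outcomesCode x)[c] = z at h1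
    simp only [outcomesCode, List.mem_flatMap, List.mem_map] at h1
    obtain ⟨i, -, q, -, rfl⟩ := h1
    have := (x i q).2
    omega
  · rw [List.getD_eq_default _ _ (by omega)]
    exact Or.inl rfl

theorem memBd_inputMem {β : ℕ} {u v w : ℕ} (hu : u ≤ 2 ^ β) (hv : v ≤ 2 ^ β) (hw : w ≤ 2 ^ β)
    {xs : List ℤ}
    (hx : ∀ c, 3 ≤ c → inputMem ([(u : ℤ), (v : ℤ), (w : ℤ)] ++ xs) c = 0 ∨
      inputMem ([(u : ℤ), (v : ℤ), (w : ℤ)] ++ xs) c = 1) :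
    MemBd β (inputMem ([(u : ℤ), (v : ℤ), (w : ℤ)] ++ xs)) := fun c => by
  have hp : (1 : ℤ) ≤ 2 ^ β := one_le_pow₀ (by norm_num)
  rcases lt_or_ge c 0 with h | h
  · rw [inputMem, if_neg (by omega), abs_zero]
    positivity
  rcases lt_or_ge c 3 with h3 | h3
  · interval_cases c
    · exact (abs_of_nonneg (Int.natCast_nonneg u)).trans_le (by exact_mod_cast hu)
    · exact (abs_of_nonneg (Int.natCast_nonneg v)).trans_le (by exact_mod_cast hv)
    · exact (abs_of_nonneg (Int.natCast_nonneg w)).trans_le (by exact_mod_cast hw)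
  · rcases hx c h3 with e | e <;> rw [e]
    · rw [abs_zero]; positivity
    · rw [abs_one]; exact hp

end FreeFermion

/-! ### Choice of the parameters, correctness and resources. -/

open FreeFermion
open scoped Matrix

namespace FreeFermion

variable {n : ℕ}

/-! ### Correctness of the estimates -/

/-- The output of the classical processing on the record `x`. -/
def description (n a b : ℕ) (I : Mem) : List ℤ :=
  ((2 * degParam n a * (2 * (4 * n * repetitions n a b)) ^ degParam n a : ℕ) : ℤ) ::
    (List.range (2 * n)).flatMap fun i => (List.range (2 * n)).flatMap fun j =>
      [outEntry (layers (dilEst I n (repetitions n a b)) n (repetitions n a b) (degParam n a)) n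
        (degParam n a) i j]

/-- The memory of the classical processing, with the parameters and the record `x`. -/
def recordMem {Cs : List (Circuit n)} (a b : ℕ) (x : Outcomes Cs) : Mem :=
  inputMem ([(n : ℤ), (a : ℤ), (b : ℤ)] ++ outcomesCode x)

theorem lt_two_pow_logParam (n b : ℕ) : 8 * n * n * b < 2 ^ logParam n b := Nat.lt_size_self _

theorem degParam_pos {a : ℕ} (hn : 1 ≤ n) (ha : 1 ≤ a) : 1 ≤ degParam n a := by
  rw [degParam]
  exact Nat.succ_le_of_lt (by positivity)

theorem logParam_pos {b : ℕ} (hn : 1 ≤ n) (hb : 1 ≤ b) : 1 ≤ logParam n b := by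
  rw [logParam, Nat.succ_le_iff, Nat.size_pos]
  positivity

theorem repetitions_pos {a b : ℕ} (hn : 1 ≤ n) (ha : 1 ≤ a) (hb : 1 ≤ b) :
    1 ≤ repetitions n a b := by
  have := logParam_pos hn hb
  rw [repetitions]
  exact Nat.succ_le_of_lt (by positivity)

/-- By the choice of the bit length, `8 n ^ 2 b < 2 ^ ℓ ≤ exp ℓ`, and `b δ ≥ 1`. -/
theorem eight_mul_exp_neg_le {b : ℕ} {δ : ℝ} (hn : 1 ≤ n) (hδ : 0 < δ) (hb : 1 / δ ≤ b) :
    8 * (n : ℝ) ^ 2 * Real.exp (-(logParam n b)) ≤ δ := by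
  have h1 : (8 * n * n * b : ℝ) ≤ 2 ^ logParam n b := by
    exact_mod_cast (lt_two_pow_logParam n b).le
  have h2 : (2 : ℝ) ^ logParam n b ≤ Real.exp (logParam n b) := by
    rw [← Real.exp_one_pow]
    exact pow_le_pow_left₀ (by norm_num) (by linarith [Real.add_one_le_exp 1]) _
  have h3 : 1 ≤ b * δ := by rwa [div_le_iff₀ hδ] at hb
  rw [Real.exp_neg, ← div_eq_mul_inv, div_le_iff₀ (Real.exp_pos _)]
  have h4 : (0 : ℝ) ≤ 8 * n ^ 2 := by positivity
  nlinarith [mul_le_mul_of_nonneg_left h3 h4, mul_le_mul_of_nonneg_left (h1.trans h2) hδ.le]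

theorem exists_estimator {a b : ℕ} {ε δ : ℝ} (hn : 1 ≤ n) (ha : 1 ≤ a) (hb : 1 ≤ b) (hε : 0 < ε)
    (hδ : 0 < δ) (haε : 1 / ε ≤ a) (hbδ : 1 / δ ≤ b) :
    ∃ est : Outcomes (measurement n (repetitions n a b)) → Op n,
      (∀ x, Describes (description n a b (recordMem a b x)) (est x)) ∧
        ∀ ρ : Op n, IsFreeFermionic ρ →
          1 - δ ≤ recordProb ρ (measurement n (repetitions n a b))
            fun x => traceNorm (est x - ρ) ≤ ε := by
  set m := repetitions n a b with hm
  set L := degParam n a with hL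
  have hm1 : 1 ≤ m := repetitions_pos hn ha hb
  have hL1 : 1 ≤ L := degParam_pos hn ha
  have hS : ∀ (x : Outcomes (measurement n m)) (p q : Fin 2 × Maj n),
      dilEst (recordMem a b x) n m (flatIdx p * (4 * n) + flatIdx q) =
        (((p.1 : ℕ) : ℤ) - ((q.1 : ℕ) : ℤ)) *
          corrEst (recordMem a b x) n m (majIdx p.2) (majIdx q.2) := fun x p q =>
    dilEst_flatIdx _ _ _ _
  have hG : ∀ (x : Outcomes (measurement n m)) (μ ν : Maj n),
      corrEst (recordMem a b x) n m (majIdx μ) (majIdx ν) =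
        -corrEst (recordMem a b x) n m (majIdx ν) (majIdx μ) := fun x μ ν => corrEst_antisymm _ _ _ _ _
  have hGm : ∀ (x : Outcomes (measurement n m)) (μ ν : Maj n),
      |corrEst (recordMem a b x) n m (majIdx μ) (majIdx ν)| ≤ m := fun x μ ν =>
    abs_corrEst_le (inputMem_bit _ _ _ x) _ _ _ _
  -- The printed matrix is an exact antisymmetric contraction for every record, not only for
  -- accurate ones, so a state always exists.
  choose B lam U est hest hfree hmat using fun x : Outcomes (measurement n m) =>
    exists_gaussianForm_of_contraction (estMat n (dilEst (recordMem a b x) n m) m L)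
      estMat_antisymm (estMat_norm_le hL1 hn hm1 (hS x) (hG x) (hGm x))
  refine ⟨est, fun x => ?_, fun ρ hρ => ?_⟩
  · refine ⟨_, _, ?_, congrArg _ (rowMajor_majIdx _).symm, hfree x, ?_⟩
    · have : 0 < 2 * L * (2 * (4 * n * m)) ^ L := by positivity
      exact_mod_cast this
    · ext μ ν
      rw [(hest x).correlationMatrix_eq, ← hmat x, estMat_apply, Matrix.of_apply, Matrix.of_apply]
      push_cast
      rfl
  · obtain ⟨B₀, lam₀, U₀, hρ⟩ := hρ.exists_gaussianForm
    have hn0 : (0 : ℝ) < n := by exact_mod_cast hn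
    have ha0 : (0 : ℝ) < a := by exact_mod_cast ha
    have hn1 : (1 : ℝ) ≤ n := by exact_mod_cast hn
    have ha1 : (1 : ℝ) ≤ a := by exact_mod_cast ha
    have hmR : (m : ℝ) = 256 * n * n * n * a * a * logParam n b := by
      rw [hm, repetitions]; push_cast; ring
    have hLR : (L : ℝ) = 144 * n * n * n * n * a * a := by
      rw [hL, degParam]; push_cast; ring
    -- Chosen so that `16 n ^ 3 t ^ 2 = 1 / a ^ 2`; with this `t` the Chernoff exponent `m t ^ 2 /
    -- 16` is exactly the bit length `logParam n b`.
    set t : ℝ := 1 / (4 * n * a * Real.sqrt n) with ht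
    have hs : Real.sqrt n ^ 2 = n := Real.sq_sqrt hn0.le
    have hs1 : 1 ≤ Real.sqrt n := Real.one_le_sqrt.2 hn1
    have ht2 : t ^ 2 = 1 / (16 * n ^ 3 * a ^ 2) := by
      rw [ht, div_pow, mul_pow, hs]
      ring
    have ht0 : 0 ≤ t := by positivity
    have ht1 : t ≤ 1 := by
      have h : t ^ 2 ≤ 1 := by
        rw [ht2, div_le_one (by positivity)]
        have := one_le_pow₀ hn1 (n := 3)
        have := one_le_pow₀ ha1 (n := 2)
        nlinarith
      nlinarith
    refine le_trans ?_ (hρ.one_sub_le_recordProb (m := m) hm1 ht0 ht1 _ fun x hx => ?_)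
    · have h1 : (m : ℝ) * t ^ 2 / 16 = logParam n b := by
        rw [hmR, ht2]
        field_simp
        ring
      rw [h1]
      linarith [eight_mul_exp_neg_le hn hδ hbδ]
    · have hacc := abs_corrEst_div_sub_le (holdsRecord_inputMem (n : ℤ) (a : ℤ) (b : ℤ) x) hm1
        (measurement_length n m).ge (skewForm_antisymm B₀ lam₀) hx ht0
      -- With degree `L = 144 n ^ 4 a ^ 2` and slope `4n`, the variance term equals `η / 2`.
      set η : ℝ := 1 / (3 * n * a) with hη
      have hη0 : 0 < η := by positivity
      have hsum := sum_sq_estMat_sub_le hL1 hn hm1 (hS x) (hG x) (hGm x) (skewForm_antisymm B₀ lam₀)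
        (norm_skewForm_le B₀ hρ.bound) hacc hη0 (by
          rw [hη, hLR]
          push_cast
          apply le_of_eq
          field_simp
          norm_num)
      have htr := hρ.traceNorm_sub_sq_le (hest x)
      rw [← hmat x] at htr
      -- The two errors contribute `1` and `8 / 9`. The sum `17 / 9` is below the factor `2` in the
      -- trace norm bound, which leaves `1 / a ≤ ε`.
      have h1 : (n : ℝ) * (16 * n ^ 2 * t ^ 2 + 8 * n * η ^ 2) = 17 / 9 * (1 / (a : ℝ)) ^ 2 := by
        rw [ht2, hη]
        field_simp
        norm_num
      have h2 := htr.trans (mul_le_mul_of_nonneg_left hsum hn0.le)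
      rw [h1] at h2
      have h3 : traceNorm (est x - ρ) ≤ 1 / a :=
        le_of_sq_le_sq (by nlinarith [sq_nonneg (1 / (a : ℝ))]) (by positivity)
      refine h3.trans ?_
      rw [div_le_iff₀ ha0]
      rw [div_le_iff₀ hε] at haε
      linarith

/-! ### Resources -/

/-- A bound for the lengths of the loops. -/
def loopBound (n a b : ℕ) : ℕ :=
  4 * n * repetitions n a b +
    (degParam n a * ((degParam n a + 1) * (4 * n * (4 * n))) + 4 * n * (4 * n)) + logParam n b + 1

/-- A bound for the bit lengths of the numbers. -/
def bitBound (n a b : ℕ) : ℕ := (loopBound n a b + 2) * (loopBound n a b + 2)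

theorem le_two_pow_bitBound {n a b c : ℕ} (h : c ≤ loopBound n a b) : c ≤ 2 ^ bitBound n a b := by
  refine h.trans (Nat.lt_two_pow_self.le.trans (Nat.pow_le_pow_right (by norm_num) ?_))
  rw [bitBound]
  nlinarith

/-- Each base is at most `2 ^ (Y + 2)` and each exponent at most `Y`, so `(Y + 2) ^ 2` bits suffice
for all powers, including their prefactors. -/
theorem paramBounds {a b : ℕ} (hn : 1 ≤ n) (ha : 1 ≤ a) (hb : 1 ≤ b) :
    ParamBounds n (repetitions n a b) (degParam n a) (bitBound n a b) (loopBound n a b) := by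
  have hm1 := repetitions_pos hn ha hb
  have hL1 := degParam_pos hn ha
  have hℓ := logParam_pos hn hb
  have hY : loopBound n a b = 4 * n * repetitions n a b +
    (degParam n a * ((degParam n a + 1) * (4 * n * (4 * n))) + 4 * n * (4 * n)) +
      logParam n b + 1 := rfl
  set m := repetitions n a b
  set L := degParam n a
  set Y := loopBound n a b with hYdef
  set T := L * ((L + 1) * (4 * n * (4 * n))) + 4 * n * (4 * n) with hT
  have hLT : L ≤ T := by
    have : L * 1 ≤ L * ((L + 1) * (4 * n * (4 * n))) := Nat.mul_le_mul_left _ (by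
      have : 0 < (L + 1) * (4 * n * (4 * n)) := by positivity
      omega)
    omega
  have hYp : Y ≤ 2 ^ Y := Nat.lt_two_pow_self.le
  have hpow : ∀ c d : ℕ, c ≤ 4 → d ≤ Y → (c * (4 * n * m)) ^ d ≤ 2 ^ ((Y + 2) * Y) := fun c d hc hd => by
    have h1 : c * (4 * n * m) ≤ 2 ^ (Y + 2) := by
      rw [pow_add, mul_comm]
      exact Nat.mul_le_mul (le_trans (by omega) hYp) hc
    calc (c * (4 * n * m)) ^ d ≤ (2 ^ (Y + 2)) ^ d := Nat.pow_le_pow_left h1 d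
      _ = 2 ^ ((Y + 2) * d) := (pow_mul _ _ _).symm
      _ ≤ _ := Nat.pow_le_pow_right (by norm_num) (Nat.mul_le_mul_left _ hd)
  have hβ : 1 + Y + (Y + 2) * Y ≤ bitBound n a b := by
    rw [bitBound, ← hYdef]
    nlinarith
  refine ⟨hn, hm1, ?_, by omega, by omega, by omega, le_two_pow_bitBound le_rfl, ?_, ?_⟩
  · nlinarith
  · calc L * (4 * (4 * n * m)) ^ T ≤ 2 ^ Y * 2 ^ ((Y + 2) * Y) :=
          Nat.mul_le_mul (le_trans (by omega) hYp) (hpow 4 T le_rfl (by omega))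
      _ = 2 ^ (Y + (Y + 2) * Y) := (pow_add _ _ _).symm
      _ ≤ _ := Nat.pow_le_pow_right (by norm_num) (by omega)
  · calc 2 * L * (2 * (4 * n * m)) ^ L ≤ 2 ^ (1 + Y) * 2 ^ ((Y + 2) * Y) :=
          Nat.mul_le_mul (by
            rw [pow_add, pow_one]
            exact Nat.mul_le_mul_left _ (le_trans (by omega) hYp)) (hpow 2 L (by norm_num) (by omega))
      _ = 2 ^ (1 + Y + (Y + 2) * Y) := (pow_add _ _ _).symm
      _ ≤ _ := Nat.pow_le_pow_right (by norm_num) hβ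

theorem param_le_two_pow_bitBound {a b : ℕ} (hn : 1 ≤ n) (ha : 1 ≤ a) :
    n ≤ 2 ^ bitBound n a b ∧ a ≤ 2 ^ bitBound n a b ∧ b ≤ 2 ^ bitBound n a b := by
  have h1 : n ≤ 4 * n * (4 * n) := by nlinarith
  have h2 : a ≤ degParam n a := by
    rw [degParam]
    exact Nat.le_mul_of_pos_left a (by positivity)
  have h3 : degParam n a * 1 ≤ degParam n a * ((degParam n a + 1) * (4 * n * (4 * n))) :=
    Nat.mul_le_mul_left _ (by
      have : 0 < (degParam n a + 1) * (4 * n * (4 * n)) := by positivity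
      omega)
  have h4 : b ≤ 8 * n * n * b := Nat.le_mul_of_pos_left b (by positivity)
  refine ⟨le_two_pow_bitBound ?_, le_two_pow_bitBound ?_, ?_⟩
  · rw [loopBound]; omega
  · rw [loopBound]; omega
  · refine h4.trans ((lt_two_pow_logParam n b).le.trans (Nat.pow_le_pow_right (by norm_num) ?_))
    have : logParam n b ≤ loopBound n a b := by rw [loopBound]; omega
    rw [bitBound]
    nlinarith

theorem prepProg_computes {a b : ℕ} (hn : 1 ≤ n) (ha : 1 ≤ a) (hb : 1 ≤ b) :
    ∃ t ≤ prepProg.wt * loopBound n a b ^ prepProg.depth * (bitBound n a b + 1),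
      Computes prepProg [(n : ℤ), (a : ℤ), (b : ℤ)] t
        (circuitsCode (measurement n (repetitions n a b))) := by
  have hP := paramBounds hn ha hb
  obtain ⟨hn', ha', hb'⟩ := param_le_two_pow_bitBound (b := b) hn ha
  have hM := memBd_inputMem hn' ha' hb' (xs := []) fun c hc => Or.inl (by
    obtain ⟨c, rfl⟩ : ∃ d : ℕ, c = 3 + d := ⟨(c - 3).toNat, by omega⟩
    rw [inputMem_three_add]
    rfl)
  have hY : logParam n b + 1 ≤ loopBound n a b := by rw [loopBound]; omega
  have hm := hP.hm
  obtain ⟨M', h⟩ := prepProg_runs (n := n) (a := a) (b := b) hY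
    (by rw [bitBound]; nlinarith) (le_two_pow_bitBound (by omega))
    (by rw [loopBound]; omega) (by linarith [hP.hW]) hP.hY hM rfl rfl rfl
  obtain ⟨-, t, ht, hex⟩ := h hM
  rw [circuitsCode_measurement]
  exact ⟨t, ht, M', hex⟩

theorem postProg_computes {a b : ℕ} (hn : 1 ≤ n) (ha : 1 ≤ a) (hb : 1 ≤ b)
    {Cs : List (Circuit n)} (x : Outcomes Cs) :
    ∃ t ≤ postProg.wt * loopBound n a b ^ postProg.depth * (bitBound n a b + 1),
      Computes postProg ([(n : ℤ), (a : ℤ), (b : ℤ)] ++ outcomesCode x) t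
        (description n a b (recordMem a b x)) := by
  obtain ⟨hn', ha', hb'⟩ := param_le_two_pow_bitBound (b := b) hn ha
  have hbit := inputMem_bit (n : ℤ) (a : ℤ) (b : ℤ) x
  have hM := memBd_inputMem hn' ha' hb' hbit
  have hY : logParam n b + 1 ≤ loopBound n a b := by rw [loopBound]; omega
  obtain ⟨M', h⟩ := postProg_runs (paramBounds hn ha hb) (degParam_pos hn ha) hY
    (by rw [bitBound]; nlinarith) hM rfl rfl rfl hbit
  obtain ⟨-, t, ht, hex⟩ := h hM
  exact ⟨t, ht, M', hex⟩

/-- From `2 ^ (ℓ - 1) ≤ 8 n ^ 2 b ≤ 4 Λ'` with `Λ' = 4 n ^ 2 / δ`; since `Λ' ≥ 4`, the additive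
constants are absorbed into `log Λ'`. -/
theorem logParam_le {b : ℕ} {δ : ℝ} (hn : 1 ≤ n) (hb : 1 ≤ b) (hδ : 0 < δ) (hδ1 : δ ≤ 1)
    (hbδ : b ≤ 2 / δ) : (logParam n b : ℝ) ≤ 5 * Real.log (4 * (n : ℝ) ^ 2 / δ) := by
  have hn1 : (1 : ℝ) ≤ n := by exact_mod_cast hn
  have hℓ := logParam_pos hn hb
  have h1 : 2 ^ (logParam n b - 1) ≤ 8 * n * n * b := by
    rw [← Nat.lt_size, ← logParam]
    omega
  have h2 : (2 : ℝ) ^ (logParam n b - 1) ≤ 4 * (4 * (n : ℝ) ^ 2 / δ) := by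
    have h3 : (2 : ℝ) ^ (logParam n b - 1) ≤ 8 * n * n * b := by exact_mod_cast h1
    refine h3.trans ((mul_le_mul_of_nonneg_left hbδ (by positivity)).trans_eq ?_)
    ring
  have hbase : 4 ≤ 4 * (n : ℝ) ^ 2 / δ := by
    rw [le_div_iff₀ hδ]
    nlinarith [one_le_pow₀ hn1 (n := 2)]
  have h4 := Real.log_le_log (by positivity) h2
  have hl2 := Real.log_two_gt_d9
  have h6 : Real.log 4 = 2 * Real.log 2 := by
    rw [show (4 : ℝ) = 2 ^ 2 by norm_num, Real.log_pow]
    norm_num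
  have h5 := Real.log_le_log (by norm_num) hbase
  rw [Real.log_pow, Real.log_mul (by norm_num) (by positivity), h6] at h4
  rw [h6] at h5
  rw [Nat.cast_sub hℓ, Nat.cast_one] at h4
  set Λ := Real.log (4 * (n : ℝ) ^ 2 / δ)
  have h7 : (0 : ℝ) ≤ logParam n b := by positivity
  by_contra h
  push Not at h
  nlinarith

end FreeFermion

/-! ### Polynomial running time and the final theorem. -/

open FreeFermion
open scoped Matrix

namespace FreeFermion

variable {n : ℕ}

/-- The dominating term is the number of layer entries, of order `L ^ 2 n ^ 2`, hence `n ^ 10 a ^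
4`: degree `14`. -/
theorem loopBound_le {a b : ℕ} {X : ℝ} (hX : 1 ≤ X) (hn : (n : ℝ) ≤ X) (ha : a ≤ 2 * X)
    (hℓ : (logParam n b : ℝ) ≤ 20 * X) : (loopBound n a b : ℝ) ≤ 10000000 * X ^ 14 := by
  have hX0 : 0 ≤ X := by linarith
  have h1 : (loopBound n a b : ℝ) = 1024 * n ^ 4 * a ^ 2 * logParam n b +
      (144 * n ^ 4 * a ^ 2 * ((144 * n ^ 4 * a ^ 2 + 1) * (16 * n ^ 2)) + 16 * n ^ 2) +
        logParam n b + 1 := by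
    rw [loopBound, repetitions, degParam]; push_cast; ring
  have h2 : (loopBound n a b : ℝ) ≤ 1024 * X ^ 4 * (2 * X) ^ 2 * (20 * X) +
      (144 * X ^ 4 * (2 * X) ^ 2 * ((144 * X ^ 4 * (2 * X) ^ 2 + 1) * (16 * X ^ 2)) +
        16 * X ^ 2) + 20 * X + 1 := by
    rw [h1]; gcongr
  have hp : ∀ d ≤ 14, X ^ d ≤ X ^ 14 := fun d hd => pow_le_pow_right₀ hX hd
  have e1 := hp 0 (by norm_num)
  have e2 := hp 1 (by norm_num)
  have e3 := hp 2 (by norm_num)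
  have e4 := hp 7 (by norm_num)
  have e5 := hp 8 (by norm_num)
  refine h2.trans ?_
  ring_nf at *
  linarith

/-- The bit length is at most quadratic in the loop bound, which explains the `2` added to the
exponent. -/
theorem time_le {n a b t t' : ℕ} (w w' d d' : ℕ) (hn : 1 ≤ n)
    (ht : t ≤ w * loopBound n a b ^ d * (bitBound n a b + 1))
    (ht' : t' ≤ w' * loopBound n a b ^ d' * (bitBound n a b + 1)) :
    t + quantumOps (measurement n (repetitions n a b)) + t' ≤
      (10 * (w + w') + 1) * loopBound n a b ^ (d + d' + 2) := by
  have hq := quantumOps_measurement_le n (repetitions n a b)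
  have h1 : 4 * n * repetitions n a b ≤ loopBound n a b := by rw [loopBound]; omega
  have h2 : 4 * n ≤ loopBound n a b := by
    have : 4 * n ≤ 4 * n * (4 * n) := Nat.le_mul_of_pos_left _ (by omega)
    rw [loopBound]; omega
  have hβ : bitBound n a b + 1 ≤ 10 * loopBound n a b ^ 2 := by
    rw [bitBound]
    nlinarith
  set Y := loopBound n a b
  have hY : 1 ≤ Y := by omega
  have h3 : t ≤ 10 * w * Y ^ (d + d' + 2) := by
    calc t ≤ w * Y ^ d * (10 * Y ^ 2) := ht.trans (Nat.mul_le_mul_left _ hβ)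
      _ = 10 * w * Y ^ (d + 2) := by ring
      _ ≤ _ := Nat.mul_le_mul_left _ (Nat.pow_le_pow_right hY (by omega))
  have h4 : t' ≤ 10 * w' * Y ^ (d + d' + 2) := by
    calc t' ≤ w' * Y ^ d' * (10 * Y ^ 2) := ht'.trans (Nat.mul_le_mul_left _ hβ)
      _ = 10 * w' * Y ^ (d' + 2) := by ring
      _ ≤ _ := Nat.mul_le_mul_left _ (Nat.pow_le_pow_right hY (by omega))
  have h5 : 4 * n * repetitions n a b * (4 * n) ≤ Y ^ (d + d' + 2) := by
    calc _ ≤ Y * Y := Nat.mul_le_mul h1 h2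
      _ = Y ^ 2 := (sq Y).symm
      _ ≤ _ := Nat.pow_le_pow_right hY (by omega)
  linarith

end FreeFermion

/-- Tomography of mixed free-fermionic states. The algorithm is a pair of programs: on input
`n, ⌈1/ε⌉, ⌈1/δ⌉`, `prep` prints circuits, each of which is run on one fresh copy of the unknown
state and followed by a measurement in the computational basis; from the same input and the
measured bits, `post` prints a classical description of a state. The copies used are as many as
the circuits. -/
theorem theorem7 :
    ∃ (prep post : Prog) (K : ℝ) (c k : ℕ),
      ∀ (n : ℕ) (ε δ : ℝ), 1 ≤ n → 0 < ε → ε < 1 → 0 < δ → δ ≤ 1 →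
        ∃ (Cs : List (Circuit n)) (tPrep tPost : ℕ) (est : Outcomes Cs → Op n),
          -- number of copies
          (Cs.length : ℝ) ≤ K * ((n : ℝ) ^ 4 / ε ^ 2) * Real.log (4 * (n : ℝ) ^ 2 / δ) ∧
          -- the measurements are chosen by the first program
          Computes prep [(n : ℤ), ⌈1 / ε⌉, ⌈1 / δ⌉] tPrep (circuitsCode Cs) ∧
          -- the second program turns every measurement record into a description of a state
          (∀ x : Outcomes Cs, ∃ (t : ℕ) (ys : List ℤ), t ≤ tPost ∧
            Computes post ([(n : ℤ), ⌈1 / ε⌉, ⌈1 / δ⌉] ++ outcomesCode x) t ys ∧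
            Describes ys (est x)) ∧
          -- total running time
          ((tPrep + quantumOps Cs + tPost : ℕ) : ℝ) ≤
            c * ((n : ℝ) + 1 / ε + Real.log (1 / δ)) ^ k ∧
          -- correctness
          ∀ ρ : Op n, IsFreeFermionic ρ →
            1 - δ ≤ recordProb ρ Cs (fun x => traceNorm (est x - ρ) ≤ ε) := by
  -- `20480 = 1024 * 4 * 5`: from `4 n m = 1024 n ^ 4 a ^ 2 ℓ`, `a ≤ 2 / ε` and `ℓ ≤ 5 log (4 n ^ 2
  -- / δ)`.
  refine ⟨prepProg, postProg, 20480,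
    (10 * (prepProg.wt + postProg.wt) + 1) * 10000000 ^ (prepProg.depth + postProg.depth + 2),
    14 * (prepProg.depth + postProg.depth + 2), fun n ε δ hn hε hε1 hδ hδ1 => ?_⟩
  have hε' : 1 < 1 / ε := (one_lt_div hε).2 hε1
  have hδ' : 1 ≤ 1 / δ := (one_le_div hδ).2 hδ1
  obtain ⟨a, ha⟩ := Int.eq_ofNat_of_zero_le (Int.ceil_nonneg (zero_le_one.trans hε'.le))
  obtain ⟨b, hb⟩ := Int.eq_ofNat_of_zero_le (Int.ceil_nonneg (zero_le_one.trans hδ'))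
  have haε : 1 / ε ≤ a := by
    have := Int.le_ceil (1 / ε)
    rw [ha] at this
    exact_mod_cast this
  have hbδ : 1 / δ ≤ b := by
    have := Int.le_ceil (1 / δ)
    rw [hb] at this
    exact_mod_cast this
  -- Rounding up at most doubles a number that is at least `1`.
  have haε' : (a : ℝ) ≤ 2 / ε := by
    have := Int.ceil_lt_add_one (1 / ε)
    rw [ha, Int.cast_natCast] at this
    linarith [show 2 / ε = 1 / ε + 1 / ε by ring]
  have hbδ' : (b : ℝ) ≤ 2 / δ := by
    have := Int.ceil_lt_add_one (1 / δ)
    rw [hb, Int.cast_natCast] at this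
    linarith [show 2 / δ = 1 / δ + 1 / δ by ring]
  have ha1 : 1 ≤ a := by
    have : (1 : ℝ) ≤ a := by linarith
    exact_mod_cast this
  have hb1 : 1 ≤ b := by
    have : (1 : ℝ) ≤ b := by linarith
    exact_mod_cast this
  have hn1 : (1 : ℝ) ≤ n := by exact_mod_cast hn
  have hℓ := logParam_le hn hb1 hδ hδ1 hbδ'
  have hlog : 0 ≤ Real.log (1 / δ) := Real.log_nonneg hδ'
  rw [ha, hb]
  obtain ⟨est, hdesc, hcorrect⟩ := exists_estimator hn ha1 hb1 hε hδ haε hbδ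
  obtain ⟨tPrep, htPrep, hprep⟩ := prepProg_computes hn ha1 hb1
  refine ⟨measurement n (repetitions n a b), tPrep,
    postProg.wt * loopBound n a b ^ postProg.depth * (bitBound n a b + 1), est, ?_, hprep,
    fun x => ?_, ?_, hcorrect⟩
  · rw [measurement_length]
    have h1 : ((4 * n * repetitions n a b : ℕ) : ℝ) = 1024 * n ^ 4 * a ^ 2 * logParam n b := by
      rw [repetitions]; push_cast; ring
    rw [h1]
    calc 1024 * (n : ℝ) ^ 4 * a ^ 2 * logParam n b
        ≤ 1024 * n ^ 4 * (2 / ε) ^ 2 * (5 * Real.log (4 * n ^ 2 / δ)) := by gcongr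
      _ = _ := by ring
  · obtain ⟨t, ht, hpost⟩ := postProg_computes hn ha1 hb1 x
    exact ⟨t, _, ht, hpost, hdesc x⟩
  · set X : ℝ := n + 1 / ε + Real.log (1 / δ) with hX
    have hlogn : Real.log n ≤ n := (Real.log_le_sub_one_of_pos (by linarith)).trans (by linarith)
    have hlog4 : Real.log 4 ≤ 2 := by
      rw [show (4 : ℝ) = 2 ^ 2 by norm_num, Real.log_pow]
      have := Real.log_two_lt_d9
      push_cast
      linarith
    -- The logarithm is at most `2 + 2 n + log (1 / δ)`, and `1 / ε ≥ 1` absorbs the constant.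
    have hΛ : Real.log (4 * (n : ℝ) ^ 2 / δ) ≤ 4 * X := by
      rw [div_eq_mul_one_div, Real.log_mul (by positivity) (by positivity),
        Real.log_mul (by norm_num) (by positivity), Real.log_pow]
      push_cast
      linarith
    have hY := loopBound_le (n := n) (a := a) (b := b) (X := X) (by linarith) (by linarith)
      (haε'.trans (by linarith [show 2 / ε = 2 * (1 / ε) by ring])) (by linarith)
    have ht := time_le prepProg.wt postProg.wt prepProg.depth postProg.depth hn htPrep le_rfl
    refine (Nat.cast_le.2 ht).trans ?_
    generalize prepProg.depth + postProg.depth + 2 = d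
    generalize 10 * (prepProg.wt + postProg.wt) + 1 = w
    rw [Nat.cast_mul, Nat.cast_mul, Nat.cast_pow, Nat.cast_pow, mul_assoc, pow_mul, ← mul_pow]
    exact mul_le_mul_of_nonneg_left (pow_le_pow_left₀ (Nat.cast_nonneg _)
      (by exact_mod_cast hY) d) (Nat.cast_nonneg _)
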